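/- Let $n\ge 0$, let $K_n\subset\mathbb{R}^2$ be the $n$-th closed polygonal curve approximating the Koch snowflake (built outwards on the sides of an equilateral triangle of side $1$, contraction ratio $1/3$), let $\Omega$ be the bounded domain with boundary $K_n$, let $ds$ be the arc length on $K_n$, and let $dm=dx+ds$. Let $$V=\{u\in H^1(\Omega): u|_{K_n}\in H^1(K_n)\},\qquad \|u\|_V^2=\int_\Omega|\nabla u|^2dx+\int_{K_n}|\nabla_s u|^2ds+\|u\|^2_{L^2(\Omega,m)},$$ where $u|_{K_n}$ is the trace (limit of averages over $B_r(x)\cap\Omega$ as $r\to0$) and $\nabla_s$ is the tangential derivative. Let $b$ be a positive continuous function on $\overline\Omega$, let $$\langle\theta_2(u),v\rangle=\iint_{K_n\times K_n}\frac{(u(x)-u(y))(v(x)-v(y))}{|x-y|^2}\,ds(x)\,ds(y),$$ and for $u,v\in V$ let $$E(u,v)=\int_\Omega\nabla u\cdot\nabla v\,dx+\int_{K_n}\nabla_su\,\nabla_sv\,ds+\int_{K_n}b\,u\,v\,ds+\langle\theta_2(u),v\rangle,\qquad E[u]=E(u,u).$$ Call $\bar C>0$ a coercivity constant of $E$ if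 $E[v]\ge\bar C\|v\|_V^2$ for all $v\in V$. Theorem. Coercivity constants of $E$ exist. Moreover there is a constant $\tilde C>0$, depending only on $n$ and $b$, such that the following holds for every coercivity constant $\bar C$ of $E$, every $T>0$, every $f\in C^{0,\alpha}([0,T];L^2(\Omega,m))$ with $\alpha\in(0,1)$, and every strict solution $u$ of $$\begin{cases}\frac{du}{dt}=\Delta u+f&\text{in }\Omega,\\ \frac{du}{dt}=-\frac{\partial u}{\partial\nu}+\Delta_{K_n}u-bu-\theta_2(u)+f&\text{on }K_n,\\ u(0)=u_0,\end{cases}\qquad t\in[0,T].$$ Here a strict solution is a function $u\in C^1([0,T];L^2(\Omega,m))$ with $u(t)\in V$ for all $t\in[0,T]$ and $u(0)=u_0$, such that for every $t$ the first equation holds in the sense of distributions, and the second one holds when tested with every $v\in V$, with $\langle\Delta_{K_n}u,v\rangle=-\int_{K_n}\nabla_su\,\nabla_sv\,ds$ and $\langle\frac{\partial u}{\partial\nu},v\rangle=\int_\Omega\nabla u\cdot\nabla v\,dx+\int_\Omega\Delta u\,v\,dx$. (i) For every $t\in[0,T]$, $$\int_0^t\Big\|\frac{du}{dt}(\tau)\Big\|^2_{L^2(\Omega,m)}d\tau+\|u(t)\|_V^2\le\frac1{\min\{1,\bar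 C\}}\Big(\tilde C\|u_0\|_V^2+\int_0^t\|f(\tau)\|^2_{L^2(\Omega,m)}d\tau\Big);$$ in particular $\sup_{t\in[0,T]}\|u(t)\|_V^2<\infty$. (ii) If $\bar C\le\frac34$ (which can always be achieved by decreasing $\bar C$), then $$\int_0^T\Big\|\frac{du}{dt}(\tau)\Big\|^2_{L^2(\Omega,m)}d\tau+\sup_{t\in[0,T]}\|u(t)\|_V^2\le\frac1{\min\{1,\bar C\}}\Big(\tilde C\|u_0\|_V^2+\int_0^T\|f(\tau)\|^2_{L^2(\Omega,m)}d\tau\Big).$$ -/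

import Mathlib

open MeasureTheory Set Filter Topology
open scoped ContDiff NNReal ENNReal

noncomputable section

namespace Venttsel

/-! The plane `ℝ²` is identified with `ℂ`, regarded as a real inner product space. -/

/-- The rotation by `-π/3`. -/
def rotBump : ℂ := ⟨1 / 2, -(√3 / 2)⟩

/-- The rotation by `2π/3`. -/
def rotSide : ℂ := ⟨-(1 / 2), √3 / 2⟩

/-- The `n`-th polygonal Koch curve from `0` to `1`, with constant speed on `[0,1]`. The four
branches are the four similarities of ratio `1/3` of the Koch curve; the bump lies to the right of
the direction of travel. -/
def kochPath : ℕ → ℝ → ℂ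
  | 0, t => (t : ℂ)
  | n + 1, t =>
      if t < 1 / 4 then kochPath n (4 * t) / 3
      else if t < 1 / 2 then 1 / 3 + rotBump * kochPath n (4 * t - 1) / 3
      else if t < 3 / 4 then
        1 / 3 + rotBump / 3 + (starRingEnd ℂ) rotBump * kochPath n (4 * t - 2) / 3
      else 2 / 3 + kochPath n (4 * t - 3) / 3

/-- The closed snowflake polygon, traversed counterclockwise on `[0,3]`: the three Koch polygons
over the sides of the unit triangle with vertices `0`, `1`, `1 + rotSide`, pointing outwards. -/
def snowflakePath (n : ℕ) (t : ℝ) : ℂ :=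
  if t < 1 then kochPath n t
  else if t < 2 then 1 + rotSide * kochPath n (t - 1)
  else 1 + rotSide + rotSide ^ 2 * kochPath n (t - 2)

/-- The length `3 (4/3)^n` of `K_n`. -/
def perimeter (n : ℕ) : ℝ := 3 * (4 / 3) ^ n

/-- The arc length parametrization of `K_n` on `[0, perimeter n]`. -/
def arcParam (n : ℕ) (s : ℝ) : ℂ := snowflakePath n ((3 / 4) ^ n * s)

/-- The polygon `K_n`. -/
def K (n : ℕ) : Set ℂ := arcParam n '' Icc 0 (perimeter n)

/-- The polygonal domain `Ω_n` bounded by `K_n`: the component of the complement of `K_n` which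
contains the barycentre of the initial triangle. -/
def Omega (n : ℕ) : Set ℂ := connectedComponentIn (K n)ᶜ ⟨1 / 2, √3 / 6⟩

/-- The arc length measure `ds` on `K_n`. -/
def ds (n : ℕ) : Measure ℂ :=
  Measure.map (arcParam n) (volume.restrict (Icc 0 (perimeter n)))

/-- The measure `dm = dx + ds`. -/
def m (n : ℕ) : Measure ℂ := volume.restrict (Omega n) + ds n

/-- The space `L²(Ω, m)`. -/
abbrev L2 (n : ℕ) : Type := Lp ℝ 2 (m n)

/-- `φ ∈ C_0^∞(Ω)`. -/
def IsTest (n : ℕ) (φ : ℂ → ℝ) : Prop :=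
  ContDiff ℝ ∞ φ ∧ HasCompactSupport φ ∧ tsupport φ ⊆ Omega n

/-- `G ∈ L²(Ω; ℝ²)` is the weak gradient of `u` in `Ω`. -/
def IsWeakGrad (n : ℕ) (u : ℂ → ℝ) (G : ℂ → ℂ) : Prop :=
  MemLp G 2 (volume.restrict (Omega n)) ∧
  ∀ φ : ℂ → ℝ, IsTest n φ → ∀ e : ℂ,
    ∫ x in Omega n, u x * fderiv ℝ φ x e = -∫ x in Omega n, inner ℝ (G x) e * φ x

/-- `g ∈ L²(K_n)` is the tangential derivative of `w` on the closed curve `K_n`: in the arc length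
parameter, `w` is (almost everywhere equal to) a periodic absolutely continuous function with
derivative `g`. -/
def IsTangDeriv (n : ℕ) (w g : ℂ → ℝ) : Prop :=
  MemLp g 2 (ds n) ∧
  (∃ c : ℝ, ∀ᵐ s ∂(volume.restrict (Icc 0 (perimeter n))),
    w (arcParam n s) = c + ∫ τ in (0 : ℝ)..s, g (arcParam n τ)) ∧
  ∫ τ in (0 : ℝ)..perimeter n, g (arcParam n τ) = 0

/-- The values of `u` on `K_n` are the trace of `u` restricted to `Ω`. -/
def IsOwnTrace (n : ℕ) (u : ℂ → ℝ) : Prop :=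
  ∀ᵐ x ∂(ds n),
    Tendsto (fun r : ℝ => ⨍ y in Metric.ball x r ∩ Omega n, u y) (𝓝[>] 0) (𝓝 (u x))

/-- `V(Ω, K_n)`: the elements of `L²(Ω, m)` whose restriction to `Ω` is in `H¹(Ω)`, and whose
restriction to `K_n` is the trace of the former and is in `H¹(K_n)`. -/
def MemV (n : ℕ) (u : L2 n) : Prop :=
  (∃ G : ℂ → ℂ, IsWeakGrad n u G) ∧ (∃ g : ℂ → ℝ, IsTangDeriv n u g) ∧ IsOwnTrace n u

open Classical in
/-- The weak gradient `∇u` in `Ω` (zero if there is none). -/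
def grad (n : ℕ) (u : L2 n) : ℂ → ℂ :=
  if h : ∃ G : ℂ → ℂ, IsWeakGrad n u G then h.choose else 0

open Classical in
/-- The tangential derivative `∇_s u` on `K_n` (zero if there is none). -/
def tgrad (n : ℕ) (u : L2 n) : ℂ → ℝ :=
  if h : ∃ g : ℂ → ℝ, IsTangDeriv n u g then h.choose else 0

/-- The norm of `V(Ω, K_n)`. -/
def normV (n : ℕ) (u : L2 n) : ℝ :=
  √((∫ x in Omega n, ‖grad n u x‖ ^ 2) + (∫ x, (tgrad n u x) ^ 2 ∂(ds n)) + ‖u‖ ^ 2)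

/-- The pairing `⟨θ₂(u), v⟩`. -/
def theta2 (n : ℕ) (u v : L2 n) : ℝ :=
  ∫ p : ℂ × ℂ, (u p.1 - u p.2) * (v p.1 - v p.2) / ‖p.1 - p.2‖ ^ 2 ∂((ds n).prod (ds n))

/-- The energy form `E(u, v)`; the quadratic form is `E[u] = E(u, u)`. -/
def energy (n : ℕ) (b : ℂ → ℝ) (u v : L2 n) : ℝ :=
  (∫ x in Omega n, inner ℝ (grad n u x) (grad n v x))
    + (∫ x, tgrad n u x * tgrad n v x ∂(ds n))
    + (∫ x, b x * u x * v x ∂(ds n)) + theta2 n u v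

/-- `c > 0` is a coercivity constant of `E` on `V(Ω, K_n)`. -/
def IsCoercivityConstant (n : ℕ) (b : ℂ → ℝ) (c : ℝ) : Prop :=
  0 < c ∧ ∀ v : L2 n, MemV n v → c * normV n v ^ 2 ≤ energy n b v v

/-- `Δu = w` in `Ω`, in the sense of distributions. -/
def HasLaplacian (n : ℕ) (u w : L2 n) : Prop :=
  ∀ φ : ℂ → ℝ, IsTest n φ →
    ∫ x in Omega n, u x * Laplacian.laplacian φ x = ∫ x in Omega n, w x * φ x

/-- The pairing `⟨∂u/∂ν, v⟩` given by Green's formula, for `u` with `Δu = w` in `L²(Ω)`. -/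
def normalDeriv (n : ℕ) (u w v : L2 n) : ℝ :=
  (∫ x in Omega n, inner ℝ (grad n u x) (grad n v x)) + ∫ x in Omega n, w x * v x

/-- `u` is a (strict) solution on `[0,T]` of the Venttsel' problem
`du/dt = Δu + f` in `Ω`, `du/dt = -∂u/∂ν + Δ_K u - b u - θ₂(u) + f` on `K_n`, `u(0) = u₀`.
The time derivative is that of a function with values in `L²(Ω, m)`; `-∂u/∂ν + Δ_K u - θ₂(u)` acts
on (traces of) elements `v` of `V(Ω, K_n)`, where `⟨Δ_K u, v⟩ = -∫_K ∇_s u ∇_s v ds`. -/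
structure IsSolution (n : ℕ) (b : ℂ → ℝ) (T : ℝ) (f : ℝ → L2 n) (u₀ : L2 n) (u : ℝ → L2 n) :
    Prop where
  contDiff : ContDiffOn ℝ 1 u (Icc 0 T)
  memV : ∀ t ∈ Icc 0 T, MemV n (u t)
  bulk : ∀ t ∈ Icc 0 T, HasLaplacian n (u t) (derivWithin u (Icc 0 T) t - f t)
  boundary : ∀ t ∈ Icc 0 T, ∀ v : L2 n, MemV n v →
    ∫ x, derivWithin u (Icc 0 T) t x * v x ∂(ds n) =
      - normalDeriv n (u t) (derivWithin u (Icc 0 T) t - f t) v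
      - (∫ x, tgrad n (u t) x * tgrad n v x ∂(ds n))
      - (∫ x, b x * u t x * v x ∂(ds n))
      - theta2 n (u t) v
      + ∫ x, f t x * v x ∂(ds n)
  initial : u 0 = u₀

end Venttsel

end

/-! The evolution is handled by an energy argument in $L^2(\Omega,m)$. Green's formula merges the
two equations into $E(u(t),v)=(F(t),v)$ for $v\in V$, with $F=f-u'$ (`energy_eq_inner`).
Differentiability of $u$ as a $V$-valued map is not available, but the symmetry of $E$ gives
$E[u(t)]-E[u(s)]=(F(t)+F(s),u(t)-u(s))$, so $E[u]$ still has derivative $2(f-u',u')$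
(`hasDerivWithinAt_energy`). Integrating over $[s,t]$ and using Young's inequality with parameter
$l$ yields $E[u(t)]+(2-l)\int\|u'\|^2\le E[u(s)]+\frac1l\int\|f\|^2$ (`energy_add_le`). The choice
$l=1$ on $[0,t]$ gives (i). In (ii) the integrals reach $T$ while the norm is taken at an arbitrary
$t$; there $l=1+2\bar C/3$ on $[0,t]$ is combined with $l=1/2$ on $[t,T]$.

It remains to compare $E[v]$ with $\|v\|_V^2$. The upper bound needs $\theta_2$ to be controlled by
the tangential derivative (`integral_theta_kernel_le`). This follows from Cauchy–Schwarz along the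
curve and from a chord-arc inequality for $K_n$, proved by induction on $n$ with an invariant
triangle that keeps the branches of the Koch curve apart.

The lower bound, that is the existence of coercivity constants, is a Poincaré inequality bounding
$\int_\Omega v^2$ by the gradient and the trace (`poincare`). From almost every point of $\Omega$
one descends vertically until an edge of $K_n$ is met; edges are never vertical, so this is a
transversal change of variables, and $v$ is the boundary value plus the integral of its vertical
derivative. Two facts make this rigorous. First, a winding number shows that $\Omega$ is bounded and
lies locally on one side of each edge. Second, Sobolev functions are absolutely continuous on almost
every vertical line, and Lebesgue differentiation identifies their limit on the edge with the trace
defined by averages over balls. -/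

noncomputable section

namespace Venttsel

/-! ### Self-similarity of the Koch polygons -/

/-- The four similarities of the Koch curve. -/
def kochBranch : ℕ → ℂ → ℂ
  | 0, z => z / 3
  | 1, z => 1 / 3 + rotBump * z / 3
  | 2, z => 1 / 3 + rotBump / 3 + (starRingEnd ℂ) rotBump * z / 3
  | _, z => 2 / 3 + z / 3

/-- The linear parts of the four similarities, multiplied by `3`. -/
def kochRot : ℕ → ℂ
  | 0 => 1
  | 1 => rotBump
  | 2 => (starRingEnd ℂ) rotBump
  | _ => 1

theorem rotBump_add_conj : rotBump + (starRingEnd ℂ) rotBump = 1 := by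
  apply Complex.ext <;> simp [rotBump]; norm_num

theorem rotSide_eq : rotSide = -rotBump := by
  apply Complex.ext <;> simp [rotBump, rotSide]

theorem rotBump_sq : rotBump ^ 2 = rotBump - 1 := by
  have h : √3 * √3 = 3 := Real.mul_self_sqrt (by norm_num)
  apply Complex.ext <;> (simp [rotBump, sq]; nlinarith)

theorem rotBump_pow_six : rotBump ^ 6 = 1 := by
  have h := rotBump_sq
  linear_combination (rotBump ^ 4 + rotBump ^ 3 - rotBump - 1) * h

theorem conj_rotBump_pow_six : ((starRingEnd ℂ) rotBump) ^ 6 = 1 := by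
  rw [← map_pow, rotBump_pow_six, map_one]

theorem rotSide_pow_six : rotSide ^ 6 = 1 := by
  rw [rotSide_eq, neg_pow, rotBump_pow_six]; norm_num

theorem one_add_rotSide_add_sq : 1 + rotSide + rotSide ^ 2 = 0 := by
  rw [rotSide_eq]; linear_combination rotBump_sq

theorem rotSide_pow_three : rotSide ^ 3 = 1 := by
  linear_combination (rotSide - 1) * one_add_rotSide_add_sq

theorem norm_eq_one_of_pow_six {z : ℂ} (h : z ^ 6 = 1) : ‖z‖ = 1 :=
  Complex.norm_eq_one_of_pow_eq_one h (by norm_num)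

/-- Being a sixth root of unity records length and direction at once; the directions are later used
to exclude vertical edges. -/
theorem kochRot_pow_six (q : ℕ) : kochRot q ^ 6 = 1 := by
  match q with
  | 0 => simp [kochRot]
  | 1 => exact rotBump_pow_six
  | 2 => exact conj_rotBump_pow_six
  | n + 3 => simp [kochRot]

theorem kochBranch_sub (q : ℕ) (z w : ℂ) :
    kochBranch q z - kochBranch q w = kochRot q * (z - w) / 3 := by
  match q with
  | 0 => simp [kochRot, kochBranch]; ring
  | 1 => simp [kochRot, kochBranch]; ring
  | 2 => simp [kochRot, kochBranch]; ring
  | n + 3 => simp [kochRot, kochBranch]; ring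

theorem norm_kochBranch_sub (q : ℕ) (z w : ℂ) :
    ‖kochBranch q z - kochBranch q w‖ = ‖z - w‖ / 3 := by
  rw [kochBranch_sub, norm_div, norm_mul, norm_eq_one_of_pow_six (kochRot_pow_six q)]
  simp

theorem kochBranch_one (q : ℕ) (hq : q < 3) : kochBranch q 1 = kochBranch (q + 1) 0 := by
  have h := rotBump_add_conj
  interval_cases q
  · simp [kochBranch]
  · simp [kochBranch]
  · simp only [kochBranch]; linear_combination h / 3

theorem kochPath_zero (n : ℕ) : kochPath n 0 = 0 := by
  induction n with
  | zero => simp [kochPath]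
  | succ n ih => simp [kochPath, ih]

theorem kochPath_one (n : ℕ) : kochPath n 1 = 1 := by
  induction n with
  | zero => simp [kochPath]
  | succ n ih =>
    have : (4 : ℝ) * 1 - 3 = 1 := by norm_num
    simp only [kochPath, this, ih]
    norm_num

/-- For $s<1$ this unfolds the definition. The endpoint $s=1$ is included because consecutive
branches agree where they meet (`kochBranch_one`). -/
theorem kochPath_branch (n q : ℕ) (hq : q < 4) {s : ℝ} (hs : s ∈ Icc (0 : ℝ) 1) :
    kochPath (n + 1) ((q + s) / 4) = kochBranch q (kochPath n s) := by
  obtain ⟨h0, h1⟩ := hs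
  have key : ∀ q : ℕ, q < 4 → ∀ s : ℝ, 0 ≤ s → s < 1 →
      kochPath (n + 1) ((q + s) / 4) = kochBranch q (kochPath n s) := by
    intro q hq s h0 h1
    interval_cases q
    · have e : 4 * (((0 : ℕ) + s) / 4) = s := by push_cast; ring
      simp only [kochPath, e, kochBranch]
      rw [if_pos (by push_cast; linarith)]
    · have e : 4 * (((1 : ℕ) + s) / 4) - 1 = s := by push_cast; ring
      simp only [kochPath, e, kochBranch]
      rw [if_neg (by push_cast; linarith), if_pos (by push_cast; linarith)]
    · have e : 4 * (((2 : ℕ) + s) / 4) - 2 = s := by push_cast; ring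
      simp only [kochPath, e, kochBranch]
      rw [if_neg (by push_cast; linarith), if_neg (by push_cast; linarith),
        if_pos (by push_cast; linarith)]
    · have e : 4 * (((3 : ℕ) + s) / 4) - 3 = s := by push_cast; ring
      simp only [kochPath, e, kochBranch]
      rw [if_neg (by push_cast; linarith), if_neg (by push_cast; linarith),
        if_neg (by push_cast; linarith)]
  rcases h1.lt_or_eq with h | rfl
  · exact key q hq s h0 h
  · rcases Nat.lt_or_ge q 3 with h3 | h3
    · have := key (q + 1) (by omega) 0 le_rfl one_pos
      rw [kochPath_zero, ← kochBranch_one q h3] at this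
      rw [kochPath_one, ← this]
      push_cast; ring_nf
    · obtain rfl : q = 3 := by omega
      rw [kochPath_one]
      have : (((3 : ℕ) : ℝ) + 1) / 4 = 1 := by norm_num
      rw [this, kochPath_one]; simp [kochBranch]; norm_num

theorem exists_quarter {t : ℝ} (ht : t ∈ Icc (0 : ℝ) 1) :
    ∃ q : ℕ, q < 4 ∧ ∃ s ∈ Icc (0 : ℝ) 1, t = (q + s) / 4 := by
  obtain ⟨h0, h1⟩ := ht
  rcases lt_or_ge t (1 / 4) with h | h
  · exact ⟨0, by norm_num, 4 * t, ⟨by linarith, by linarith⟩, by push_cast; ring⟩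
  rcases lt_or_ge t (1 / 2) with h' | h'
  · exact ⟨1, by norm_num, 4 * t - 1, ⟨by linarith, by linarith⟩, by push_cast; ring⟩
  rcases lt_or_ge t (3 / 4) with h'' | h''
  · exact ⟨2, by norm_num, 4 * t - 2, ⟨by linarith, by linarith⟩, by push_cast; ring⟩
  · exact ⟨3, by norm_num, 4 * t - 3, ⟨by linarith, by linarith⟩, by push_cast; ring⟩

/-! ### The invariant triangle and the chord-arc inequality for the Koch polygons -/

/-- The closed isosceles triangle below the segment `[0,1]` with base angles `π/6`. -/
def kochTriangle : Set ℂ :=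
  {z | ∃ X Y : ℝ, z = ⟨X, -(√3 / 3 * Y)⟩ ∧ 0 ≤ Y ∧ Y ≤ X ∧ Y ≤ 1 - X}

/-- In the coordinates $(X,Y)$, with the factor $\sqrt3/3$ taken out, every branch has rational
coefficients, and the three conditions defining the triangle are linear. The invariance confines the
polygons of all levels to one triangle. -/
theorem kochBranch_mem_kochTriangle (q : ℕ) (hq : q < 4) {z : ℂ} (hz : z ∈ kochTriangle) :
    kochBranch q z ∈ kochTriangle := by
  have h3 : √3 * √3 = 3 := Real.mul_self_sqrt (by norm_num)
  obtain ⟨X, Y, rfl, h0, h1, h2⟩ := hz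
  interval_cases q
  · refine ⟨X / 3, Y / 3, ?_, by linarith, by linarith, by linarith⟩
    apply Complex.ext <;> simp [kochBranch]; ring
  · refine ⟨1 / 3 + (X - Y) / 6, (3 * X + Y) / 6, ?_, by linarith, by linarith, by linarith⟩
    apply Complex.ext <;> simp [kochBranch, rotBump] <;> linarith [h3, congrArg (· * Y) h3]
  · refine ⟨1 / 2 + (X + Y) / 6, 1 / 2 + (Y - 3 * X) / 6, ?_, by linarith, by linarith, by linarith⟩
    apply Complex.ext <;> simp [kochBranch, rotBump] <;> linarith [h3, congrArg (· * Y) h3]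
  · refine ⟨2 / 3 + X / 3, Y / 3, ?_, by linarith, by linarith, by linarith⟩
    apply Complex.ext <;> simp [kochBranch]; ring

theorem kochPath_mem_kochTriangle (n : ℕ) {t : ℝ} (ht : t ∈ Icc (0 : ℝ) 1) :
    kochPath n t ∈ kochTriangle := by
  induction n generalizing t with
  | zero =>
    refine ⟨t, 0, ?_, le_rfl, ht.1, by linarith [ht.2]⟩
    apply Complex.ext <;> simp [kochPath]
  | succ n ih =>
    obtain ⟨q, hq, s, hs, rfl⟩ := exists_quarter ht
    rw [kochPath_branch n q hq hs]
    exact kochBranch_mem_kochTriangle q hq (ih hs)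

theorem half_add_le_of_sq {x a b : ℝ} (hx : 0 ≤ x) (h : a ^ 2 + b ^ 2 ≤ 2 * x ^ 2) :
    (a + b) / 2 ≤ x := by
  apply le_of_sq_le_sq _ hx
  nlinarith [sq_nonneg (a - b)]

/-- The vector $z-1$ has direction in $[\pi,7\pi/6]$ and the rotated $w$ has direction in
$[3\pi/2,5\pi/3]$, so they make an angle of at least $\pi/3$. The law of cosines then gives
$|z-1-\rho w|^2\ge a^2+b^2-ab\ge(a^2+b^2)/2$ with $a=|z-1|$, $b=|w|$. -/
theorem norm_sub_one_sub_rotBump_mul {z w : ℂ} (hz : z ∈ kochTriangle) (hw : w ∈ kochTriangle) :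
    (‖z - 1‖ + ‖w‖) / 2 ≤ ‖z - 1 - rotBump * w‖ := by
  have h3 : √3 * √3 = 3 := Real.mul_self_sqrt (by norm_num)
  obtain ⟨X, Y, rfl, h0, h1, h2⟩ := hz
  obtain ⟨U, V, rfl, k0, k1, k2⟩ := hw
  apply half_add_le_of_sq (norm_nonneg _)
  simp only [Complex.sq_norm, Complex.normSq_apply]
  simp [rotBump]
  have : (√3) ^ 2 = 3 := by rw [sq, h3]
  ring_nf
  have e4 : √3 ^ 4 = 9 := by rw [show √3 ^ 4 = (√3 ^ 2) ^ 2 by ring, this]; norm_num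
  simp only [this, e4]
  obtain ⟨p, rfl⟩ : ∃ p, X = 1 - Y - p := ⟨1 - Y - X, by ring⟩
  obtain ⟨r, rfl⟩ : ∃ r, U = V + r := ⟨U - V, by ring⟩
  have hp : 0 ≤ p := by linarith
  have hr : 0 ≤ r := by linarith
  nlinarith [mul_nonneg hp hr, mul_nonneg h0 hp, mul_nonneg k0 hr, sq_nonneg (Y - V),
    mul_nonneg h0 hr, mul_nonneg k0 hp, mul_nonneg h0 k0, sq_nonneg (p - r), sq_nonneg (Y - V + p/2 - r/2)]

/-- Same reason as for `rotBump`: the rotated $w$ now has direction in $[\pi/2,2\pi/3]$, again at an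
angle of at least $\pi/3$ from $z-1$. -/
theorem norm_sub_one_sub_rotSide_mul {z w : ℂ} (hz : z ∈ kochTriangle) (hw : w ∈ kochTriangle) :
    (‖z - 1‖ + ‖w‖) / 2 ≤ ‖z - 1 - rotSide * w‖ := by
  have h3 : √3 * √3 = 3 := Real.mul_self_sqrt (by norm_num)
  obtain ⟨X, Y, rfl, h0, h1, h2⟩ := hz
  obtain ⟨U, V, rfl, k0, k1, k2⟩ := hw
  apply half_add_le_of_sq (norm_nonneg _)
  simp only [Complex.sq_norm, Complex.normSq_apply]
  simp [rotSide]
  have : (√3) ^ 2 = 3 := by rw [sq, h3]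
  ring_nf
  have e4 : √3 ^ 4 = 9 := by rw [show √3 ^ 4 = (√3 ^ 2) ^ 2 by ring, this]; norm_num
  simp only [this, e4]
  obtain ⟨p, rfl⟩ : ∃ p, X = 1 - Y - p := ⟨1 - Y - X, by ring⟩
  obtain ⟨r, rfl⟩ : ∃ r, U = V + r := ⟨U - V, by ring⟩
  have hp : 0 ≤ p := by linarith
  have hr : 0 ≤ r := by linarith
  nlinarith [mul_nonneg hp hr, mul_nonneg h0 hp, mul_nonneg k0 hr, sq_nonneg (Y - V),
    mul_nonneg h0 hr, mul_nonneg k0 hp, mul_nonneg h0 k0, sq_nonneg (p - r), sq_nonneg (Y - V + p - r)]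

/-- Up to a rotation and the factor $1/3$, the two feet of the bump are the configuration with
`rotBump`, and its tip is the one with `rotSide`. -/
theorem kochBranch_adjacent (q : ℕ) (hq : q < 3) {z w : ℂ} (hz : z ∈ kochTriangle)
    (hw : w ∈ kochTriangle) :
    (‖z - 1‖ + ‖w‖) / 6 ≤ ‖kochBranch q z - kochBranch (q + 1) w‖ := by
  have h1 := rotBump_add_conj
  have h2 := rotBump_sq
  have hc : (starRingEnd ℂ) rotBump = 1 - rotBump := by linear_combination h1
  have nb : ‖rotBump‖ = 1 := norm_eq_one_of_pow_six rotBump_pow_six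
  interval_cases q
  · have e : kochBranch 0 z - kochBranch 1 w = (z - 1 - rotBump * w) / 3 := by
      simp [kochBranch]; ring
    rw [e, norm_div]
    have := norm_sub_one_sub_rotBump_mul hz hw
    simp; linarith
  · have e : kochBranch 1 z - kochBranch 2 w = rotBump * (z - 1 - rotSide * w) / 3 := by
      rw [rotSide_eq]; simp only [kochBranch, hc]; linear_combination (-w / 3) * h2
    rw [e, norm_div, norm_mul, nb]
    have := norm_sub_one_sub_rotSide_mul hz hw
    simp; linarith
  · have e : kochBranch 2 z - kochBranch 3 w
        = (starRingEnd ℂ) rotBump * (z - 1 - rotBump * w) / 3 := by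
      simp only [kochBranch, hc]; linear_combination (-w / 3) * h2
    rw [e, norm_div, norm_mul, RCLike.norm_conj, nb]
    have := norm_sub_one_sub_rotBump_mul hz hw
    simp; linarith

/-- The four small triangles project to the real axis inside $[0,\frac13]$, $[\frac13,\frac12]$,
$[\frac12,\frac23]$, $[\frac23,1]$, so real parts alone separate non-neighbours. -/
theorem kochBranch_nonadjacent (q r : ℕ) (hqr : q + 2 ≤ r) (hr : r < 4) {z w : ℂ}
    (hz : z ∈ kochTriangle) (hw : w ∈ kochTriangle) :
    1 / 6 ≤ ‖kochBranch q z - kochBranch r w‖ := by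
  have h3 : √3 * √3 = 3 := Real.mul_self_sqrt (by norm_num)
  obtain ⟨X, Y, rfl, h0, h1, h2⟩ := hz
  obtain ⟨U, V, rfl, k0, k1, k2⟩ := hw
  rw [norm_sub_rev]
  refine le_trans ?_ (Complex.re_le_norm _)
  have hq : q < 2 := by omega
  interval_cases q <;> interval_cases r
  all_goals
    simp [kochBranch, rotBump]
    linarith [h3, congrArg (· * Y) h3, congrArg (· * V) h3]

/-- Induction on $n$: two points on one branch are a scaled pair of the previous level; on
neighbouring branches their distance dominates the distances to the common vertex, to which the
induction hypothesis applies; on other pairs the distance is bounded below outright. -/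
theorem kochPath_chordArc (n : ℕ) : ∃ c : ℝ, 0 < c ∧ ∀ s ∈ Icc (0 : ℝ) 1, ∀ t ∈ Icc (0 : ℝ) 1,
    c * |s - t| ≤ ‖kochPath n s - kochPath n t‖ := by
  induction n with
  | zero =>
    refine ⟨1, one_pos, fun s _ t _ => ?_⟩
    simp only [kochPath]
    rw [← Complex.ofReal_sub, Complex.norm_real, Real.norm_eq_abs, one_mul]
  | succ n ih =>
    obtain ⟨c, hc, ih⟩ := ih
    -- Neighbouring branches give $\frac c6(1-s+t)$ against a parameter distance $\frac14(1-s+t)$,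
    -- hence $2c/3$; non-neighbours give $1/6$ against a parameter distance at most $1$.
    refine ⟨min (2 * c / 3) (1 / 6), by positivity, ?_⟩
    set d := min (2 * c / 3) (1 / 6)
    have hd0 : 0 < d := by positivity
    have hd1 : d ≤ 2 * c / 3 := min_le_left _ _
    have hd2 : d ≤ 1 / 6 := min_le_right _ _
    have key : ∀ q r : ℕ, q ≤ r → r < 4 → ∀ s ∈ Icc (0 : ℝ) 1, ∀ t ∈ Icc (0 : ℝ) 1,
        d * |(q + s) / 4 - (r + t) / 4|
          ≤ ‖kochPath (n + 1) ((q + s) / 4) - kochPath (n + 1) ((r + t) / 4)‖ := by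
      intro q r hqr hr s hs t ht
      rw [kochPath_branch n q (by omega) hs, kochPath_branch n r hr ht]
      have ms := kochPath_mem_kochTriangle n hs
      have mt := kochPath_mem_kochTriangle n ht
      rcases hqr.eq_or_lt with rfl | hlt
      · rw [norm_kochBranch_sub]
        have := ih s hs t ht
        have e : (q + s) / 4 - (q + t) / 4 = (s - t) / 4 := by ring
        rw [e, abs_div, abs_of_pos (by norm_num : (0 : ℝ) < 4)]
        nlinarith [abs_nonneg (s - t)]
      · rcases (Nat.succ_le_of_lt hlt).eq_or_lt with rfl | hlt'
        · have h := kochBranch_adjacent q (by omega) ms mt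
          have a1 := ih s hs 1 (by simp)
          have a2 := ih t ht 0 (by simp)
          rw [kochPath_one, abs_of_nonpos (by linarith [hs.2])] at a1
          rw [kochPath_zero, sub_zero, sub_zero, abs_of_nonneg ht.1] at a2
          have e : |(q + s) / 4 - ((q.succ : ℕ) + t) / 4| = (1 - s + t) / 4 := by
            rw [abs_of_nonpos (by push_cast; linarith [hs.2, ht.1])]; push_cast; ring
          rw [e]
          nlinarith [hs.2, ht.1]
        · refine le_trans ?_ (kochBranch_nonadjacent q r hlt' hr ms mt)
          have : |(q + s) / 4 - (r + t) / 4| ≤ 1 := by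
            have h4 : (r : ℝ) ≤ 3 := by exact_mod_cast Nat.lt_succ_iff.mp hr
            have h5 : (0 : ℝ) ≤ q := q.cast_nonneg
            have h6 : (q : ℝ) ≤ r := by exact_mod_cast hqr
            rw [abs_le]; constructor <;> linarith [hs.1, hs.2, ht.1, ht.2]
          nlinarith
    intro s hs t ht
    obtain ⟨q, hq, s', hs', rfl⟩ := exists_quarter hs
    obtain ⟨r, hr, t', ht', rfl⟩ := exists_quarter ht
    rcases le_total q r with h | h
    · exact key q r h hr s' hs' t' ht'
    · rw [abs_sub_comm, norm_sub_rev]; exact key r q h hq t' ht' s' hs'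

/-! ### The closed snowflake: chord-arc inequality -/

/-- The three sides of the unit triangle, each carrying a Koch polygon. -/
def sidePath (n k : ℕ) (s : ℝ) : ℂ := match k with
  | 0 => kochPath n s
  | 1 => 1 + rotSide * kochPath n s
  | _ => 1 + rotSide + rotSide ^ 2 * kochPath n s

theorem sidePath_one (n k : ℕ) (hk : k < 2) : sidePath n k 1 = sidePath n (k + 1) 0 := by
  interval_cases k <;> simp [sidePath, kochPath_one, kochPath_zero]

theorem snowflakePath_side (n k : ℕ) (hk : k < 3) {s : ℝ} (hs : s ∈ Icc (0 : ℝ) 1) :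
    snowflakePath n (k + s) = sidePath n k s := by
  obtain ⟨h0, h1⟩ := hs
  have key : ∀ k : ℕ, k < 3 → ∀ s : ℝ, 0 ≤ s → s < 1 →
      snowflakePath n (k + s) = sidePath n k s := by
    intro k hk s h0 h1
    interval_cases k
    · simp only [snowflakePath, sidePath]
      rw [if_pos (by push_cast; linarith)]; simp
    · simp only [snowflakePath, sidePath]
      rw [if_neg (by push_cast; linarith), if_pos (by push_cast; linarith)]
      simp
    · simp only [snowflakePath, sidePath]
      rw [if_neg (by push_cast; linarith), if_neg (by push_cast; linarith)]
      simp
  rcases h1.lt_or_eq with h | rfl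
  · exact key k hk s h0 h
  · rcases Nat.lt_or_ge k 2 with h3 | h3
    · have := key (k + 1) (by omega) 0 le_rfl one_pos
      rw [sidePath_one n k h3, ← this]
      push_cast; ring_nf
    · obtain rfl : k = 2 := by omega
      simp only [snowflakePath, sidePath]
      norm_num

theorem exists_side {t : ℝ} (ht : t ∈ Icc (0 : ℝ) 3) :
    ∃ k : ℕ, k < 3 ∧ ∃ s ∈ Icc (0 : ℝ) 1, t = k + s := by
  obtain ⟨h0, h1⟩ := ht
  rcases lt_or_ge t 1 with h | h
  · exact ⟨0, by norm_num, t, ⟨by linarith, by linarith⟩, by push_cast; ring⟩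
  rcases lt_or_ge t 2 with h' | h'
  · exact ⟨1, by norm_num, t - 1, ⟨by linarith, by linarith⟩, by push_cast; ring⟩
  · exact ⟨2, by norm_num, t - 2, ⟨by linarith, by linarith⟩, by push_cast; ring⟩

/-- Any two of the three sides share a vertex, and up to rotation every pair is the configuration of
`norm_sub_one_sub_rotSide_mul`. The first and the last side meet at the closing point, where the
parameter distance is $3-|s-t|$; this is why the minimum appears. -/
theorem snowflakePath_chordArc (n : ℕ) : ∃ c : ℝ, 0 < c ∧
    ∀ s ∈ Icc (0 : ℝ) 3, ∀ t ∈ Icc (0 : ℝ) 3,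
      c * min |s - t| (3 - |s - t|) ≤ ‖snowflakePath n s - snowflakePath n t‖ := by
  obtain ⟨c, hc, h⟩ := kochPath_chordArc n
  have nr : ‖rotSide‖ = 1 := norm_eq_one_of_pow_six rotSide_pow_six
  have hsum := one_add_rotSide_add_sq
  have adj : ∀ s ∈ Icc (0 : ℝ) 1, ∀ t ∈ Icc (0 : ℝ) 1,
      c / 2 * (1 - s + t) ≤ ‖kochPath n s - 1 - rotSide * kochPath n t‖ := by
    intro s hs t ht
    have a1 := h s hs 1 (by simp)
    have a2 := h t ht 0 (by simp)
    rw [kochPath_one, abs_of_nonpos (by linarith [hs.2])] at a1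
    rw [kochPath_zero, sub_zero, sub_zero, abs_of_nonneg ht.1] at a2
    have := norm_sub_one_sub_rotSide_mul (kochPath_mem_kochTriangle n hs)
      (kochPath_mem_kochTriangle n ht)
    nlinarith
  have same : ∀ k : ℕ, ∀ s t : ℝ, ‖sidePath n k s - sidePath n k t‖
      = ‖kochPath n s - kochPath n t‖ := by
    intro k s t
    match k with
    | 0 => rfl
    | 1 =>
      simp only [sidePath]
      rw [add_sub_add_left_eq_sub, ← mul_sub, norm_mul, nr, one_mul]
    | k + 2 =>
      simp only [sidePath]
      rw [add_sub_add_left_eq_sub, ← mul_sub, norm_mul, norm_pow, nr, one_pow, one_mul]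
  have key : ∀ k l : ℕ, k ≤ l → l < 3 → ∀ s ∈ Icc (0 : ℝ) 1, ∀ t ∈ Icc (0 : ℝ) 1,
      c / 2 * min |(k + s) - (l + t)| (3 - |(k + s) - (l + t)|)
        ≤ ‖snowflakePath n (k + s) - snowflakePath n (l + t)‖ := by
    intro k l hkl hl s hs t ht
    rw [snowflakePath_side n k (by omega) hs, snowflakePath_side n l hl ht]
    rcases hkl.eq_or_lt with rfl | hlt
    · rw [same, add_sub_add_left_eq_sub]
      have := h s hs t ht
      nlinarith [min_le_left |s - t| (3 - |s - t|), abs_nonneg (s - t)]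
    · have hcs : k = 0 ∧ l = 1 ∨ k = 1 ∧ l = 2 ∨ k = 0 ∧ l = 2 := by omega
      rcases hcs with ⟨rfl, rfl⟩ | ⟨rfl, rfl⟩ | ⟨rfl, rfl⟩
      · have e : |((0 : ℕ) + s) - ((1 : ℕ) + t)| = 1 - s + t := by
          rw [abs_of_nonpos (by push_cast; linarith [hs.2, ht.1])]; push_cast; ring
        rw [e]
        have := adj s hs t ht
        have e2 : sidePath n 0 s - sidePath n 1 t
            = kochPath n s - 1 - rotSide * kochPath n t := by simp only [sidePath]; ring
        rw [e2]
        nlinarith [min_le_left (1 - s + t) (3 - (1 - s + t))]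
      · have e : |((1 : ℕ) + s) - ((2 : ℕ) + t)| = 1 - s + t := by
          rw [abs_of_nonpos (by push_cast; linarith [hs.2, ht.1])]; push_cast; ring
        rw [e]
        have := adj s hs t ht
        have e2 : sidePath n 1 s - sidePath n 2 t
            = rotSide * (kochPath n s - 1 - rotSide * kochPath n t) := by
          simp only [sidePath]; ring
        rw [e2, norm_mul, nr, one_mul]
        nlinarith [min_le_left (1 - s + t) (3 - (1 - s + t))]
      · have e : |((0 : ℕ) + s) - ((2 : ℕ) + t)| = 3 - (1 - t + s) := by
          rw [abs_of_nonpos (by push_cast; linarith [hs.2, ht.1])]; push_cast; ring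
        rw [e]
        have := adj t ht s hs
        have e2 : sidePath n 0 s - sidePath n 2 t
            = -(rotSide ^ 2 * (kochPath n t - 1 - rotSide * kochPath n s)) := by
          simp only [sidePath]
          linear_combination -hsum - (rotSide - 1) * kochPath n s * hsum
        rw [e2, norm_neg, norm_mul, norm_pow, nr, one_pow, one_mul]
        nlinarith [min_le_right (3 - (1 - t + s)) (3 - (3 - (1 - t + s)))]
  refine ⟨c / 2, by positivity, fun s hs t ht => ?_⟩
  obtain ⟨k, hk, s', hs', rfl⟩ := exists_side hs
  obtain ⟨l, hl, t', ht', rfl⟩ := exists_side ht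
  rcases le_total k l with hkl | hkl
  · exact key k l hkl hl s' hs' t' ht'
  · rw [abs_sub_comm, norm_sub_rev]; exact key l k hkl hk t' ht' s' hs'

theorem perimeter_pos (n : ℕ) : 0 < perimeter n := by unfold perimeter; positivity

theorem perimeter_eq (n : ℕ) : (3 / 4) ^ n * perimeter n = 3 := by
  unfold perimeter
  rw [mul_left_comm, ← mul_pow]; norm_num

theorem arcParam_chordArc (n : ℕ) : ∃ c : ℝ, 0 < c ∧
    ∀ s ∈ Icc 0 (perimeter n), ∀ t ∈ Icc 0 (perimeter n),
      c * min |s - t| (perimeter n - |s - t|) ≤ ‖arcParam n s - arcParam n t‖ := by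
  obtain ⟨c, hc, h⟩ := snowflakePath_chordArc n
  have hp : (0 : ℝ) < (3 / 4) ^ n := by positivity
  have mem : ∀ s ∈ Icc 0 (perimeter n), (3 / 4) ^ n * s ∈ Icc (0 : ℝ) 3 := by
    intro s hs
    refine ⟨by have := hs.1; positivity, ?_⟩
    calc (3 / 4) ^ n * s ≤ (3 / 4) ^ n * perimeter n := mul_le_mul_of_nonneg_left hs.2 hp.le
      _ = 3 := perimeter_eq n
  refine ⟨c * (3 / 4) ^ n, by positivity, fun s hs t ht => ?_⟩
  refine le_trans (le_of_eq ?_) (h _ (mem s hs) _ (mem t ht))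
  have e : 3 - (3 / 4) ^ n * |s - t| = (3 / 4) ^ n * (perimeter n - |s - t|) := by
    rw [mul_sub, perimeter_eq]
  rw [← mul_sub, abs_mul, abs_of_pos hp, e, mul_assoc, mul_min_of_nonneg _ _ hp.le]

/-! ### Vertices and edges of the polygon -/

theorem sidePath_vadd (n k : ℕ) :
    ∃ a ζ : ℂ, ζ ^ 6 = 1 ∧ ∀ s, sidePath n k s = a + ζ * kochPath n s := by
  match k with
  | 0 => exact ⟨0, 1, by simp, fun s => by simp [sidePath]⟩
  | 1 => exact ⟨1, rotSide, rotSide_pow_six, fun s => rfl⟩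
  | k + 2 =>
    refine ⟨1 + rotSide, rotSide ^ 2, ?_, fun s => rfl⟩
    rw [← pow_mul, mul_comm, pow_mul, rotSide_pow_six, one_pow]

theorem kochBranch_vadd (q : ℕ) (z : ℂ) :
    kochBranch q z = kochBranch q 0 + kochRot q / 3 * z := by
  have := kochBranch_sub q z 0
  linear_combination this

/-- Induction on $n$, splitting off the leading base-$4$ digit of $j$, which selects the branch. The
sixth power equation encodes that the edge has length $3^{-n}$ and a direction that is a multiple of
$\pi/3$. -/
theorem kochPath_edge (n j : ℕ) (hj : j < 4 ^ n) :
    (3 ^ n * (kochPath n ((j + 1 : ℝ) / 4 ^ n) - kochPath n ((j : ℝ) / 4 ^ n))) ^ 6 = 1 ∧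
    ∀ t ∈ Icc (0 : ℝ) 1, kochPath n ((j + t) / 4 ^ n) = kochPath n ((j : ℝ) / 4 ^ n)
      + t * (kochPath n ((j + 1 : ℝ) / 4 ^ n) - kochPath n ((j : ℝ) / 4 ^ n)) := by
  induction n generalizing j with
  | zero =>
    obtain rfl : j = 0 := by simpa using hj
    simp [kochPath]
  | succ n ih =>
    have h4 : (0 : ℝ) < 4 ^ n := by positivity
    obtain ⟨q, r, hr, rfl⟩ : ∃ q r : ℕ, r < 4 ^ n ∧ j = q * 4 ^ n + r :=
      ⟨j / 4 ^ n, j % 4 ^ n, Nat.mod_lt _ (by positivity), by rw [mul_comm, Nat.div_add_mod]⟩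
    have hq : q < 4 := by
      by_contra h
      have : 4 * 4 ^ n ≤ q * 4 ^ n := Nat.mul_le_mul_right _ (by omega)
      rw [pow_succ] at hj; omega
    have hr' : (r : ℝ) + 1 ≤ 4 ^ n := by exact_mod_cast hr
    have key : ∀ t ∈ Icc (0 : ℝ) 1, kochPath (n + 1) (((q * 4 ^ n + r : ℕ) + t) / 4 ^ (n + 1))
        = kochBranch q (kochPath n ((r + t) / 4 ^ n)) := by
      intro t ht
      rw [← kochPath_branch n q hq]
      · congr 1; push_cast; field_simp; ring
      · constructor
        · have := ht.1; positivity
        · rw [div_le_one h4]; linarith [ht.2]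
    obtain ⟨i1, i2⟩ := ih r hr
    have k0 := key 0 (by simp)
    have k1 := key 1 (by simp)
    rw [add_zero, add_zero] at k0
    have hdiff : kochPath (n + 1) (((q * 4 ^ n + r : ℕ) + 1) / 4 ^ (n + 1))
        - kochPath (n + 1) ((q * 4 ^ n + r : ℕ) / 4 ^ (n + 1)) = kochRot q / 3 *
        (kochPath n ((r + 1) / 4 ^ n) - kochPath n (r / 4 ^ n)) := by
      rw [k0, k1, kochBranch_sub]; ring
    constructor
    · rw [hdiff]
      have : (3 : ℂ) ^ (n + 1) * (kochRot q / 3 *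
          (kochPath n ((r + 1) / 4 ^ n) - kochPath n (r / 4 ^ n)))
          = kochRot q * (3 ^ n * (kochPath n ((r + 1) / 4 ^ n) - kochPath n (r / 4 ^ n))) := by
        ring
      rw [this, mul_pow, kochRot_pow_six, i1, one_mul]
    · intro t ht
      rw [key t ht, hdiff, k0, i2 t ht, kochBranch_vadd q (_ + _), kochBranch_vadd q (kochPath n _)]
      ring

/-- The vertices of `K_n`, in cyclic order. -/
def vertex (n j : ℕ) : ℂ := snowflakePath n ((j : ℝ) / 4 ^ n)

/-- The edges of `K_n`. -/
def edge (n j : ℕ) : ℂ := vertex n (j + 1) - vertex n j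

theorem snowflakePath_edge (n j : ℕ) (hj : j < 3 * 4 ^ n) :
    (3 ^ n * edge n j) ^ 6 = 1 ∧
    ∀ t ∈ Icc (0 : ℝ) 1, snowflakePath n ((j + t) / 4 ^ n) = vertex n j + t * edge n j := by
  have h4 : (0 : ℝ) < 4 ^ n := by positivity
  obtain ⟨q, r, hr, rfl⟩ : ∃ q r : ℕ, r < 4 ^ n ∧ j = q * 4 ^ n + r :=
    ⟨j / 4 ^ n, j % 4 ^ n, Nat.mod_lt _ (by positivity), by rw [mul_comm, Nat.div_add_mod]⟩
  have hq : q < 3 := by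
    by_contra h
    have : 3 * 4 ^ n ≤ q * 4 ^ n := Nat.mul_le_mul_right _ (by omega)
    omega
  have hr' : (r : ℝ) + 1 ≤ 4 ^ n := by exact_mod_cast hr
  obtain ⟨a, ζ, hζ, hside⟩ := sidePath_vadd n q
  have key : ∀ t ∈ Icc (0 : ℝ) 1, snowflakePath n (((q * 4 ^ n + r : ℕ) + t) / 4 ^ n)
      = a + ζ * kochPath n ((r + t) / 4 ^ n) := by
    intro t ht
    rw [← hside, ← snowflakePath_side n q hq]
    · congr 1; push_cast; field_simp; ring
    · constructor
      · have := ht.1; positivity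
      · rw [div_le_one h4]; linarith [ht.2]
  obtain ⟨i1, i2⟩ := kochPath_edge n r hr
  have k0 := key 0 (by simp)
  have k1 := key 1 (by simp)
  rw [add_zero, add_zero] at k0
  have hdiff : edge n (q * 4 ^ n + r)
      = ζ * (kochPath n ((r + 1) / 4 ^ n) - kochPath n (r / 4 ^ n)) := by
    unfold edge vertex
    rw [Nat.cast_add_one, k0, k1]; ring
  constructor
  · rw [hdiff, mul_left_comm, mul_pow, hζ, i1, one_mul]
  · intro t ht
    rw [hdiff, key t ht, vertex, k0, i2 t ht]; ring

/-- The sixth power of a purely imaginary number is not positive, so it cannot be $1$. Vertical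
lines are therefore transversal to every edge, which the Poincaré inequality relies on. -/
theorem edge_re_ne_zero (n j : ℕ) (hj : j < 3 * 4 ^ n) : (edge n j).re ≠ 0 := by
  intro h
  have h6 := (snowflakePath_edge n j hj).1
  have e : edge n j = Complex.I * ((edge n j).im : ℂ) := by
    apply Complex.ext <;> simp [h]
  have hI : Complex.I ^ 6 = -1 := by
    rw [show Complex.I ^ 6 = (Complex.I ^ 2) ^ 3 by ring, Complex.I_sq]; norm_num
  rw [e, mul_left_comm, mul_pow, hI] at h6
  have h7 : -((3 : ℝ) ^ n * (edge n j).im) ^ 6 = 1 := by exact_mod_cast (by linear_combination h6 :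
    -((3 : ℂ) ^ n * ((edge n j).im : ℂ)) ^ 6 = 1)
  have h8 : 0 ≤ ((3 : ℝ) ^ n * (edge n j).im) ^ 6 := by positivity
  linarith

/-- The `j`-th edge in the arc length parametrization. -/
theorem arcParam_edge (n j : ℕ) (hj : j < 3 * 4 ^ n) {t : ℝ} (ht : t ∈ Icc (0 : ℝ) 1) :
    arcParam n ((1 / 3) ^ n * (j + t)) = vertex n j + t * edge n j := by
  rw [← (snowflakePath_edge n j hj).2 t ht, arcParam, ← mul_assoc, ← mul_pow]
  congr 1
  rw [show (3 / 4 * (1 / 3) : ℝ) = 1 / 4 by norm_num, div_pow, one_pow]; ring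

theorem exists_edge (n : ℕ) {s : ℝ} (hs : s ∈ Icc 0 (perimeter n)) :
    ∃ j : ℕ, j < 3 * 4 ^ n ∧ ∃ t ∈ Icc (0 : ℝ) 1, s = (1 / 3) ^ n * (j + t) := by
  have e : s = (1 / 3) ^ n * (3 ^ n * s) := by
    rw [← mul_assoc, ← mul_pow]; norm_num
  have h0 : 0 ≤ 3 ^ n * s := by have := hs.1; positivity
  have h1 : 3 ^ n * s ≤ 3 * 4 ^ n := by
    calc 3 ^ n * s ≤ 3 ^ n * perimeter n := by have := hs.2; gcongr
      _ = 3 * 4 ^ n := by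
        unfold perimeter; rw [mul_left_comm, ← mul_pow]; norm_num
  set x := 3 ^ n * s
  rcases h1.lt_or_eq with h | h
  · refine ⟨⌊x⌋₊, ?_, x - ⌊x⌋₊, ⟨by linarith [Nat.floor_le h0], by linarith [Nat.lt_floor_add_one x]⟩,
      by rw [e]; ring⟩
    rw [Nat.floor_lt h0]; exact_mod_cast h
  · have hN : 0 < 3 * 4 ^ n := by positivity
    -- At the closing point the floor would be one index too large; the point is taken as the end of
    -- the last edge.
    refine ⟨3 * 4 ^ n - 1, by omega, 1, by simp, ?_⟩
    rw [Nat.cast_sub (by omega), e, h]; push_cast; ring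

theorem vertex_closed (n : ℕ) : vertex n (3 * 4 ^ n) = vertex n 0 := by
  have h4 : (4 : ℝ) ^ n ≠ 0 := by positivity
  have h3 := snowflakePath_side n 2 (by norm_num) (s := 1) (by simp)
  have h0 := snowflakePath_side n 0 (by norm_num) (s := 0) (by simp)
  unfold vertex
  push_cast at h3 h0 ⊢
  rw [mul_div_assoc, div_self h4, mul_one, zero_div, ← add_zero (0 : ℝ), h0,
    show (3 : ℝ) = 2 + 1 by norm_num, h3]
  simp only [sidePath, kochPath_one, kochPath_zero]
  linear_combination one_add_rotSide_add_sq

theorem edge_mul_mem_Icc (n j : ℕ) (hj : j < 3 * 4 ^ n) {t : ℝ} (ht : t ∈ Icc (0 : ℝ) 1) :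
    (1 / 3) ^ n * (j + t) ∈ Icc 0 (perimeter n) := by
  have h1 : (j : ℝ) + 1 ≤ 3 * 4 ^ n := by exact_mod_cast hj
  have := ht.1
  refine ⟨by positivity, ?_⟩
  calc (1 / 3 : ℝ) ^ n * (j + t) ≤ (1 / 3) ^ n * (3 * 4 ^ n) := by gcongr; linarith [ht.2]
    _ = perimeter n := by
      unfold perimeter; rw [mul_left_comm, ← mul_pow]; norm_num

/-! ### Integral inequalities and the bound of `theta2` by the tangential derivative -/

theorem sq_lintegral_le {α : Type*} [MeasurableSpace α] (μ : Measure α) {f : α → ℝ≥0∞}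
    (hf : AEMeasurable f μ) : (∫⁻ x, f x ∂μ) ^ 2 ≤ μ univ * ∫⁻ x, f x ^ 2 ∂μ := by
  have h := ENNReal.lintegral_mul_le_Lp_mul_Lq μ Real.HolderConjugate.two_two
    (aemeasurable_const (b := (1 : ℝ≥0∞))) hf
  simp only [Pi.mul_apply, one_mul, ENNReal.one_rpow, lintegral_one] at h
  have h2 := pow_le_pow_left' h 2
  rw [mul_pow, ← ENNReal.rpow_natCast, ← ENNReal.rpow_natCast (_ ^ (1 / 2 : ℝ)),
    ← ENNReal.rpow_natCast (_ ^ (1 / 2 : ℝ)), ← ENNReal.rpow_mul, ← ENNReal.rpow_mul] at h2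
  norm_num at h2
  exact h2

theorem sq_enorm_integral_le {α : Type*} [MeasurableSpace α] (μ : Measure α) (f : α → ℝ) :
    ‖∫ x, f x ∂μ‖ₑ ^ 2 ≤ μ univ * ∫⁻ x, ‖f x‖ₑ ^ 2 ∂μ := by
  by_cases hf : Integrable f μ
  · exact (pow_le_pow_left' (enorm_integral_le_lintegral_enorm f) 2).trans
      (sq_lintegral_le μ hf.1.enorm)
  · simp [integral_undef hf]

theorem measurable_kochPath (n : ℕ) : Measurable (kochPath n) := by
  induction n with
  | zero => exact Complex.measurable_ofReal
  | succ n ih =>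
    have h (a : ℝ) : MeasurableSet {t : ℝ | t < a} := measurableSet_Iio
    change Measurable fun t : ℝ => kochPath (n + 1) t
    simp only [kochPath]
    refine Measurable.ite (h _) (by fun_prop) (Measurable.ite (h _) (by fun_prop)
      (Measurable.ite (h _) (by fun_prop) (by fun_prop)))

theorem measurable_arcParam (n : ℕ) : Measurable (arcParam n) := by
  have h (a : ℝ) : MeasurableSet {t : ℝ | t < a} := measurableSet_Iio
  have hk := measurable_kochPath n
  have : Measurable (snowflakePath n) := by
    unfold snowflakePath
    exact Measurable.ite (h _) hk (Measurable.ite (h _) (by fun_prop) (by fun_prop))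
  unfold arcParam
  fun_prop

instance (n : ℕ) : IsFiniteMeasure (ds n) := by unfold ds; infer_instance

theorem lintegral_ds (n : ℕ) {F : ℂ → ℝ≥0∞} (hF : AEMeasurable F (ds n)) :
    ∫⁻ x, F x ∂(ds n) = ∫⁻ s in Icc 0 (perimeter n), F (arcParam n s) :=
  lintegral_map' hF (measurable_arcParam n).aemeasurable

theorem ae_ds_iff (n : ℕ) {p : ℂ → Prop} (h : ∀ᵐ x ∂(ds n), p x) :
    ∀ᵐ s ∂(volume.restrict (Icc 0 (perimeter n))), p (arcParam n s) :=
  ae_of_ae_map (measurable_arcParam n).aemeasurable h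

theorem measurable_lintegral_Ioc {F : ℝ → ℝ≥0∞} (hF : Measurable F) :
    Measurable fun p : ℝ × ℝ => ∫⁻ τ in Ioc p.1 p.2, F τ := by
  have e : (fun p : ℝ × ℝ => ∫⁻ τ in Ioc p.1 p.2, F τ)
      = fun p : ℝ × ℝ => ∫⁻ τ, indicator {q : (ℝ × ℝ) × ℝ | q.1.1 < q.2 ∧ q.2 ≤ q.1.2}
        (fun q => F q.2) (p, τ) := by
    funext p
    rw [← lintegral_indicator measurableSet_Ioc]
    rfl
  rw [e]
  refine Measurable.lintegral_prod_right' ?_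
  refine (hF.comp measurable_snd).indicator ?_
  rw [Set.ofPred_and]
  exact (measurableSet_lt (by fun_prop) (by fun_prop)).inter
    (measurableSet_le (by fun_prop) (by fun_prop))

theorem lintegral_Ioc_add (F : ℝ → ℝ≥0∞) (s h : ℝ) :
    ∫⁻ τ in Ioc s (s + h), F τ = ∫⁻ τ in Ioc 0 h, F (s + τ) := by
  rw [← lintegral_indicator measurableSet_Ioc, ← lintegral_indicator measurableSet_Ioc,
    ← lintegral_add_left_eq_self _ s]
  congr 1; funext τ
  simp only [indicator, mem_Ioc, lt_add_iff_pos_right, add_le_add_iff_left]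

/-- Substitute $t=s+h$: for fixed $h$ the mean of $F$ over $(s,s+h]$ has, as a function of $s$, the
same integral as $F$, and $h$ ranges over an interval of length $L$. -/
theorem lintegral_lintegral_average_le {F : ℝ → ℝ≥0∞} (hF : Measurable F) (L : ℝ) :
    ∫⁻ s, ∫⁻ t, indicator {p : ℝ × ℝ | p.1 < p.2 ∧ p.2 < p.1 + L}
      (fun p => ENNReal.ofReal (1 / (p.2 - p.1)) * ∫⁻ τ in Ioc p.1 p.2, F τ) (s, t)
      ≤ ENNReal.ofReal L * ∫⁻ τ, F τ := by
  have h1 : ∀ s, ∫⁻ t, indicator {p : ℝ × ℝ | p.1 < p.2 ∧ p.2 < p.1 + L}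
      (fun p => ENNReal.ofReal (1 / (p.2 - p.1)) * ∫⁻ τ in Ioc p.1 p.2, F τ) (s, t)
      = ∫⁻ h in Ioo 0 L, ENNReal.ofReal (1 / h) * ∫⁻ τ in Ioc 0 h, F (s + τ) := by
    intro s
    rw [← lintegral_add_left_eq_self _ s, ← lintegral_indicator measurableSet_Ioo]
    congr 1; funext h
    simp only [indicator, mem_ofPred_eq, lt_add_iff_pos_right, add_lt_add_iff_left, mem_Ioo,
      add_sub_cancel_left, lintegral_Ioc_add]
  simp only [h1]
  have hm : Measurable fun p : ℝ × ℝ => ∫⁻ τ in Ioc 0 p.2, F (p.1 + τ) := by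
    have := (measurable_lintegral_Ioc hF).comp
      (show Measurable fun p : ℝ × ℝ => (p.1, p.1 + p.2) by fun_prop)
    simpa only [Function.comp_def, lintegral_Ioc_add] using this
  rw [lintegral_lintegral_swap]
  · calc ∫⁻ h in Ioo 0 L, ∫⁻ s, ENNReal.ofReal (1 / h) * ∫⁻ τ in Ioc 0 h, F (s + τ)
        = ∫⁻ h in Ioo 0 L, ∫⁻ τ, F τ := by
          refine setLIntegral_congr_fun measurableSet_Ioo fun h hh => ?_
          have hm' : Measurable fun s => ∫⁻ τ in Ioc 0 h, F (s + τ) :=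
            hm.comp (measurable_id.prodMk measurable_const)
          rw [lintegral_const_mul _ hm',
            lintegral_lintegral_swap]
          · have : ∀ τ : ℝ, ∫⁻ s, F (s + τ) = ∫⁻ s, F s := fun τ =>
              lintegral_add_right_eq_self _ τ
            simp only [this]
            rw [setLIntegral_const, Real.volume_Ioc, sub_zero, mul_comm (∫⁻ _, _), ← mul_assoc,
              ← ENNReal.ofReal_mul (by have := hh.1; positivity), one_div,
              inv_mul_cancel₀ hh.1.ne']
            simp
          · exact (hF.comp (measurable_fst.add measurable_snd)).aemeasurable
      _ ≤ _ := by
        rw [setLIntegral_const, Real.volume_Ioo, sub_zero, mul_comm]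
  · refine Measurable.aemeasurable ?_
    refine Measurable.mul ?_ hm
    fun_prop

/-- For a fixed difference $h=t-s$ the admissible $s$ form an interval of length $L-h$, which
cancels the singular factor. This serves the pairs of points that are close through the closing
point. -/
theorem lintegral_lintegral_inv_le (L : ℝ) :
    ∫⁻ s, ∫⁻ t, indicator {p : ℝ × ℝ | 0 < p.1 ∧ p.1 < p.2 ∧ p.2 < L}
      (fun p => ENNReal.ofReal (1 / (L - (p.2 - p.1)))) (s, t) ≤ ENNReal.ofReal L := by
  have h1 : ∀ s, ∫⁻ t, indicator {p : ℝ × ℝ | 0 < p.1 ∧ p.1 < p.2 ∧ p.2 < L}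
      (fun p => ENNReal.ofReal (1 / (L - (p.2 - p.1)))) (s, t)
      = ∫⁻ h, indicator {p : ℝ × ℝ | 0 < p.1 ∧ 0 < p.2 ∧ p.1 + p.2 < L}
      (fun p => ENNReal.ofReal (1 / (L - p.2))) (s, h) := by
    intro s
    rw [← lintegral_add_left_eq_self _ s]
    congr 1; funext h
    simp only [indicator, mem_ofPred_eq, lt_add_iff_pos_right, add_sub_cancel_left]
  simp only [h1]
  rw [lintegral_lintegral_swap]
  · calc _ ≤ ∫⁻ h, indicator (Ioo 0 L) 1 h := by
          refine lintegral_mono fun h => ?_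
          by_cases hh : h ∈ Ioo 0 L
          · have : (fun s => indicator {p : ℝ × ℝ | 0 < p.1 ∧ 0 < p.2 ∧ p.1 + p.2 < L}
                (fun p => ENNReal.ofReal (1 / (L - p.2))) (s, h))
                = indicator (Ioo 0 (L - h)) (fun _ => ENNReal.ofReal (1 / (L - h))) := by
              funext s
              have e : (0 < s ∧ 0 < h ∧ s + h < L) ↔ s ∈ Ioo 0 (L - h) := by
                constructor
                · rintro ⟨a, -, b⟩; exact ⟨a, by linarith⟩
                · rintro ⟨a, b⟩; exact ⟨a, hh.1, by linarith⟩
              simp only [indicator, mem_ofPred_eq, e]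
            simp only [this, indicator_of_mem hh]
            have hL : 0 < L - h := by linarith [hh.2]
            rw [lintegral_indicator measurableSet_Ioo, setLIntegral_const, Real.volume_Ioo,
              sub_zero, ← ENNReal.ofReal_mul (by positivity), one_div, inv_mul_cancel₀ hL.ne']
            simp
          · have : (fun s => indicator {p : ℝ × ℝ | 0 < p.1 ∧ 0 < p.2 ∧ p.1 + p.2 < L}
                (fun p => ENNReal.ofReal (1 / (L - p.2))) (s, h)) = 0 := by
              funext s
              refine indicator_of_notMem ?_ _
              rintro ⟨a, b, c⟩
              simp only at a b c
              exact hh ⟨b, by linarith⟩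
            rw [this]
            exact lintegral_zero.le.trans (zero_le)
      _ = ENNReal.ofReal L := by
        rw [lintegral_indicator measurableSet_Ioo]; simp
  · refine Measurable.aemeasurable ?_
    refine Measurable.indicator (by fun_prop) ?_
    rw [Set.ofPred_and, Set.ofPred_and]
    exact (measurableSet_lt (by fun_prop) (by fun_prop)).inter
      ((measurableSet_lt (by fun_prop) (by fun_prop)).inter
        (measurableSet_lt (by fun_prop) (by fun_prop)))

theorem ennreal_add_sq_le (a b : ℝ≥0∞) : (a + b) ^ 2 ≤ 2 * (a ^ 2 + b ^ 2) := by
  have h := ENNReal.rpow_add_le_mul_rpow_add_rpow a b (p := 2) (by norm_num)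
  rw [show (2 : ℝ) - 1 = 1 by norm_num, ENNReal.rpow_one, ENNReal.rpow_two, ENNReal.rpow_two,
    ENNReal.rpow_two] at h
  exact h

theorem ofReal_integral_sq_ds (n : ℕ) {g : ℂ → ℝ} (hg : MemLp g 2 (ds n)) :
    ENNReal.ofReal (∫ x, g x ^ 2 ∂(ds n))
      = ∫⁻ τ in Icc 0 (perimeter n), ‖g (arcParam n τ)‖ₑ ^ 2 := by
  rw [ofReal_integral_eq_lintegral_ofReal hg.integrable_sq (ae_of_all _ fun x => sq_nonneg _),
    lintegral_ds n (by have := hg.1.aemeasurable; fun_prop)]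
  congr 1; funext τ
  rw [Real.enorm_eq_ofReal_abs, ← ENNReal.ofReal_pow (abs_nonneg _), sq_abs]

theorem memLp_comp_arcParam (n : ℕ) {g : ℂ → ℝ} (hg : MemLp g 2 (ds n)) :
    MemLp (fun s => g (arcParam n s)) 2 (volume.restrict (Icc 0 (perimeter n))) :=
  hg.comp_measurePreserving ⟨measurable_arcParam n, rfl⟩

theorem intervalIntegrable_arcParam (n : ℕ) {g : ℂ → ℝ} (hg : MemLp g 2 (ds n)) {s t : ℝ}
    (hs : s ∈ Icc 0 (perimeter n)) (ht : t ∈ Icc 0 (perimeter n)) :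
    IntervalIntegrable (fun τ => g (arcParam n τ)) volume s t := by
  have h : IntegrableOn (fun τ => g (arcParam n τ)) (Icc 0 (perimeter n)) :=
    (memLp_comp_arcParam n hg).integrable (by norm_num)
  exact (h.mono_set (uIcc_subset_Icc hs ht)).intervalIntegrable

theorem sq_enorm_intervalIntegral_le {g : ℝ → ℝ} {s t : ℝ} (hst : s ≤ t) :
    ‖∫ τ in s..t, g τ‖ₑ ^ 2 ≤ ENNReal.ofReal (t - s) * ∫⁻ τ in Ioc s t, ‖g τ‖ₑ ^ 2 := by
  rw [intervalIntegral.integral_of_le hst]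
  refine (sq_enorm_integral_le _ _).trans (le_of_eq ?_)
  simp

/-- The pointwise bound of the kernel of `θ₂` on a curve satisfying the chord-arc condition. -/
theorem sq_div_le_of_chordArc {L c s t w d : ℝ} {I J : ℝ≥0∞} (hc : 0 < c)
    (hst : s < t) (hL : t - s < L) (hd : c * min (t - s) (L - (t - s)) ≤ d)
    (hI : ‖w‖ₑ ^ 2 ≤ ENNReal.ofReal (t - s) * I)
    (hJ : ‖w‖ₑ ^ 2 ≤ ENNReal.ofReal (L - (t - s)) * J) :
    ENNReal.ofReal (w * w / d ^ 2) ≤ ENNReal.ofReal (1 / c ^ 2) *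
      (ENNReal.ofReal (1 / (t - s)) * I + ENNReal.ofReal (1 / (L - (t - s))) * J) := by
  have e : ‖w‖ₑ ^ 2 = ENNReal.ofReal (w * w) := by
    rw [Real.enorm_eq_ofReal_abs, ← ENNReal.ofReal_pow (abs_nonneg _), sq_abs, sq]
  have key : ∀ x : ℝ, 0 < x → c * x ≤ d → ∀ I : ℝ≥0∞, ‖w‖ₑ ^ 2 ≤ ENNReal.ofReal x * I →
      ENNReal.ofReal (w * w / d ^ 2)
        ≤ ENNReal.ofReal (1 / c ^ 2) * (ENNReal.ofReal (1 / x) * I) := by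
    intro x hx hxd I hI
    calc ENNReal.ofReal (w * w / d ^ 2)
        ≤ ENNReal.ofReal (1 / c ^ 2 * (1 / x) * (1 / x) * (w * w)) := by
          apply ENNReal.ofReal_le_ofReal
          have h1 : (c * x) ^ 2 ≤ d ^ 2 := pow_le_pow_left₀ (by positivity) hxd 2
          calc w * w / d ^ 2 ≤ w * w / (c * x) ^ 2 := by
                apply div_le_div_of_nonneg_left (mul_self_nonneg w) (by positivity) h1
            _ = _ := by field_simp
      _ = ENNReal.ofReal (1 / c ^ 2 * (1 / x) * (1 / x)) * ‖w‖ₑ ^ 2 := by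
          rw [ENNReal.ofReal_mul (by positivity), e]
      _ ≤ ENNReal.ofReal (1 / c ^ 2 * (1 / x) * (1 / x)) * (ENNReal.ofReal x * I) := by gcongr
      _ = _ := by
          rw [← mul_assoc, ← mul_assoc, ← ENNReal.ofReal_mul (by positivity),
            ← ENNReal.ofReal_mul (by positivity)]
          congr 2; field_simp
  rcases le_total (t - s) (L - (t - s)) with h | h
  · rw [min_eq_left h] at hd
    refine (key _ (by linarith) hd I hI).trans ?_
    gcongr; exact le_self_add
  · rw [min_eq_right h] at hd
    refine (key _ (by linarith) hd J hJ).trans ?_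
    gcongr; exact le_add_self

/-- Write $I=\int g^2$. For $s<t$, Cauchy–Schwarz on the arc from $s$ to $t$ gives
$|w(s)-w(t)|^2\le(t-s)\int_s^tg^2$. On the complementary arc, usable because $g$ has zero integral,
it gives $|w(s)-w(t)|^2\le(L-(t-s))\,2I$. Dividing by the square of the chord-arc bound leaves
$\frac1{t-s}\int_s^tg^2+\frac{2I}{L-(t-s)}$ up to $1/c^2$, and both terms are integrable over pairs.
-/
theorem integral_theta_kernel_le (n : ℕ) : ∃ C : ℝ, 0 ≤ C ∧ ∀ u g : ℂ → ℝ, IsTangDeriv n u g →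
    ∫ p : ℂ × ℂ, (u p.1 - u p.2) * (u p.1 - u p.2) / ‖p.1 - p.2‖ ^ 2 ∂((ds n).prod (ds n))
      ≤ C * ∫ x, g x ^ 2 ∂(ds n) := by
  obtain ⟨c, hc, hca⟩ := arcParam_chordArc n
  set L := perimeter n
  have hL : 0 < L := perimeter_pos n
  -- The direct arc contributes $L\,I$ and the complementary arc $2L\,I$; the factor $2$ accounts
  -- for the pairs with $t<s$.
  refine ⟨2 * (1 / c ^ 2 * (3 * L)), by positivity, ?_⟩
  rintro u g ⟨hg, ⟨k, hk⟩, hper⟩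
  set γ := arcParam n with hγ
  have hγm : Measurable γ := measurable_arcParam n
  set μ := volume.restrict (Icc 0 L) with hμ
  set w : ℝ → ℝ := fun s => k + ∫ τ in (0 : ℝ)..s, g (γ τ) with hw
  set I := ∫⁻ τ in Icc 0 L, ‖g (γ τ)‖ₑ ^ 2
  have hgm : AEStronglyMeasurable (fun τ => g (γ τ)) μ := (memLp_comp_arcParam n hg).1
  obtain ⟨F, hF, hFint, hFeq⟩ : ∃ F : ℝ → ℝ≥0∞, Measurable F ∧ ∫⁻ τ, F τ = I ∧
      ∀ s ∈ Icc 0 L, ∀ t ∈ Icc 0 L, ∫⁻ τ in Ioc s t, ‖g (γ τ)‖ₑ ^ 2 = ∫⁻ τ in Ioc s t, F τ := by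
    have hm : Measurable (fun τ => ‖hgm.mk _ τ‖ₑ ^ 2) :=
      (hgm.stronglyMeasurable_mk.measurable.enorm).pow_const 2
    refine ⟨indicator (Icc 0 L) (fun τ => ‖hgm.mk _ τ‖ₑ ^ 2), hm.indicator measurableSet_Icc,
      ?_, ?_⟩
    · rw [lintegral_indicator measurableSet_Icc]
      refine lintegral_congr_ae ?_
      filter_upwards [hgm.ae_eq_mk] with τ hτ
      rw [hτ]
    · intro s hs t ht
      have hsub : Ioc s t ⊆ Icc 0 L := fun x hx => ⟨hs.1.trans hx.1.le, hx.2.trans ht.2⟩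
      refine lintegral_congr_ae ?_
      filter_upwards [ae_restrict_of_ae_restrict_of_subset hsub hgm.ae_eq_mk,
        ae_restrict_mem measurableSet_Ioc] with τ hτ hτ2
      rw [indicator_of_mem (hsub hτ2), hτ]
  have hwsub : ∀ s ∈ Icc 0 L, ∀ t ∈ Icc 0 L, w s - w t = -∫ τ in s..t, g (γ τ) := by
    intro s hs t ht
    have h0 : (0 : ℝ) ∈ Icc 0 L := ⟨le_rfl, hL.le⟩
    have := intervalIntegral.integral_add_adjacent_intervals
      (intervalIntegrable_arcParam n hg h0 hs) (intervalIntegrable_arcParam n hg hs ht)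
    simp only [hw, ← hγ] at this ⊢
    linarith
  have hlocal : ∀ s ∈ Icc 0 L, ∀ t ∈ Icc 0 L, s ≤ t →
      ‖w s - w t‖ₑ ^ 2 ≤ ENNReal.ofReal (t - s) * ∫⁻ τ in Ioc s t, F τ := by
    intro s hs t ht hst
    rw [hwsub s hs t ht, enorm_neg, ← hFeq s hs t ht]
    exact sq_enorm_intervalIntegral_le hst
  have hFle : ∀ s t, ∫⁻ τ in Ioc s t, F τ ≤ I := fun s t => by
    rw [← hFint]; exact setLIntegral_le_lintegral _ _
  have h0L : w 0 = w L := by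
    have hper' : ∫ τ in (0 : ℝ)..L, g (γ τ) = 0 := hper
    simp [hw, hper']
  have hglob : ∀ s ∈ Icc 0 L, ∀ t ∈ Icc 0 L, s ≤ t →
      ‖w s - w t‖ₑ ^ 2 ≤ ENNReal.ofReal (L - (t - s)) * (2 * I) := by
    intro s hs t ht hst
    have a1 := (hlocal 0 ⟨le_rfl, hL.le⟩ s hs hs.1).trans (mul_le_mul_right (hFle _ _) _)
    have a2 := (hlocal t ht L ⟨hL.le, le_rfl⟩ ht.2).trans (mul_le_mul_right (hFle _ _) _)
    have a3 : ‖w s - w t‖ₑ ≤ ‖w 0 - w s‖ₑ + ‖w t - w L‖ₑ := by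
      have : w s - w t = -((w 0 - w s) + (w t - w L)) := by rw [h0L]; ring
      rw [this, enorm_neg]; exact enorm_add_le _ _
    calc ‖w s - w t‖ₑ ^ 2 ≤ (‖w 0 - w s‖ₑ + ‖w t - w L‖ₑ) ^ 2 := by gcongr
      _ ≤ 2 * (‖w 0 - w s‖ₑ ^ 2 + ‖w t - w L‖ₑ ^ 2) := ennreal_add_sq_le _ _
      _ ≤ 2 * (ENNReal.ofReal (s - 0) * I + ENNReal.ofReal (L - t) * I) := by gcongr
      _ = ENNReal.ofReal (L - (t - s)) * (2 * I) := by
          rw [← add_mul, ← ENNReal.ofReal_add (by linarith [hs.1]) (by linarith [ht.2])]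
          rw [show s - 0 + (L - t) = L - (t - s) by ring]; ring
  set B₁ : ℝ × ℝ → ℝ≥0∞ := indicator {p : ℝ × ℝ | p.1 < p.2 ∧ p.2 < p.1 + L}
    (fun p => ENNReal.ofReal (1 / (p.2 - p.1)) * ∫⁻ τ in Ioc p.1 p.2, F τ) with hB1
  set B₂ : ℝ × ℝ → ℝ≥0∞ := indicator {p : ℝ × ℝ | 0 < p.1 ∧ p.1 < p.2 ∧ p.2 < L}
    (fun p => ENNReal.ofReal (1 / (L - (p.2 - p.1)))) with hB2
  set B : ℝ × ℝ → ℝ≥0∞ := fun p => B₁ p + B₂ p * (2 * I) with hB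
  have hB1m : Measurable B₁ := by
    refine Measurable.indicator (Measurable.mul (by fun_prop) (measurable_lintegral_Ioc hF)) ?_
    rw [Set.ofPred_and]
    exact (measurableSet_lt (by fun_prop) (by fun_prop)).inter
      (measurableSet_lt (by fun_prop) (by fun_prop))
  have hB2m : Measurable B₂ := by
    refine Measurable.indicator (by fun_prop) ?_
    rw [Set.ofPred_and, Set.ofPred_and]
    exact (measurableSet_lt (by fun_prop) (by fun_prop)).inter
      ((measurableSet_lt (by fun_prop) (by fun_prop)).inter
        (measurableSet_lt (by fun_prop) (by fun_prop)))
  have hBm : Measurable B := hB1m.add (hB2m.mul_const _)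
  have hBint : ∫⁻ p, B p ∂(μ.prod μ) ≤ ENNReal.ofReal (3 * L) * I := by
    have hle : μ.prod μ ≤ (volume : Measure ℝ).prod volume := by
      rw [hμ, Measure.prod_restrict]; exact Measure.restrict_le_self
    calc ∫⁻ p, B p ∂(μ.prod μ) ≤ ∫⁻ p, B p ∂((volume : Measure ℝ).prod volume) :=
          lintegral_mono' hle le_rfl
      _ = (∫⁻ p, B₁ p ∂((volume : Measure ℝ).prod volume))
          + (∫⁻ p, B₂ p ∂((volume : Measure ℝ).prod volume)) * (2 * I) := by
          rw [hB, lintegral_add_left hB1m, lintegral_mul_const _ hB2m]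
      _ ≤ ENNReal.ofReal L * I + ENNReal.ofReal L * (2 * I) := by
          rw [lintegral_prod _ hB1m.aemeasurable, lintegral_prod _ hB2m.aemeasurable, ← hFint]
          gcongr
          · exact lintegral_lintegral_average_le hF L
          · exact lintegral_lintegral_inv_le L
      _ = ENNReal.ofReal (3 * L) * I := by
          rw [ENNReal.ofReal_mul (by norm_num)]
          norm_num
          ring
  set Φ : ℝ × ℝ → ℝ≥0∞ := fun p =>
    ENNReal.ofReal ((u (γ p.1) - u (γ p.2)) * (u (γ p.1) - u (γ p.2)) / ‖γ p.1 - γ p.2‖ ^ 2)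
  have hpt : ∀ s ∈ Ioo 0 L, ∀ t ∈ Ioo 0 L, s < t → u (γ s) = w s → u (γ t) = w t →
      Φ (s, t) ≤ ENNReal.ofReal (1 / c ^ 2) * B (s, t) := by
    intro s hs t ht hst es et
    have hs' := Ioo_subset_Icc_self hs
    have ht' := Ioo_subset_Icc_self ht
    have hd := hca s hs' t ht'
    rw [abs_sub_comm, abs_of_pos (sub_pos.2 hst)] at hd
    have := sq_div_le_of_chordArc hc hst (by linarith [hs.1, ht.2]) hd
      (hlocal s hs' t ht' hst.le) (hglob s hs' t ht' hst.le)
    simp only [Φ, es, et, hB, hB1, hB2]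
    rw [indicator_of_mem (by exact ⟨hst, by simp only; linarith [hs.1, ht.2]⟩),
      indicator_of_mem (by exact ⟨hs.1, hst, ht.2⟩)]
    exact this
  have hae : ∀ᵐ s ∂μ, s ∈ Ioo 0 L ∧ u (γ s) = w s := by
    have : ∀ᵐ s ∂μ, s ∈ Ioo 0 L := by
      rw [hμ, ← restrict_Ioo_eq_restrict_Icc]; exact ae_restrict_mem measurableSet_Ioo
    filter_upwards [this, hk] with s h1 h2 using ⟨h1, h2⟩
  have hΦ : ∀ᵐ p ∂(μ.prod μ), Φ p ≤ ENNReal.ofReal (1 / c ^ 2) * (B p + B p.swap) := by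
    filter_upwards [Measure.quasiMeasurePreserving_fst.ae hae,
      Measure.quasiMeasurePreserving_snd.ae hae] with ⟨s, t⟩ ⟨hs, es⟩ ⟨ht, et⟩
    simp only at hs es ht et
    rcases lt_trichotomy s t with h | rfl | h
    · refine (hpt s hs t ht h es et).trans ?_
      gcongr; exact le_self_add
    · simp [Φ]
    · have hsymm : Φ (s, t) = Φ (t, s) := by
        simp only [Φ]; rw [norm_sub_rev]; congr 2; ring
      rw [hsymm]
      refine (hpt t ht s hs h et es).trans ?_
      gcongr; exact le_add_self
  have hG0 : 0 ≤ ∫ x, g x ^ 2 ∂(ds n) := integral_nonneg fun x => sq_nonneg _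
  have hΦint : ∫⁻ p, Φ p ∂(μ.prod μ)
      ≤ ENNReal.ofReal (2 * (1 / c ^ 2 * (3 * L)) * ∫ x, g x ^ 2 ∂(ds n)) := by
    calc ∫⁻ p, Φ p ∂(μ.prod μ) ≤ ∫⁻ p, ENNReal.ofReal (1 / c ^ 2) * (B p + B p.swap) ∂(μ.prod μ) :=
          lintegral_mono_ae hΦ
      _ = ENNReal.ofReal (1 / c ^ 2) *
          (∫⁻ p, B p ∂(μ.prod μ) + ∫⁻ p, B p.swap ∂(μ.prod μ)) := by
          have hm : Measurable fun p => B p + B p.swap := hBm.add (hBm.comp measurable_swap)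
          rw [lintegral_const_mul _ hm, lintegral_add_left hBm]
      _ ≤ ENNReal.ofReal (1 / c ^ 2) * (ENNReal.ofReal (3 * L) * I + ENNReal.ofReal (3 * L) * I) := by
          have : ∫⁻ p, B p.swap ∂(μ.prod μ) = ∫⁻ p, B p ∂(μ.prod μ) :=
            (Measure.measurePreserving_swap (μ := μ) (ν := μ)).lintegral_comp hBm
          rw [this]; gcongr
      _ = _ := by
          have h1 : I = ENNReal.ofReal (∫ x, g x ^ 2 ∂(ds n)) := (ofReal_integral_sq_ds n hg).symm
          rw [h1, ← ENNReal.ofReal_mul (by positivity), ← ENNReal.ofReal_add (by positivity)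
            (by positivity), ← ENNReal.ofReal_mul (by positivity)]
          congr 1; ring
  have hprod : (ds n).prod (ds n) = Measure.map (Prod.map γ γ) (μ.prod μ) := by
    rw [ds, Measure.map_prod_map _ _ hγm hγm]
  by_cases hint : Integrable (fun p : ℂ × ℂ =>
      (u p.1 - u p.2) * (u p.1 - u p.2) / ‖p.1 - p.2‖ ^ 2) ((ds n).prod (ds n))
  · rw [integral_eq_lintegral_of_nonneg_ae
      (ae_of_all _ fun p => div_nonneg (mul_self_nonneg _) (sq_nonneg _)) hint.1]
    refine ENNReal.toReal_le_of_le_ofReal (by positivity) (le_trans ?_ hΦint)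
    rw [hprod]
    exact lintegral_map_le _ _
  -- A non-integrable kernel has Bochner integral $0$ by convention.
  · rw [integral_undef hint]; positivity

/-! ### Topology of the domain: simplicity of the polygon and the winding number -/

/-- The closed segment carrying the `j`-th edge of `K_n`. -/
def edgeSegment (n j : ℕ) : Set ℂ := (fun t : ℝ => vertex n j + t * edge n j) '' Icc 0 1

theorem K_eq_iUnion (n : ℕ) : K n = ⋃ j ∈ Finset.range (3 * 4 ^ n), edgeSegment n j := by
  ext z
  simp only [K, mem_image, mem_iUnion, Finset.mem_range, exists_prop, edgeSegment]
  constructor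
  · rintro ⟨s, hs, rfl⟩
    obtain ⟨j, hj, t, ht, rfl⟩ := exists_edge n hs
    exact ⟨j, hj, t, ht, (arcParam_edge n j hj ht).symm⟩
  · rintro ⟨j, hj, t, ht, rfl⟩
    exact ⟨_, edge_mul_mem_Icc n j hj ht, arcParam_edge n j hj ht⟩

theorem edgeSegment_subset_K (n j : ℕ) (hj : j < 3 * 4 ^ n) : edgeSegment n j ⊆ K n := by
  rw [K_eq_iUnion]
  exact subset_biUnion_of_mem (u := fun j => edgeSegment n j) (Finset.mem_range.2 hj)

theorem isCompact_edgeSegment (n j : ℕ) : IsCompact (edgeSegment n j) :=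
  isCompact_Icc.image (by fun_prop)

theorem isCompact_K (n : ℕ) : IsCompact (K n) := by
  rw [K_eq_iUnion]
  exact (Finset.range _).isCompact_biUnion fun j _ => isCompact_edgeSegment n j

theorem isOpen_compl_K (n : ℕ) : IsOpen (K n)ᶜ := (isCompact_K n).isClosed.isOpen_compl

theorem isOpen_Omega (n : ℕ) : IsOpen (Omega n) := (isOpen_compl_K n).connectedComponentIn

theorem Omega_subset_compl_K (n : ℕ) : Omega n ⊆ (K n)ᶜ := connectedComponentIn_subset _ _

theorem mem_Omega_of_preconnected (n : ℕ) {S : Set ℂ} (hS : IsPreconnected S) (hSK : S ⊆ (K n)ᶜ)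
    {z : ℂ} (hz : z ∈ S) (hzO : z ∈ Omega n) : S ⊆ Omega n := by
  unfold Omega at *
  rw [connectedComponentIn_eq hzO]
  exact hS.subset_connectedComponentIn hz hSK

theorem closure_Omega_subset (n : ℕ) : closure (Omega n) ⊆ Omega n ∪ K n := by
  intro z hz
  by_cases hK : z ∈ K n
  · exact Or.inr hK
  · left
    obtain ⟨r, hr, hb⟩ := Metric.isOpen_iff.1 (isOpen_compl_K n) z hK
    obtain ⟨w, hwO, hw⟩ := Metric.mem_closure_iff.1 hz r hr
    exact mem_Omega_of_preconnected n (convex_ball z r).isPreconnected hb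
      (by rwa [Metric.mem_ball, dist_comm]) hwO (Metric.mem_ball_self hr)

theorem edge_ne_zero (n j : ℕ) (hj : j < 3 * 4 ^ n) : edge n j ≠ 0 := by
  intro h; exact edge_re_ne_zero n j hj (by simp [h])

/-- By the chord-arc inequality, coinciding points have arc length parameters differing by $0$ or by
the whole perimeter; neither is possible when one point is interior to its edge and the other lies
on a different edge. -/
theorem edge_interior_notMem (n j k : ℕ) (hj : j < 3 * 4 ^ n) (hk : k < 3 * 4 ^ n) (hjk : k ≠ j)
    {t₀ : ℝ} (ht₀ : t₀ ∈ Ioo (0 : ℝ) 1) : vertex n j + t₀ * edge n j ∉ edgeSegment n k := by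
  rintro ⟨t, ht, h⟩
  obtain ⟨c, hc, hca⟩ := arcParam_chordArc n
  have h3 : (0 : ℝ) < (1 / 3) ^ n := by positivity
  have ht₀' := Ioo_subset_Icc_self ht₀
  have key := hca _ (edge_mul_mem_Icc n j hj ht₀') _ (edge_mul_mem_Icc n k hk ht)
  simp only at h
  rw [arcParam_edge n j hj ht₀', arcParam_edge n k hk ht, h, sub_self, norm_zero, ← mul_sub,
    abs_mul, abs_of_pos h3] at key
  have hL : perimeter n = (1 / 3) ^ n * (3 * 4 ^ n) := by
    unfold perimeter; rw [mul_left_comm, ← mul_pow]; norm_num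
  rw [hL, ← mul_sub, ← mul_min_of_nonneg _ _ h3.le] at key
  have hmin : min |(j + t₀) - (k + t)| (3 * 4 ^ n - |(j + t₀) - (k + t)|) ≤ 0 := by
    by_contra hpos
    push Not at hpos
    have : 0 < c * ((1 / 3) ^ n * min |(j + t₀) - (k + t)| (3 * 4 ^ n - |(j + t₀) - (k + t)|)) := by
      positivity
    linarith
  have j0 : (0 : ℝ) ≤ j := j.cast_nonneg
  have k0 : (0 : ℝ) ≤ k := k.cast_nonneg
  have j1 : (j : ℝ) + 1 ≤ 3 * 4 ^ n := by exact_mod_cast hj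
  have k1 : (k : ℝ) + 1 ≤ 3 * 4 ^ n := by exact_mod_cast hk
  rcases min_le_iff.1 hmin with h0 | h0
  · have := abs_nonpos_iff.1 h0
    rcases lt_or_gt_of_ne hjk with hlt | hlt
    · have : (k : ℝ) + 1 ≤ j := by exact_mod_cast hlt
      linarith [ht.1, ht.2, ht₀.1, ht₀.2]
    · have : (j : ℝ) + 1 ≤ k := by exact_mod_cast hlt
      linarith [ht.1, ht.2, ht₀.1, ht₀.2]
  · have : |(j + t₀) - (k + t)| < 3 * 4 ^ n := by
      rw [abs_lt]; constructor <;> linarith [ht.1, ht.2, ht₀.1, ht₀.2]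
    linarith

/-- The quotient of the vectors from a point off a segment to the endpoints is not in `(-∞,0]`. -/
theorem div_mem_slitPlane {p e z : ℂ} (h : ∀ t ∈ Icc (0 : ℝ) 1, p + t * e ≠ z) :
    (p + e - z) / (p - z) ∈ Complex.slitPlane := by
  have h0 : p - z ≠ 0 := by
    have := h 0 (by simp); simpa [sub_eq_zero] using this
  by_contra hn
  rw [Complex.mem_slitPlane_iff] at hn
  push Not at hn
  obtain ⟨hre, him⟩ := hn
  set q := (p + e - z) / (p - z)
  have hq : p + e - z = q * (p - z) := by rw [div_mul_cancel₀ _ h0]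
  have hqr : q = ((-q.re : ℝ) : ℂ) * (-1) := by apply Complex.ext <;> simp [him]
  set r := -q.re
  have hr : 0 ≤ r := by simp only [r]; linarith
  have hr1 : (1 + r : ℂ) ≠ 0 := by exact_mod_cast (by linarith : (1 + r : ℝ) ≠ 0)
  -- If the quotient is $-r$ with $r\ge0$, then $p+e-z=-r(p-z)$, that is $z=p+\frac1{1+r}e$, a point
  -- of the segment.
  refine h (1 / (1 + r)) ⟨by positivity, by rw [div_le_one (by linarith)]; linarith⟩ ?_
  rw [hqr] at hq
  push_cast
  field_simp
  linear_combination hq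

/-- The winding number of `K_n` around `z`, times `2πi`. -/
def winding (n : ℕ) (z : ℂ) : ℂ :=
  ∑ j ∈ Finset.range (3 * 4 ^ n), Complex.log ((vertex n j + edge n j - z) / (vertex n j - z))

theorem vertex_succ (n j : ℕ) : vertex n (j + 1) = vertex n j + edge n j := by
  unfold edge; ring

theorem continuousAt_log_edge (n j : ℕ) {z : ℂ} (hz : z ∉ edgeSegment n j) :
    ContinuousAt (fun z => Complex.log ((vertex n j + edge n j - z) / (vertex n j - z))) z := by
  have h : ∀ t ∈ Icc (0 : ℝ) 1, vertex n j + t * edge n j ≠ z := fun t ht e => hz ⟨t, ht, e⟩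
  have h0 : vertex n j - z ≠ 0 := by
    have := h 0 (by simp); simpa [sub_eq_zero] using this
  exact ContinuousAt.clog (ContinuousAt.div (by fun_prop) (by fun_prop) h0) (div_mem_slitPlane h)

/-- Off an edge its quotient avoids the cut, so the principal logarithm is differentiable there; the
derivatives telescope around the closed polygon. -/
theorem hasDerivAt_winding (n : ℕ) {z : ℂ} (hz : z ∉ K n) : HasDerivAt (winding n) 0 z := by
  have key : ∀ j ∈ Finset.range (3 * 4 ^ n), HasDerivAt
      (fun z => Complex.log ((vertex n j + edge n j - z) / (vertex n j - z)))
      ((vertex n j - z)⁻¹ - (vertex n (j + 1) - z)⁻¹) z := by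
    intro j hj
    have hs : z ∉ edgeSegment n j := fun h => hz (edgeSegment_subset_K n j (Finset.mem_range.1 hj) h)
    have h : ∀ t ∈ Icc (0 : ℝ) 1, vertex n j + t * edge n j ≠ z := fun t ht e => hs ⟨t, ht, e⟩
    have h0 : vertex n j - z ≠ 0 := by
      have := h 0 (by simp); simpa [sub_eq_zero] using this
    have h1 : vertex n j + edge n j - z ≠ 0 := by
      have := h 1 (by simp); simpa [sub_eq_zero] using this
    have d1 : HasDerivAt (fun z => (vertex n j + edge n j - z) / (vertex n j - z))
        (((-1) * (vertex n j - z) - (vertex n j + edge n j - z) * (-1)) / (vertex n j - z) ^ 2) z :=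
      ((hasDerivAt_id z).const_sub _).div ((hasDerivAt_id z).const_sub _) h0
    convert d1.clog (div_mem_slitPlane h) using 1
    rw [vertex_succ]
    field_simp
    ring
  have := HasDerivAt.fun_sum key
  rw [Finset.sum_range_sub' (fun j => (vertex n j - z)⁻¹), vertex_closed, sub_self] at this
  exact this

theorem winding_eq_of_mem_Omega (n : ℕ) {z w : ℂ} (hz : z ∈ Omega n) (hw : w ∈ Omega n) :
    winding n z = winding n w := by
  have hd : ∀ x ∈ Omega n, HasDerivAt (winding n) 0 x := fun x hx =>
    hasDerivAt_winding n (Omega_subset_compl_K n hx)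
  exact (isOpen_Omega n).is_const_of_deriv_eq_zero isPreconnected_connectedComponentIn
    (fun x hx => (hd x hx).differentiableAt.differentiableWithinAt) (fun x hx => (hd x hx).deriv)
    hz hw

theorem tendsto_winding_cobounded (n : ℕ) :
    Tendsto (winding n) (Bornology.cobounded ℂ) (𝓝 0) := by
  rw [show (0 : ℂ) = ∑ j ∈ Finset.range (3 * 4 ^ n), Complex.log 1 by simp]
  refine tendsto_finsetSum _ fun j _ => ?_
  refine Tendsto.clog ?_ Complex.one_mem_slitPlane
  have h1 : Tendsto (fun z => vertex n j - z) (Bornology.cobounded ℂ) (Bornology.cobounded ℂ) := by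
    rw [← tendsto_norm_atTop_iff_cobounded]
    refine tendsto_atTop_mono (f := fun z : ℂ => ‖z‖ - ‖vertex n j‖) (fun z => ?_)
      (tendsto_atTop_add_const_right _ _ tendsto_norm_cobounded_atTop)
    rw [norm_sub_rev]; exact norm_sub_norm_le _ _
  have h2 : Tendsto (fun z => 1 + edge n j * (vertex n j - z)⁻¹) (Bornology.cobounded ℂ)
      (𝓝 (1 + edge n j * 0)) :=
    ((tendsto_inv₀_cobounded.comp h1).const_mul _).const_add _
  rw [mul_zero, add_zero] at h2
  refine h2.congr' ?_
  have : ∀ᶠ z in Bornology.cobounded ℂ, z ≠ vertex n j :=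
    Bornology.isBounded_def.1 (Bornology.isBounded_singleton (x := vertex n j))
  filter_upwards [this] with z hz
  have : vertex n j - z ≠ 0 := sub_ne_zero.2 (Ne.symm hz)
  field_simp
  ring

theorem vertex_add_pow (n r : ℕ) (hr : r ≤ 2 * 4 ^ n) :
    vertex n (4 ^ n + r) = 1 + rotSide * vertex n r := by
  have h4 : (0 : ℝ) < 4 ^ n := by positivity
  have hr' : (r : ℝ) / 4 ^ n ≤ 2 := by rw [div_le_iff₀ h4]; exact_mod_cast hr
  have h0 : (0 : ℝ) ≤ r / 4 ^ n := by positivity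
  have e : ((4 ^ n + r : ℕ) : ℝ) / 4 ^ n = 1 + r / 4 ^ n := by push_cast; field_simp
  unfold vertex
  rw [e]
  obtain ⟨k, hk, s, hs, h⟩ : ∃ k : ℕ, k < 2 ∧ ∃ s ∈ Icc (0 : ℝ) 1, (r : ℝ) / 4 ^ n = k + s := by
    rcases le_total ((r : ℝ) / 4 ^ n) 1 with h | h
    · exact ⟨0, by norm_num, _, ⟨h0, h⟩, by simp⟩
    · exact ⟨1, by norm_num, (r : ℝ) / 4 ^ n - 1, ⟨by linarith, by linarith⟩, by simp⟩
  have e2 : (1 : ℝ) + (k + s) = ((k + 1 : ℕ) : ℝ) + s := by push_cast; ring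
  rw [h, e2, snowflakePath_side n k (by omega) hs, snowflakePath_side n (k + 1) (by omega) hs]
  interval_cases k <;> simp [sidePath]
  ring

/-- The rotation by $2\pi/3$ about the barycentre permutes the sides, so the sum is three times that
of one side. If it vanished, exponentiating the partial sum would give $(1-c)/(0-c)=1$, identifying
the two ends $0$ and $1$ of that side. -/
theorem winding_barycentre_ne_zero (n : ℕ) (hc : (⟨1 / 2, √3 / 6⟩ : ℂ) ∉ K n) :
    winding n ⟨1 / 2, √3 / 6⟩ ≠ 0 := by
  set c : ℂ := ⟨1 / 2, √3 / 6⟩ with hcdef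
  have hρ0 : rotSide ≠ 0 := by
    intro h; have := rotSide_pow_three; rw [h] at this; norm_num at this
  have hcρ : 1 + rotSide * c = c := by
    have h3 : √3 * √3 = 3 := Real.mul_self_sqrt (by norm_num)
    apply Complex.ext <;> simp [rotSide, hcdef] <;> nlinarith
  set f : ℕ → ℂ := fun j => Complex.log ((vertex n j + edge n j - c) / (vertex n j - c)) with hf
  have hshift : ∀ r, r < 2 * 4 ^ n → f (4 ^ n + r) = f r := by
    intro r hr
    simp only [hf, ← vertex_succ]
    rw [add_assoc, vertex_add_pow n r (by omega), vertex_add_pow n (r + 1) (by omega)]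
    have e1 : 1 + rotSide * vertex n (r + 1) - c = rotSide * (vertex n (r + 1) - c) := by
      linear_combination hcρ
    have e2 : 1 + rotSide * vertex n r - c = rotSide * (vertex n r - c) := by
      linear_combination hcρ
    rw [e1, e2, mul_div_mul_left _ _ hρ0]
  have hW : winding n c = 3 * ∑ j ∈ Finset.range (4 ^ n), f j := by
    have e : 3 * 4 ^ n = 4 ^ n + (4 ^ n + 4 ^ n) := by ring
    have hs : ∀ r ∈ Finset.range (4 ^ n), f (4 ^ n + (4 ^ n + r)) = f r := by
      intro r hr
      have := Finset.mem_range.1 hr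
      rw [hshift _ (by omega), hshift r (by omega)]
    have hs' : ∀ r ∈ Finset.range (4 ^ n), f (4 ^ n + r) = f r := by
      intro r hr
      have := Finset.mem_range.1 hr
      rw [hshift r (by omega)]
    unfold winding
    rw [e, Finset.sum_range_add, Finset.sum_range_add, Finset.sum_congr rfl hs,
      Finset.sum_congr rfl hs']
    ring
  intro h0
  have hsum : ∑ j ∈ Finset.range (4 ^ n), f j = 0 := by
    rw [hW] at h0; simpa using h0
  have hne : ∀ j, j < 3 * 4 ^ n → vertex n j - c ≠ 0 := by
    intro j hj h
    refine hc (edgeSegment_subset_K n j hj ⟨0, by simp, ?_⟩)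
    simpa [sub_eq_zero] using h
  have hprod : ∀ m, m ≤ 4 ^ n → Complex.exp (∑ j ∈ Finset.range m, f j)
      = (vertex n m - c) / (vertex n 0 - c) := by
    intro m
    induction m with
    | zero => intro _; simp [div_self (hne 0 (by positivity))]
    | succ m ih =>
      intro hm
      have h1 := hne m (by omega)
      have h4 : 0 < 4 ^ n := by positivity
      have h2 := hne (m + 1) (by omega)
      rw [Finset.sum_range_succ, Complex.exp_add, ih (by omega)]
      simp only [hf, ← vertex_succ]
      rw [Complex.exp_log (div_ne_zero h2 h1)]
      field_simp
  have := hprod _ le_rfl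
  have v0 : vertex n 0 = 0 := by
    have := snowflakePath_side n 0 (by norm_num) (s := 0) (by simp)
    simpa [vertex, sidePath, kochPath_zero] using this
  have v1 : vertex n (4 ^ n) = 1 := by
    have := vertex_add_pow n 0 (by omega)
    simpa [v0] using this
  rw [hsum, Complex.exp_zero, v0, v1, eq_comm, div_eq_one_iff_eq] at this
  · have h1 : (1 : ℂ) = 0 := by linear_combination this
    exact one_ne_zero h1
  · have := hne 0 (by positivity)
    rwa [v0] at this

/-- The winding number is a nonzero constant on $\Omega$ but tends to $0$ at infinity. Were the
barycentre on $K_n$, the component would be empty by convention. -/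
theorem isBounded_Omega (n : ℕ) : Bornology.IsBounded (Omega n) := by
  by_cases hc : (⟨1 / 2, √3 / 6⟩ : ℂ) ∈ K n
  · have : Omega n = ∅ := connectedComponentIn_eq_empty (by simpa using hc)
    rw [this]; exact Bornology.isBounded_empty
  · have hW := winding_barycentre_ne_zero n hc
    have hmem : (⟨1 / 2, √3 / 6⟩ : ℂ) ∈ Omega n := mem_connectedComponentIn hc
    have h := (tendsto_winding_cobounded n).eventually_ne hW.symm
    rw [Bornology.isBounded_def]
    filter_upwards [h] with z hz hzO
    exact hz (winding_eq_of_mem_Omega n hzO hmem)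

/-- `Ω_n` lies locally on one side of each edge. -/
theorem not_both_sides (n j : ℕ) (hj : j < 3 * 4 ^ n) {t₀ : ℝ} (ht₀ : t₀ ∈ Ioo (0 : ℝ) 1)
    (h1 : ∀ᶠ ε : ℝ in 𝓝[>] 0, vertex n j + t₀ * edge n j + Complex.I * ε * edge n j ∈ Omega n)
    (h2 : ∀ᶠ ε : ℝ in 𝓝[>] 0, vertex n j + t₀ * edge n j - Complex.I * ε * edge n j ∈ Omega n) :
    False := by
  set z₀ := vertex n j + t₀ * edge n j with hz₀
  have he := edge_ne_zero n j hj
  set f : ℕ → ℂ → ℂ := fun k z => Complex.log ((vertex n k + edge n k - z) / (vertex n k - z))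
  -- At $z_0$ the quotient of the $j$-th edge is this negative number, which sits on the cut of the
  -- logarithm. The two normal approaches reach it from opposite half planes, with logarithms
  -- differing by $2\pi i$, whereas all other summands are continuous.
  set x : ℝ := -((1 - t₀) / t₀) with hx
  have hx0 : x < 0 := by
    have := ht₀.1; have : 0 < 1 - t₀ := by linarith [ht₀.2]
    rw [hx]; have : 0 < (1 - t₀) / t₀ := by positivity
    linarith
  have hlim : ∀ a : ℝ, Tendsto (fun ε : ℝ => z₀ + a * Complex.I * ε * edge n j) (𝓝[>] 0) (𝓝 z₀) := by
    intro a
    have : Continuous fun ε : ℝ => z₀ + a * Complex.I * ε * edge n j := by fun_prop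
    have := this.tendsto 0
    simp only [Complex.ofReal_zero, mul_zero, zero_mul, add_zero] at this
    exact this.mono_left nhdsWithin_le_nhds
  have hrest : ∀ a : ℝ, ∀ k ∈ (Finset.range (3 * 4 ^ n)).erase j,
      Tendsto (fun ε : ℝ => f k (z₀ + a * Complex.I * ε * edge n j)) (𝓝[>] 0) (𝓝 (f k z₀)) := by
    intro a k hk
    simp only [Finset.mem_erase, Finset.mem_range] at hk
    exact (continuousAt_log_edge n k (edge_interior_notMem n j k hj hk.2 hk.1 ht₀)).tendsto.comp
      (hlim a)
  have hratio : ∀ a : ℝ, ∀ ε : ℝ, (vertex n j + edge n j - (z₀ + a * Complex.I * ε * edge n j))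
      / (vertex n j - (z₀ + a * Complex.I * ε * edge n j))
      = ((1 - t₀) - a * ε * Complex.I) / (-t₀ - a * ε * Complex.I) := by
    intro a ε
    rw [← mul_div_mul_right ((1 - t₀ : ℂ) - a * ε * Complex.I) _ he]
    congr 1 <;> rw [hz₀] <;> ring
  have hratlim : ∀ a : ℝ, Tendsto (fun ε : ℝ => ((1 - t₀ : ℂ) - a * ε * Complex.I)
      / (-t₀ - a * ε * Complex.I)) (𝓝[>] 0) (𝓝 (x : ℂ)) := by
    intro a
    have h0 : (-(t₀ : ℂ) - a * ((0 : ℝ) : ℂ) * Complex.I) ≠ 0 := by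
      simpa using ht₀.1.ne'
    have : ContinuousAt (fun ε : ℝ => ((1 - t₀ : ℂ) - a * ε * Complex.I)
      / (-t₀ - a * ε * Complex.I)) 0 := ContinuousAt.div (by fun_prop) (by fun_prop) h0
    have := this.tendsto.mono_left (nhdsWithin_le_nhds (s := Ioi 0))
    convert this using 2
    rw [hx]; push_cast
    simp [div_neg]
  have him : ∀ a ε : ℝ, (((1 - t₀ : ℂ) - a * ε * Complex.I) / (-t₀ - a * ε * Complex.I)).im
      = a * ε / (t₀ ^ 2 + (a * ε) ^ 2) := by
    intro a ε
    rw [Complex.div_im]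
    simp [Complex.normSq_apply]
    ring
  have hup : Tendsto (fun ε : ℝ => f j (z₀ + (1 : ℝ) * Complex.I * ε * edge n j)) (𝓝[>] 0)
      (𝓝 (Real.log ‖(x : ℂ)‖ + Real.pi * Complex.I)) := by
    have := Complex.continuousWithinAt_log_of_re_neg_of_im_zero (z := (x : ℂ)) (by simpa) (by simp)
    have harg : Complex.log (x : ℂ) = Real.log ‖(x : ℂ)‖ + Real.pi * Complex.I := by
      rw [Complex.log, Complex.arg_ofReal_of_neg hx0]
    rw [← harg]
    refine this.tendsto.comp (f := fun ε : ℝ => _) ?_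
    simp only [hratio]
    refine tendsto_nhdsWithin_iff.2 ⟨hratlim 1, ?_⟩
    filter_upwards [self_mem_nhdsWithin] with ε hε
    simp only [him]
    have : (0 : ℝ) < ε := hε
    have := ht₀.1
    positivity
  have hdown : Tendsto (fun ε : ℝ => f j (z₀ + (-1 : ℝ) * Complex.I * ε * edge n j)) (𝓝[>] 0)
      (𝓝 (Real.log ‖(x : ℂ)‖ - Real.pi * Complex.I)) := by
    have := Complex.tendsto_log_nhdsWithin_im_neg_of_re_neg_of_im_zero (z := (x : ℂ)) (by simpa)
      (by simp)
    refine this.comp (f := fun ε : ℝ => _) ?_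
    simp only [hratio]
    refine tendsto_nhdsWithin_iff.2 ⟨hratlim (-1), ?_⟩
    filter_upwards [self_mem_nhdsWithin] with ε hε
    simp only [him]
    have : (0 : ℝ) < ε := hε
    have h3 := ht₀.1
    rw [neg_one_mul, neg_div, neg_sq]
    have : 0 < ε / (t₀ ^ 2 + ε ^ 2) := by positivity
    linarith
  have hjmem : j ∈ Finset.range (3 * 4 ^ n) := Finset.mem_range.2 hj
  have hsplit : ∀ z, winding n z = f j z + ∑ k ∈ (Finset.range (3 * 4 ^ n)).erase j, f k z := fun z =>
    (Finset.add_sum_erase _ (fun k => f k z) hjmem).symm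
  have T1 := hup.add (tendsto_finsetSum _ (hrest 1))
  have T2 := hdown.add (tendsto_finsetSum _ (hrest (-1)))
  have T := T1.sub T2
  have T0 : Tendsto (fun _ : ℝ => (0 : ℂ)) (𝓝[>] (0 : ℝ)) (𝓝 0) := tendsto_const_nhds
  have := tendsto_nhds_unique (T.congr' ?_) T0
  · have hpi : (2 : ℂ) * Real.pi * Complex.I = 0 := by linear_combination this
    simp [Real.pi_ne_zero] at hpi
  · filter_upwards [h1, h2] with ε e1 e2
    rw [← hsplit, ← hsplit]
    have e1' : z₀ + (1 : ℝ) * Complex.I * ε * edge n j ∈ Omega n := by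
      push_cast; rwa [one_mul]
    have e2' : z₀ + (-1 : ℝ) * Complex.I * ε * edge n j ∈ Omega n := by
      convert e2 using 1; push_cast; ring
    rw [winding_eq_of_mem_Omega n e1' e2', sub_self]

/-! ### Oblique coordinates and the region above an edge -/

/-- Oblique coordinates in the plane: along `e` and along the imaginary axis. -/
def oblique (q e : ℂ) (p : ℝ × ℝ) : ℂ := q + p.1 * e + p.2 * Complex.I

theorem continuous_oblique (q e : ℂ) : Continuous (oblique q e) := by
  unfold oblique; fun_prop

theorem oblique_re (q e : ℂ) (p : ℝ × ℝ) : (oblique q e p).re = q.re + p.1 * e.re := by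
  simp [oblique]

theorem oblique_im (q e : ℂ) (p : ℝ × ℝ) : (oblique q e p).im = q.im + p.1 * e.im + p.2 := by
  simp [oblique]

theorem oblique_injective (q : ℂ) {e : ℂ} (he : e.re ≠ 0) : Function.Injective (oblique q e) := by
  intro p p' h
  have h1 := congrArg Complex.re h
  have h2 := congrArg Complex.im h
  simp only [oblique_re, oblique_im] at h1 h2
  have h3 : p.1 = p'.1 := mul_right_cancel₀ he (by linarith)
  refine Prod.ext h3 ?_
  rw [h3] at h2; linarith

/-- The linear part of the oblique coordinates. -/
def obliqueEquiv (e : ℂ) (he : e.re ≠ 0) : (ℝ × ℝ) ≃L[ℝ] ℂ :=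
  LinearEquiv.toContinuousLinearEquiv
    { toFun := oblique 0 e
      invFun := fun z => (z.re / e.re, z.im - z.re / e.re * e.im)
      map_add' := fun p p' => by simp [oblique]; ring
      map_smul' := fun c p => by simp [oblique]; ring
      left_inv := fun p => by
        refine Prod.ext ?_ ?_ <;> simp [oblique, he]
      right_inv := fun z => by
        apply Complex.ext <;> simp [oblique, he] }

theorem oblique_eq (q e : ℂ) (he : e.re ≠ 0) (p : ℝ × ℝ) :
    oblique q e p = q + obliqueEquiv e he p := by
  change oblique q e p = q + oblique 0 e p
  simp [oblique]; ring

theorem measurableEmbedding_oblique (q : ℂ) {e : ℂ} (he : e.re ≠ 0) :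
    MeasurableEmbedding (oblique q e) :=
  (continuous_oblique q e).measurableEmbedding (oblique_injective q he)

theorem map_oblique (q : ℂ) {e : ℂ} (he : e.re ≠ 0) :
    ∃ k : ℝ≥0∞, k ≠ 0 ∧ k ≠ ⊤ ∧ Measure.map (oblique q e) volume = k • (volume : Measure ℂ) := by
  set μ' : Measure ℂ := Measure.map (obliqueEquiv e he) volume with hμ'
  have : μ'.IsAddHaarMeasure := by rw [hμ']; infer_instance
  have h := Measure.isAddLeftInvariant_eq_smul μ' (volume : Measure ℂ)
  refine ⟨(Measure.addHaarScalarFactor μ' (volume : Measure ℂ) : ℝ≥0), ?_, ENNReal.coe_ne_top, ?_⟩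
  · have := Measure.addHaarScalarFactor_pos_of_isAddHaarMeasure μ' (volume : Measure ℂ)
    exact_mod_cast this.ne'
  · have e1 : oblique q e = (fun z => q + z) ∘ (obliqueEquiv e he) := by
      funext p; exact oblique_eq q e he p
    rw [e1, ← Measure.map_map (measurable_const_add q) (obliqueEquiv e he).continuous.measurable,
      ← hμ', map_add_left_eq_self]
    exact h

theorem ae_oblique (q : ℂ) {e : ℂ} (he : e.re ≠ 0) {p : ℂ → Prop}
    (h : ∀ᵐ z, p z) : ∀ᵐ x : ℝ × ℝ, p (oblique q e x) := by
  obtain ⟨k, -, -, hk⟩ := map_oblique q he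
  refine ae_of_ae_map (continuous_oblique q e).aemeasurable ?_
  rw [hk]
  exact Measure.smul_absolutelyContinuous.ae_le h

/-- The part of the domain seen from the `j`-th edge along upward vertical lines. -/
def aboveEdge (n j : ℕ) : Set (ℝ × ℝ) :=
  {p | p.1 ∈ Ioo (0 : ℝ) 1 ∧ 0 < p.2 ∧
    ∀ τ ∈ Ioc 0 p.2, oblique (vertex n j) (edge n j) (p.1, τ) ∈ Omega n}

/-- An interior point of the $j$-th edge has positive distance from the other edges, and the $j$-th
edge itself lies in $\{t=0\}$. -/
theorem oblique_notMem_K (n j : ℕ) (hj : j < 3 * 4 ^ n) {s₀ : ℝ} (hs₀ : s₀ ∈ Ioo (0 : ℝ) 1) :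
    ∃ δ > 0, Ioo (s₀ - δ) (s₀ + δ) ⊆ Ioo 0 1 ∧ ∀ s ∈ Ioo (s₀ - δ) (s₀ + δ), ∀ t ∈ Ioo (-δ) δ, t ≠ 0 →
      oblique (vertex n j) (edge n j) (s, t) ∉ K n := by
  set S : Set ℂ := ⋃ k ∈ (Finset.range (3 * 4 ^ n)).erase j, edgeSegment n k with hS
  have hSc : IsClosed S :=
    (((Finset.range _).erase j).isCompact_biUnion fun k _ => isCompact_edgeSegment n k).isClosed
  have h0 : oblique (vertex n j) (edge n j) (s₀, 0) ∉ S := by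
    simp only [hS, mem_iUnion, not_exists]
    intro k hk
    rw [Finset.mem_erase, Finset.mem_range] at hk
    have := edge_interior_notMem n j k hj hk.2 hk.1 hs₀
    simpa [oblique] using this
  have hU : IsOpen ((oblique (vertex n j) (edge n j) ⁻¹' Sᶜ) ∩ Ioo 0 1 ×ˢ univ) :=
    (hSc.isOpen_compl.preimage (continuous_oblique _ _)).inter (isOpen_Ioo.prod isOpen_univ)
  obtain ⟨δ, hδ, hb⟩ := Metric.isOpen_iff.1 hU (s₀, 0) ⟨h0, hs₀, mem_univ _⟩
  rw [← ball_prod_same, Real.ball_eq_Ioo, Real.ball_eq_Ioo, zero_sub, zero_add] at hb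
  refine ⟨δ, hδ, fun s hs => (hb (mk_mem_prod hs ⟨by linarith, hδ⟩)).2.1, fun s hs t ht htne hK => ?_⟩
  obtain ⟨h1, h2⟩ := hb (mk_mem_prod hs ht)
  rw [K_eq_iUnion] at hK
  simp only [mem_iUnion] at hK
  obtain ⟨k, hk, hkz⟩ := hK
  by_cases hkj : k = j
  · subst hkj
    obtain ⟨t', ht', he⟩ := hkz
    have : oblique (vertex n k) (edge n k) (t', 0) = oblique (vertex n k) (edge n k) (s, t) := by
      rw [← he]; simp [oblique]
    have := oblique_injective _ (edge_re_ne_zero n k hj) this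
    exact htne (Prod.ext_iff.1 this).2.symm
  · refine h1 ?_
    simp only [hS, mem_iUnion]
    exact ⟨k, Finset.mem_erase.2 ⟨hkj, hk⟩, hkz⟩

/-- Just above the edge a rectangle free of $K_n$ meets $\Omega$, hence lies in it; the rectangle
just below cannot meet $\Omega$, by `not_both_sides`. Away from the edge the vertical segment is
compact in an open set, and the tube lemma thickens it. -/
theorem exists_box (n j : ℕ) (hj : j < 3 * 4 ^ n) {s₀ t₀ : ℝ} (h : (s₀, t₀) ∈ aboveEdge n j) :
    ∃ δ > 0, ∃ H > t₀, Ioo (s₀ - δ) (s₀ + δ) ⊆ Ioo 0 1 ∧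
      (∀ s ∈ Ioo (s₀ - δ) (s₀ + δ), ∀ t ∈ Ioo 0 H,
        oblique (vertex n j) (edge n j) (s, t) ∈ Omega n) ∧
      (∀ s ∈ Ioo (s₀ - δ) (s₀ + δ), ∀ t ∈ Ioc (-δ) 0,
        oblique (vertex n j) (edge n j) (s, t) ∉ Omega n) := by
  obtain ⟨hs₀, ht₀, hup⟩ := h
  simp only at hs₀ ht₀ hup
  obtain ⟨δ, hδ, hδI, hδK⟩ := oblique_notMem_K n j hj hs₀
  set Φ := oblique (vertex n j) (edge n j) with hΦ
  have hconn : ∀ a b : ℝ, IsPreconnected (Φ '' (Ioo (s₀ - δ) (s₀ + δ) ×ˢ Ioo a b)) := fun a b =>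
    ((convex_Ioo _ _).prod (convex_Ioo a b)).isPreconnected.image _ (continuous_oblique _ _).continuousOn
  have hs₀' : s₀ ∈ Ioo (s₀ - δ) (s₀ + δ) := ⟨by linarith, by linarith⟩
  set τ := min t₀ (δ / 2)
  have hτ0 : 0 < τ := lt_min ht₀ (by linarith)
  have hτδ : τ < δ := (min_le_right _ _).trans_lt (by linarith)
  have hupper : Φ '' (Ioo (s₀ - δ) (s₀ + δ) ×ˢ Ioo 0 δ) ⊆ Omega n := by
    refine mem_Omega_of_preconnected n (hconn 0 δ) ?_ ⟨(s₀, τ), ⟨hs₀', hτ0, hτδ⟩, rfl⟩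
      (hup τ ⟨hτ0, min_le_left _ _⟩)
    rintro _ ⟨⟨s, t⟩, ⟨hs, ht⟩, rfl⟩
    exact hδK s hs t ⟨by linarith [ht.1], ht.2⟩ ht.1.ne'
  have hlower : ∀ s ∈ Ioo (s₀ - δ) (s₀ + δ), ∀ t ∈ Ioo (-δ) 0, Φ (s, t) ∉ Omega n := by
    intro s hs t ht hO
    have hlow : Φ '' (Ioo (s₀ - δ) (s₀ + δ) ×ˢ Ioo (-δ) 0) ⊆ Omega n := by
      refine mem_Omega_of_preconnected n (hconn _ _) ?_ ⟨(s, t), ⟨hs, ht⟩, rfl⟩ hO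
      rintro _ ⟨⟨s, t⟩, ⟨hs, ht⟩, rfl⟩
      exact hδK s hs t ⟨ht.1, by linarith [ht.2]⟩ ht.2.ne
    set a := (edge n j).re with ha
    set b := (edge n j).im with hb
    have ha0 : a ≠ 0 := edge_re_ne_zero n j hj
    -- `not_both_sides` approaches along the normal; for small $x\ne0$ such points have a small
    -- nonzero vertical coordinate and fall in one of the two rectangles.
    have hcoord : ∀ x : ℝ, vertex n j + s₀ * edge n j + Complex.I * x * edge n j
        = Φ (s₀ - x * (b / a), x * ((a ^ 2 + b ^ 2) / a)) := by
      intro x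
      apply Complex.ext
      · rw [hΦ, oblique_re]; simp [← ha, ← hb]; field_simp; ring
      · rw [hΦ, oblique_im]; simp [← ha, ← hb]; field_simp; ring
    have hc : ∀ᶠ x : ℝ in 𝓝 0, s₀ - x * (b / a) ∈ Ioo (s₀ - δ) (s₀ + δ) ∧
        x * ((a ^ 2 + b ^ 2) / a) ∈ Ioo (-δ) δ := by
      refine (ContinuousAt.eventually_mem (f := fun x : ℝ => s₀ - x * (b / a)) (by fun_prop)
        ?_).and (ContinuousAt.eventually_mem (f := fun x : ℝ => x * ((a ^ 2 + b ^ 2) / a))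
        (by fun_prop) ?_)
      · exact Ioo_mem_nhds (by simp [hδ]) (by simp [hδ])
      · exact Ioo_mem_nhds (by simp [hδ]) (by simp [hδ])
    have hall : ∀ᶠ x : ℝ in 𝓝 0, x ≠ 0 →
        vertex n j + s₀ * edge n j + Complex.I * x * edge n j ∈ Omega n := by
      filter_upwards [hc] with x ⟨h1, h2⟩ hx
      rw [hcoord]
      have hne : x * ((a ^ 2 + b ^ 2) / a) ≠ 0 := by
        have : a ^ 2 + b ^ 2 ≠ 0 := by positivity
        positivity
      rcases lt_or_gt_of_ne hne with h3 | h3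
      · exact hlow ⟨_, ⟨h1, h2.1, h3⟩, rfl⟩
      · exact hupper ⟨_, ⟨h1, h3, h2.2⟩, rfl⟩
    refine not_both_sides n j hj hs₀ ?_ ?_
    · filter_upwards [hall.filter_mono nhdsWithin_le_nhds, self_mem_nhdsWithin] with x hx hx0
      exact hx (ne_of_gt hx0)
    · have hneg : ∀ᶠ x : ℝ in 𝓝 0, -x ≠ 0 →
          vertex n j + s₀ * edge n j + Complex.I * (-x : ℝ) * edge n j ∈ Omega n := by
        have : Tendsto (fun x : ℝ => -x) (𝓝 0) (𝓝 0) := by simpa using (continuous_neg.tendsto (0 : ℝ))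
        exact this.eventually hall
      filter_upwards [hneg.filter_mono nhdsWithin_le_nhds, self_mem_nhdsWithin] with x hx hx0
      have := hx (neg_ne_zero.2 (ne_of_gt hx0))
      push_cast at this
      rwa [mul_neg, neg_mul, ← sub_eq_add_neg] at this
  have hO : IsOpen (Φ ⁻¹' Omega n) := (isOpen_Omega n).preimage (continuous_oblique _ _)
  obtain ⟨u, v, hu, hv, hsu, htv, huv⟩ := generalized_tube_lemma (isCompact_singleton (x := s₀))
    (isCompact_Icc (a := τ) (b := t₀)) hO (by
      rintro ⟨s, t⟩ ⟨hs, ht⟩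
      simp only [mem_singleton_iff] at hs
      subst hs
      exact hup t ⟨hτ0.trans_le ht.1, ht.2⟩)
  obtain ⟨δ₁, hδ₁, hb₁⟩ := Metric.isOpen_iff.1 hu s₀ (hsu rfl)
  obtain ⟨δ₂, hδ₂, hb₂⟩ := Metric.isOpen_iff.1 hv t₀ (htv ⟨min_le_left _ _, le_rfl⟩)
  rw [Real.ball_eq_Ioo] at hb₁ hb₂
  have hmin : 0 < min δ δ₁ := lt_min hδ hδ₁
  have hsub : Ioo (s₀ - min δ δ₁) (s₀ + min δ δ₁) ⊆ Ioo (s₀ - δ) (s₀ + δ) :=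
    Ioo_subset_Ioo (by linarith [min_le_left δ δ₁]) (by linarith [min_le_left δ δ₁])
  have hsub₁ : Ioo (s₀ - min δ δ₁) (s₀ + min δ δ₁) ⊆ Ioo (s₀ - δ₁) (s₀ + δ₁) :=
    Ioo_subset_Ioo (by linarith [min_le_right δ δ₁]) (by linarith [min_le_right δ δ₁])
  refine ⟨min δ δ₁, hmin, t₀ + δ₂, by linarith, hsub.trans hδI, fun s hs t ht => ?_,
    fun s hs t ht hO => ?_⟩
  · rcases lt_or_ge t τ with h1 | h1
    · exact hupper ⟨(s, t), ⟨hsub hs, ht.1, h1.trans hτδ⟩, rfl⟩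
    · refine huv (mk_mem_prod (hb₁ (hsub₁ hs)) ?_)
      rcases le_or_gt t t₀ with h2 | h2
      · exact htv ⟨h1, h2⟩
      · exact hb₂ ⟨by linarith, ht.2⟩
  · rcases ht.2.lt_or_eq with h1 | rfl
    · exact hlower s (hsub hs) t ⟨by linarith [ht.1, min_le_left δ δ₁], h1⟩ hO
    · refine Omega_subset_compl_K n hO (edgeSegment_subset_K n j hj
        ⟨s, Ioo_subset_Icc_self (hδI (hsub hs)), ?_⟩)
      simp [hΦ, oblique]

/-! ### Absolute continuity of Sobolev functions on vertical lines -/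

theorem isTest_translate (n : ℕ) {φ : ℂ → ℝ} (hφ : ContDiff ℝ ∞ φ) (hc : HasCompactSupport φ)
    {a : ℂ} (ha : ∀ z ∈ tsupport φ, z + a ∈ Omega n) : IsTest n (fun z => φ (z - a)) := by
  refine ⟨hφ.comp (contDiff_id.sub contDiff_const), hc.comp_homeomorph (Homeomorph.subRight a), ?_⟩
  intro z hz
  have := tsupport_comp_subset_preimage φ (f := fun z : ℂ => z - a) (by fun_prop) hz
  simpa using ha _ this

theorem sub_translate_eq_integral {φ : ℂ → ℝ} (hφ : ContDiff ℝ ∞ φ) (z : ℂ) (h : ℝ) :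
    φ (z - h * Complex.I) - φ z = -∫ τ in (0 : ℝ)..h, fderiv ℝ φ (z - τ * Complex.I) Complex.I := by
  have hd : ∀ τ ∈ uIcc 0 h, HasDerivAt (fun τ : ℝ => φ (z - τ * Complex.I))
      (-(fderiv ℝ φ (z - τ * Complex.I) Complex.I)) τ := by
    intro τ _
    have h1 : HasDerivAt (fun τ : ℝ => z - τ * Complex.I) (-Complex.I) τ := by
      have := ((Complex.ofRealCLM.hasDerivAt (x := τ)).mul_const Complex.I).const_sub z
      simpa using this
    have h2 := ((hφ.differentiable (by simp)) (z - τ * Complex.I)).hasFDerivAt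
    have := h2.comp_hasDerivAt τ h1
    rw [map_neg] at this
    exact this
  have hcont : Continuous fun τ : ℝ => fderiv ℝ φ (z - τ * Complex.I) Complex.I :=
    ((hφ.continuous_fderiv (by simp)).comp (by fun_prop)).clm_apply continuous_const
  have := intervalIntegral.integral_eq_sub_of_hasDerivAt hd (hcont.neg.intervalIntegrable _ _)
  rw [intervalIntegral.integral_neg] at this
  rw [this]; simp

theorem measurePreserving_shear {μ : Measure ℝ} [SFinite μ] :
    MeasurePreserving (fun p : ℝ × ℂ => (p.1, p.2 + p.1 * Complex.I))
      (μ.prod volume) (μ.prod volume) := by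
  refine (MeasurePreserving.id μ).skew_product
    (g := fun (τ : ℝ) (z : ℂ) => z + τ * Complex.I) ?_ ?_
  · unfold Function.uncurry; fun_prop
  · exact ae_of_all _ fun τ => map_add_right_eq_self _ _

/-- A function with a weak gradient is a.e. the integral of its vertical derivative along vertical
segments of a given length. -/
theorem ae_sub_eq_integral_of_isWeakGrad (n : ℕ) {u : ℂ → ℝ} {G : ℂ → ℂ}
    (hu : IntegrableOn u (Omega n)) (hG : IntegrableOn G (Omega n)) (hw : IsWeakGrad n u G)
    {h : ℝ} (hh : 0 ≤ h) {U : Set ℂ} (hU : IsOpen U)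
    (hUO : ∀ z ∈ U, ∀ τ ∈ Icc 0 h, z + τ * Complex.I ∈ Omega n) :
    ∀ᵐ z : ℂ, z ∈ U → (Omega n).indicator u (z + h * Complex.I) - (Omega n).indicator u z
      = ∫ τ in (0 : ℝ)..h, (Omega n).indicator (fun z => (G z).im) (z + τ * Complex.I) := by
  have hOm : MeasurableSet (Omega n) := (isOpen_Omega n).measurableSet
  set v := (Omega n).indicator u with hv
  set g := (Omega n).indicator (fun z => (G z).im) with hg
  have hvi : Integrable v := hu.integrable_indicator hOm
  have hgi : Integrable g := IntegrableOn.integrable_indicator (Complex.imCLM.integrable_comp hG) hOm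
  set μ : Measure ℝ := volume.restrict (Ioc 0 h)
  have hgp : Integrable (fun p : ℝ × ℂ => g (p.2 + p.1 * Complex.I)) (μ.prod volume) :=
    measurePreserving_shear.integrable_comp_of_integrable (hgi.comp_snd μ)
  set A : ℂ → ℝ := fun z => ∫ τ, g (z + τ * Complex.I) ∂μ
  have hAi : Integrable A := hgp.integral_prod_right
  have hvh : Integrable fun z => v (z + h * Complex.I) := hvi.comp_add_right _
  have hD : Integrable fun z => v (z + h * Complex.I) - v z - A z := (hvh.sub hvi).sub hAi
  -- The difference is tested against $\varphi$ supported in $U$: the translation moves to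
  -- $\varphi$, whose increment is an integral of vertical derivatives. Each translate of $\varphi$
  -- is still a test function in $\Omega$, so the weak gradient applies, and Fubini concludes.
  have key := hU.ae_eq_zero_of_integral_contDiff_smul_eq_zero (μ := volume)
    (hD.locallyIntegrable.locallyIntegrableOn U) ?_
  · filter_upwards [key] with z hz hzU
    rw [intervalIntegral.integral_of_le hh, ← sub_eq_zero]
    exact hz hzU
  intro φ hφ hφc hφU
  obtain ⟨M, hM⟩ := hφc.exists_bound_of_continuous hφ.continuous
  have hdc : Continuous fun z => fderiv ℝ φ z Complex.I :=
    (hφ.continuous_fderiv (by simp)).clm_apply continuous_const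
  obtain ⟨M', hM'⟩ := (hφc.fderiv_apply ℝ Complex.I).exists_bound_of_continuous hdc
  have hφm : AEStronglyMeasurable φ volume := hφ.continuous.aestronglyMeasurable
  have i1 : Integrable fun z => φ z * v (z + h * Complex.I) :=
    hvh.bdd_mul hφm (ae_of_all _ hM)
  have i2 : Integrable fun z => φ z * v z := hvi.bdd_mul hφm (ae_of_all _ hM)
  have i12 : Integrable fun z => φ z * v (z + h * Complex.I) - φ z * v z := i1.sub i2
  have i3 : Integrable fun z => φ z * A z := hAi.bdd_mul hφm (ae_of_all _ hM)
  have i1' : Integrable fun z => φ (z - h * Complex.I) * v z :=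
    hvi.bdd_mul (by have := hφ.continuous; fun_prop) (ae_of_all _ fun z => hM _)
  have e1 : ∫ z, φ z * v (z + h * Complex.I) = ∫ z, φ (z - h * Complex.I) * v z := by
    rw [← integral_add_right_eq_self (fun z => φ (z - h * Complex.I) * v z) (h * Complex.I)]
    simp
  have p1 : Integrable (Function.uncurry fun (τ : ℝ) (z : ℂ) =>
      fderiv ℝ φ (z - τ * Complex.I) Complex.I * v z) (μ.prod volume) := by
    refine (hvi.comp_snd μ).bdd_mul (c := M') ?_ (ae_of_all _ fun p => hM' _)
    exact (hdc.comp (by fun_prop)).aestronglyMeasurable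
  have p2 : Integrable (Function.uncurry fun (τ : ℝ) (z : ℂ) =>
      φ z * g (z + τ * Complex.I)) (μ.prod volume) := by
    refine hgp.bdd_mul (c := M) ?_ (ae_of_all _ fun p => hM _)
    exact (hφ.continuous.comp continuous_snd).aestronglyMeasurable
  have e2 : ∀ z, φ (z - h * Complex.I) * v z - φ z * v z
      = -∫ τ, fderiv ℝ φ (z - τ * Complex.I) Complex.I * v z ∂μ := by
    intro z
    rw [← sub_mul, sub_translate_eq_integral hφ, intervalIntegral.integral_of_le hh,
      integral_mul_const, neg_mul]
  have e3 : ∀ τ ∈ Ioc 0 h, ∫ z, fderiv ℝ φ (z - τ * Complex.I) Complex.I * v z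
      = -∫ z, φ z * g (z + τ * Complex.I) := by
    intro τ hτ
    have ht : IsTest n (fun z => φ (z - τ * Complex.I)) :=
      isTest_translate n hφ hφc fun z hz => hUO z (hφU hz) τ ⟨hτ.1.le, hτ.2⟩
    have h1 := hw.2 _ ht Complex.I
    have h2 : ∫ x in Omega n, u x * fderiv ℝ (fun z => φ (z - τ * Complex.I)) x Complex.I
        = ∫ z, fderiv ℝ φ (z - τ * Complex.I) Complex.I * v z := by
      rw [← integral_indicator hOm]
      congr 1; funext z
      have h4 : fderiv ℝ (fun z => φ (z - τ * Complex.I)) z = fderiv ℝ φ (z - τ * Complex.I) :=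
        fderiv_comp_sub _
      by_cases hz : z ∈ Omega n
      · rw [hv, indicator_of_mem hz, indicator_of_mem hz, h4, mul_comm]
      · rw [hv, indicator_of_notMem hz, indicator_of_notMem hz, mul_zero]
    have h3 : ∫ x in Omega n, inner ℝ (G x) Complex.I * φ (x - τ * Complex.I)
        = ∫ z, φ z * g (z + τ * Complex.I) := by
      rw [← integral_indicator hOm,
        ← integral_add_right_eq_self _ (τ * Complex.I)]
      congr 1; funext z
      by_cases hz : z + τ * Complex.I ∈ Omega n
      · rw [hg, indicator_of_mem hz, indicator_of_mem hz, add_sub_cancel_right, mul_comm]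
        simp
      · rw [hg, indicator_of_notMem hz, indicator_of_notMem hz, mul_zero]
    rw [← h2, h1, h3]
  calc ∫ z, φ z • (v (z + h * Complex.I) - v z - A z)
      = ∫ z, (φ z * v (z + h * Complex.I) - φ z * v z - φ z * A z) := by
        congr 1; funext z; rw [smul_eq_mul]; ring
    _ = (∫ z, (φ (z - h * Complex.I) * v z - φ z * v z)) - ∫ z, φ z * A z := by
        rw [integral_sub i12 i3, integral_sub i1 i2, integral_sub i1' i2, e1]
    _ = 0 := by
        simp only [e2]
        rw [integral_neg, ← integral_integral_swap p1]
        have : ∫ τ, ∫ z, fderiv ℝ φ (z - τ * Complex.I) Complex.I * v z ∂volume ∂μ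
            = ∫ τ, -(∫ z, φ z * g (z + τ * Complex.I)) ∂μ :=
          setIntegral_congr_fun measurableSet_Ioc e3
        rw [this, integral_neg, neg_neg, integral_integral_swap p2, sub_eq_zero]
        congr 1; funext z
        rw [integral_const_mul]

theorem isOpenMap_oblique (q : ℂ) {e : ℂ} (he : e.re ≠ 0) : IsOpenMap (oblique q e) := by
  have : oblique q e = (Homeomorph.addLeft q) ∘ (obliqueEquiv e he).toHomeomorph := by
    funext p; exact oblique_eq q e he p
  rw [this]
  exact (Homeomorph.addLeft q).isOpenMap.comp (obliqueEquiv e he).toHomeomorph.isOpenMap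

theorem integrable_comp_oblique (q : ℂ) {e : ℂ} (he : e.re ≠ 0) {f : ℂ → ℝ} (hf : Integrable f) :
    Integrable (fun p => f (oblique q e p)) := by
  obtain ⟨k, -, hk, hmap⟩ := map_oblique q he
  have : Integrable f (Measure.map (oblique q e) volume) := by
    rw [hmap]; exact hf.smul_measure hk
  exact this.comp_measurable (continuous_oblique q e).measurable

theorem lintegral_comp_oblique (q : ℂ) {e : ℂ} (he : e.re ≠ 0) :
    ∃ k : ℝ≥0∞, k ≠ 0 ∧ k ≠ ⊤ ∧ ∀ f : ℂ → ℝ≥0∞, ∫⁻ p, f (oblique q e p) = k * ∫⁻ z, f z := by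
  obtain ⟨k, hk0, hk, hmap⟩ := map_oblique q he
  refine ⟨k, hk0, hk, fun f => ?_⟩
  rw [← (measurableEmbedding_oblique q he).lintegral_map, hmap, lintegral_smul_measure, smul_eq_mul]

theorem measurePreserving_swap_last : MeasurePreserving
    (fun x : (ℝ × ℝ) × ℝ => ((x.1.1, x.2), x.1.2)) volume volume := by
  have h1 := measurePreserving_prodAssoc (volume : Measure ℝ) (volume : Measure ℝ)
    (volume : Measure ℝ)
  have h2 := (MeasurePreserving.id (volume : Measure ℝ)).prod
    (Measure.measurePreserving_swap (μ := (volume : Measure ℝ)) (ν := (volume : Measure ℝ)))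
  exact (h1.symm _).comp (h2.comp h1)

/-- A function on a rectangle whose vertical increments vanish a.e. does not depend on the second
variable. -/
theorem ae_eq_slice {W : ℝ × ℝ → ℝ} (hW : Measurable W) {a b H : ℝ}
    (h : ∀ h : ℝ, 0 < h → ∀ᵐ p : ℝ × ℝ, p.1 ∈ Ioo a b → 0 < p.2 → p.2 + h < H →
      W (p.1, p.2 + h) = W p) :
    ∀ᵐ t' : ℝ, ∀ᵐ p : ℝ × ℝ, p.1 ∈ Ioo a b → p.2 ∈ Ioo 0 H → t' ∈ Ioo 0 H →
      W p = W (p.1, t') := by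
  have hm1 : MeasurableSet {x : (ℝ × ℝ) × ℝ | x.1.1 ∈ Ioo a b → 0 < x.1.2 → x.1.2 + x.2 < H →
      0 < x.2 → W (x.1.1, x.1.2 + x.2) = W x.1} := by
    refine MeasurableSet.imp (measurableSet_Ioo.preimage (by fun_prop)) (.imp
      (measurableSet_lt (by fun_prop) (by fun_prop)) (.imp (measurableSet_lt (by fun_prop)
      (by fun_prop)) (.imp (measurableSet_lt (by fun_prop) (by fun_prop))
      (measurableSet_eq_fun (by fun_prop) (by fun_prop)))))
  have hm2 : MeasurableSet {x : (ℝ × ℝ) × ℝ | x.1.1 ∈ Ioo a b → 0 < x.1.2 → x.2 < H →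
      x.1.2 < x.2 → W (x.1.1, x.2) = W x.1} := by
    refine MeasurableSet.imp (measurableSet_Ioo.preimage (by fun_prop)) (.imp
      (measurableSet_lt (by fun_prop) (by fun_prop)) (.imp (measurableSet_lt (by fun_prop)
      (by fun_prop)) (.imp (measurableSet_lt (by fun_prop) (by fun_prop))
      (measurableSet_eq_fun (by fun_prop) (by fun_prop)))))
  have hm3 : MeasurableSet {x : (ℝ × ℝ) × ℝ | x.1.1 ∈ Ioo a b → x.1.2 ∈ Ioo 0 H → x.2 ∈ Ioo 0 H →
      W x.1 = W (x.1.1, x.2)} := by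
    refine MeasurableSet.imp (measurableSet_Ioo.preimage (by fun_prop)) (.imp
      (measurableSet_Ioo.preimage (by fun_prop)) (.imp (measurableSet_Ioo.preimage (by fun_prop))
      (measurableSet_eq_fun (by fun_prop) (by fun_prop))))
  -- The exceptional set depends on $h$; Fubini exchanges the quantifiers, after which $h$ can be
  -- replaced by $t'-t$.
  have s1 : ∀ᵐ p : ℝ × ℝ, ∀ᵐ h : ℝ, p.1 ∈ Ioo a b → 0 < p.2 → p.2 + h < H → 0 < h →
      W (p.1, p.2 + h) = W p := by
    rw [Measure.ae_ae_comm hm1]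
    refine ae_of_all _ fun t => ?_
    by_cases ht : 0 < t
    · filter_upwards [h t ht] with p hp h1 h2 h3 _ using hp h1 h2 h3
    · exact ae_of_all _ fun p _ _ _ h0 => absurd h0 ht
  have s2 : ∀ᵐ p : ℝ × ℝ, ∀ᵐ t' : ℝ, p.1 ∈ Ioo a b → 0 < p.2 → t' < H → p.2 < t' →
      W (p.1, t') = W p := by
    filter_upwards [s1] with p hp
    have := (measurePreserving_sub_right (volume : Measure ℝ) p.2).quasiMeasurePreserving.ae hp
    filter_upwards [this] with t' ht' h1 h2 h3 h4
    simpa using ht' h1 h2 (by linarith) (by linarith)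
  have s3 : ∀ᵐ x : (ℝ × ℝ) × ℝ, x.1.1 ∈ Ioo a b → 0 < x.1.2 → x.2 < H → x.1.2 < x.2 →
      W (x.1.1, x.2) = W x.1 := (Measure.ae_prod_iff_ae_ae hm2).2 s2
  -- Exchanging the two heights covers the case $t'<t$.
  have s4 := measurePreserving_swap_last.quasiMeasurePreserving.ae s3
  have s5 : ∀ᵐ x : (ℝ × ℝ) × ℝ, x.1.1 ∈ Ioo a b → x.1.2 ∈ Ioo 0 H → x.2 ∈ Ioo 0 H →
      W x.1 = W (x.1.1, x.2) := by
    filter_upwards [s3, s4] with ⟨⟨s, t⟩, t'⟩ h3 h4 h5 h6 h7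
    simp only at h3 h4 h5 h6 h7 ⊢
    rcases lt_trichotomy t t' with hlt | rfl | hlt
    · exact (h3 h5 h6.1 h7.2 hlt).symm
    · rfl
    · exact h4 h5 h7.1 h6.2 hlt
  exact (Measure.ae_ae_comm (p := fun (p : ℝ × ℝ) (t' : ℝ) => p.1 ∈ Ioo a b → p.2 ∈ Ioo 0 H →
    t' ∈ Ioo 0 H → W p = W (p.1, t')) hm3).1 ((Measure.ae_prod_iff_ae_ae hm3).1 s5)

/-- In oblique coordinates, a function with a weak gradient is a.e. absolutely continuous along
vertical segments starting on the base of a rectangle. -/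
theorem exists_vertical_primitive (n : ℕ) {u : ℂ → ℝ} {G : ℂ → ℂ} (hum : Measurable u)
    (hGm : Measurable G) (hu : IntegrableOn u (Omega n)) (hG : IntegrableOn G (Omega n))
    (hw : IsWeakGrad n u G) {q e : ℂ} (he : e.re ≠ 0) {a b H : ℝ} (hH : 0 < H)
    (hbox : ∀ s ∈ Ioo a b, ∀ t ∈ Ioo 0 H, oblique q e (s, t) ∈ Omega n) :
    ∃ c : ℝ → ℝ, StronglyMeasurable c ∧ Integrable c ∧
      ∀ᵐ p : ℝ × ℝ, p.1 ∈ Ioo a b → p.2 ∈ Ioo 0 H → u (oblique q e p) = c p.1 +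
        ∫ τ in (0 : ℝ)..p.2, (Omega n).indicator (fun z => (G z).im) (oblique q e (p.1, τ)) := by
  have hOm : MeasurableSet (Omega n) := (isOpen_Omega n).measurableSet
  set v := (Omega n).indicator u with hv
  set g := (Omega n).indicator (fun z => (G z).im)
  have hvm : Measurable v := hum.indicator hOm
  have hgm : Measurable g := (Complex.measurable_im.comp hGm).indicator hOm
  have hvi : Integrable v := hu.integrable_indicator hOm
  have hgi : Integrable g := IntegrableOn.integrable_indicator (Complex.imCLM.integrable_comp hG) hOm
  have hΦ := continuous_oblique q e
  have hVi := integrable_comp_oblique q he hvi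
  have hggi := integrable_comp_oblique q he hgi
  set gg : ℝ × ℝ → ℝ := fun p => g (oblique q e p) with hgg
  have hggm : Measurable gg := hgm.comp hΦ.measurable
  set P : ℝ × ℝ → ℝ := fun p => ∫ τ, indicator {x : (ℝ × ℝ) × ℝ | x.2 ∈ Ioc 0 x.1.2}
    (fun x => gg (x.1.1, x.2)) (p, τ) with hP
  have hPm : Measurable P := by
    refine (StronglyMeasurable.integral_prod_right' (f := indicator _ _) ?_).measurable
    refine (Measurable.indicator (by fun_prop) ?_).stronglyMeasurable
    exact (measurableSet_lt (f := fun x : (ℝ × ℝ) × ℝ => (0 : ℝ)) (by fun_prop) (by fun_prop)).inter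
      (measurableSet_le (f := fun x : (ℝ × ℝ) × ℝ => x.2) (by fun_prop) (by fun_prop))
  have hPeq : ∀ p : ℝ × ℝ, 0 ≤ p.2 → P p = ∫ τ in (0 : ℝ)..p.2, gg (p.1, τ) := by
    intro p hp
    rw [intervalIntegral.integral_of_le hp, ← integral_indicator measurableSet_Ioc]
    rfl
  -- Subtracting the candidate primitive leaves a function with vanishing vertical increments; a
  -- generic horizontal slice of it serves as the boundary value $c$.
  set W : ℝ × ℝ → ℝ := fun p => v (oblique q e p) - P p with hW
  have hWm : Measurable W := (hvm.comp hΦ.measurable).sub hPm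
  have hslice : ∀ᵐ p : ℝ × ℝ, Integrable fun τ => gg (p.1, τ) :=
    Measure.quasiMeasurePreserving_fst.ae hggi.prod_right_ae
  have hstep := ae_eq_slice hWm (a := a) (b := b) (H := H) (by
    intro h hh
    set S : Set (ℝ × ℝ) := Ioo a b ×ˢ Ioo 0 (H - h)
    have hU : IsOpen (oblique q e '' S) := isOpenMap_oblique q he _ (isOpen_Ioo.prod isOpen_Ioo)
    have hT := ae_sub_eq_integral_of_isWeakGrad n hu hG hw hh.le hU (by
      rintro _ ⟨⟨s, t⟩, ⟨hs, ht⟩, rfl⟩ τ hτ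
      have : oblique q e (s, t) + τ * Complex.I = oblique q e (s, t + τ) := by
        simp [oblique]; ring
      rw [this]
      exact hbox s hs _ ⟨by linarith [ht.1, hτ.1], by linarith [ht.2, hτ.2]⟩)
    filter_upwards [ae_oblique q he hT, hslice] with ⟨s, t⟩ h1 h2 h3 h4 h5
    simp only at h2 h3 h4 h5
    have h6 := h1 ⟨(s, t), ⟨h3, h4, by linarith⟩, rfl⟩
    have hadd : ∀ τ : ℝ, oblique q e (s, t) + τ * Complex.I = oblique q e (s, t + τ) := by
      intro τ; simp [oblique]; ring
    simp only [hadd] at h6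
    have h7 : ∫ τ in (0 : ℝ)..h, g (oblique q e (s, t + τ)) = ∫ τ in t..(t + h), gg (s, τ) := by
      have := intervalIntegral.integral_comp_add_left (fun τ => gg (s, τ)) t (a := 0) (b := h)
      rw [add_zero] at this
      exact this
    have h8 := intervalIntegral.integral_add_adjacent_intervals
      (h2.intervalIntegrable (a := 0) (b := t)) (h2.intervalIntegrable (a := t) (b := t + h))
    simp only [hW]
    rw [hPeq (s, t + h) (by simp only; linarith), hPeq (s, t) h4.le]
    simp only
    rw [h7] at h6
    linarith)
  have hVslice : ∀ᵐ t' : ℝ, Integrable fun s => v (oblique q e (s, t')) := hVi.prod_left_ae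
  have : (ae (volume.restrict (Ioo 0 H))).NeBot := by
    rw [ae_neBot, ← Measure.measure_univ_ne_zero]
    simp [hH]
  -- The height is also chosen so that the slice of $u$ is integrable, which makes $c$ integrable.
  obtain ⟨t', h1, h2, h3⟩ := ((ae_restrict_mem measurableSet_Ioo).and
    ((ae_restrict_of_ae hstep).and (ae_restrict_of_ae (s := Ioo 0 H) hVslice))).exists
  refine ⟨fun s => W (s, t'), (hWm.comp (by fun_prop)).stronglyMeasurable, ?_, ?_⟩
  · refine h3.sub ?_
    have e1 : (fun s => P (s, t')) = fun s => ∫ τ, indicator (univ ×ˢ Ioc 0 t') gg (s, τ) := by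
      funext s
      rw [hPeq (s, t') h1.1.le, intervalIntegral.integral_of_le h1.1.le,
        ← integral_indicator measurableSet_Ioc]
      congr 1; funext τ
      simp [indicator]
    rw [e1]
    exact (hggi.indicator (MeasurableSet.univ.prod measurableSet_Ioc)).integral_prod_left
  · filter_upwards [h2] with p hp ha hb
    have := hp ha hb h1
    rw [← this]
    simp only [hW]
    rw [hPeq p hb.1.le, hv, indicator_of_mem (hbox p.1 ha p.2 hb)]
    simp [hgg]

/-! ### Averages over balls identify the trace with the vertical boundary value -/

theorem enorm_setAverage_sub_mul_le {α : Type*} [MeasurableSpace α] {μ : Measure α} {E : Set α}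
    (h0 : μ E ≠ 0) (ht : μ E ≠ ⊤) {u : α → ℝ} (hu : IntegrableOn u E μ) (c : ℝ) :
    ‖(⨍ y in E, u y ∂μ) - c‖ₑ * μ E ≤ ∫⁻ y in E, ‖u y - c‖ₑ ∂μ := by
  have hfin : IsFiniteMeasure (μ.restrict E) := ⟨by simpa using ht.lt_top⟩
  have hne : NeZero (μ.restrict E) := ⟨by simpa using h0⟩
  have e1 : (⨍ y in E, u y ∂μ) - c = ⨍ y in E, (u y - c) ∂μ := by
    have : ⨍ y in E, c ∂μ = c := average_const _ _
    rw [average_eq, average_eq, integral_sub hu (integrable_const c), smul_sub, ← average_eq,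
      ← average_eq, this]
  rw [e1, average]
  have h1 := enorm_integral_le_lintegral_enorm (μ := (μ.restrict E univ)⁻¹ • μ.restrict E)
    (fun y => u y - c)
  rw [lintegral_smul_measure, Measure.restrict_apply_univ, smul_eq_mul] at h1
  rw [Measure.restrict_apply_univ]
  calc _ ≤ ((μ E)⁻¹ * ∫⁻ y in E, ‖u y - c‖ₑ ∂μ) * μ E := by gcongr
    _ = _ := by
      rw [mul_right_comm, ENNReal.inv_mul_cancel h0 ht, one_mul]

/-- Averages over small half balls are controlled by averages over the diameter. -/
theorem enorm_average_halfBall_le (n : ℕ) {u : ℂ → ℝ} (hu : IntegrableOn u (Omega n)) {q e : ℂ}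
    (he : e.re ≠ 0) {a b H δ : ℝ}
    (hbox : ∀ s ∈ Ioo a b, ∀ t ∈ Ioo 0 H, oblique q e (s, t) ∈ Omega n)
    (hlow : ∀ s ∈ Ioo a b, ∀ t ∈ Ioc (-δ) 0, oblique q e (s, t) ∉ Omega n)
    {c : ℝ → ℝ} {g : ℝ × ℝ → ℝ} {η : ℝ}
    (hac : ∀ᵐ p : ℝ × ℝ, p.1 ∈ Ioo a b → p.2 ∈ Ioo 0 H →
      u (oblique q e p) = c p.1 + ∫ τ in (0 : ℝ)..p.2, g (p.1, τ))
    (hcm : Measurable c)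
    {s₀ r κ l : ℝ} (hr : 0 < r) (hκ : κ = (1 + ‖e‖) / |e.re| + 1) (hl : l = 1 / (1 + ‖e‖))
    (hra : κ * r < s₀ - a) (hrb : κ * r < b - s₀) (hrH : κ * r < H) (hrδ : κ * r < δ)
    (hrη : κ * r < η) :
    ‖(⨍ y in Metric.ball (oblique q e (s₀, 0)) r ∩ Omega n, u y) - c s₀‖ₑ
      ≤ ENNReal.ofReal (κ ^ 2 / l ^ 2) *
        ((∫⁻ s in Metric.closedBall s₀ (κ * r), ‖c s - c s₀‖ₑ)
            / volume (Metric.closedBall s₀ (κ * r))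
          + (∫⁻ s in Metric.closedBall s₀ (κ * r), ∫⁻ τ in Ioo 0 η, ‖g (s, τ)‖ₑ)
            / volume (Metric.closedBall s₀ (κ * r))) := by
  have hOm : MeasurableSet (Omega n) := (isOpen_Omega n).measurableSet
  have hre : 0 < |e.re| := abs_pos.2 he
  have hκ1 : 1 ≤ κ := by rw [hκ]; have : 0 ≤ (1 + ‖e‖) / |e.re| := by positivity
                         linarith
  have hl0 : 0 < l := by rw [hl]; positivity
  have hl1 : l ≤ 1 := by rw [hl, div_le_one (by positivity)]; linarith [norm_nonneg e]
  have hκr : 0 < κ * r := by positivity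
  have hlr : l * r ≤ κ * r := by gcongr; linarith
  set E := Metric.ball (oblique q e (s₀, 0)) r ∩ Omega n
  have hEm : MeasurableSet E := Metric.isOpen_ball.measurableSet.inter hOm
  obtain ⟨k, hk0, hkt, hk⟩ := lintegral_comp_oblique q he
  have hdiff : ∀ s t : ℝ, oblique q e (s, t) - oblique q e (s₀, 0) = ((s - s₀ : ℝ) : ℂ) * e + t * Complex.I := by
    intro s t; simp [oblique]; ring
  -- The constants compare ball and coordinates: the half ball lies in a rectangle of size $\kappa
  -- r$ and contains one of size $lr$. Points with $t\le0$ drop out because `hlow` places them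
  -- outside $\Omega$.
  have hsub : oblique q e ⁻¹' E ⊆ Ioo (s₀ - κ * r) (s₀ + κ * r) ×ˢ Ioo 0 (κ * r) := by
    rintro ⟨s, t⟩ ⟨hb, hO⟩
    rw [Metric.mem_ball, dist_eq_norm, hdiff] at hb
    have h1 : |s - s₀| * |e.re| < r := by
      have := (Complex.abs_re_le_norm (((s - s₀ : ℝ) : ℂ) * e + t * Complex.I)).trans_lt hb
      simpa [abs_mul] using this
    have h2 : |s - s₀| < r / |e.re| := by rwa [lt_div_iff₀ hre]
    have h3 : |t| < κ * r := by
      have e1 : (t : ℂ) * Complex.I = (((s - s₀ : ℝ) : ℂ) * e + t * Complex.I) - ((s - s₀ : ℝ) : ℂ) * e := by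
        ring
      have h4 : |t| = ‖(t : ℂ) * Complex.I‖ := by simp
      have h5 : |t| ≤ ‖((s - s₀ : ℝ) : ℂ) * e + t * Complex.I‖ + ‖((s - s₀ : ℝ) : ℂ) * e‖ := by
        rw [h4]; nth_rw 1 [e1]; exact norm_sub_le _ _
      rw [norm_mul (((s - s₀ : ℝ) : ℂ)) e, Complex.norm_real, Real.norm_eq_abs] at h5
      have h6 : |s - s₀| * ‖e‖ ≤ r / |e.re| * ‖e‖ := by gcongr
      have h7 : κ * r = r + r / |e.re| * ‖e‖ + r / |e.re| := by rw [hκ]; ring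
      have : 0 < r / |e.re| := by positivity
      linarith
    have h4 : |s - s₀| < κ * r := by
      have h7 : κ * r = r + r / |e.re| * ‖e‖ + r / |e.re| := by rw [hκ]; ring
      have : 0 ≤ r / |e.re| * ‖e‖ := by positivity
      linarith
    rw [abs_lt] at h3 h4
    refine ⟨⟨by linarith, by linarith⟩, ?_, h3.2⟩
    by_contra ht
    exact hlow s ⟨by linarith, by linarith⟩ t ⟨by linarith, not_lt.1 ht⟩ hO
  have hsup : Ioo (s₀ - l * r) (s₀ + l * r) ×ˢ Ioo 0 (l * r) ⊆ oblique q e ⁻¹' E := by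
    rintro ⟨s, t⟩ ⟨hs, ht⟩
    simp only [mem_Ioo] at hs ht
    refine ⟨?_, hbox s ⟨by linarith, by linarith⟩ t ⟨ht.1, by linarith⟩⟩
    rw [Metric.mem_ball, dist_eq_norm, hdiff]
    have h1 : |s - s₀| < l * r := by rw [abs_lt]; constructor <;> linarith
    have h2 : ‖((s - s₀ : ℝ) : ℂ) * e + t * Complex.I‖ ≤ |s - s₀| * ‖e‖ + |t| := by
      refine (norm_add_le _ _).trans (le_of_eq ?_)
      rw [norm_mul, Complex.norm_real, Real.norm_eq_abs]; simp
    rw [abs_of_pos ht.1] at h2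
    have h3 : l * r * ‖e‖ + l * r = r := by rw [hl]; field_simp; ring
    have h4 : |s - s₀| * ‖e‖ ≤ l * r * ‖e‖ := by gcongr
    linarith
  have hvolE : k * volume E = volume (oblique q e ⁻¹' E) := by
    have := hk (E.indicator 1)
    rw [lintegral_indicator_one hEm] at this
    rw [← this, ← lintegral_indicator_one (hEm.preimage (continuous_oblique q e).measurable)]
    rfl
  have hvollow : ENNReal.ofReal (2 * l ^ 2 * r ^ 2) ≤ k * volume E := by
    rw [hvolE]
    refine le_trans (le_of_eq ?_) (measure_mono hsup)
    rw [Measure.volume_eq_prod, Measure.prod_prod, Real.volume_Ioo, Real.volume_Ioo,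
      ← ENNReal.ofReal_mul (by linarith [mul_pos hl0 hr])]
    congr 1; ring
  have hE0 : volume E ≠ 0 := by
    intro h0
    rw [h0, mul_zero] at hvollow
    have : 0 < ENNReal.ofReal (2 * l ^ 2 * r ^ 2) := ENNReal.ofReal_pos.2 (by positivity)
    exact absurd hvollow (not_le.2 this)
  have hEt : volume E ≠ ⊤ :=
    ((measure_mono inter_subset_left).trans_lt (Metric.isBounded_ball.measure_lt_top)).ne
  set I := Ioo (s₀ - κ * r) (s₀ + κ * r) with hI
  set B := Metric.closedBall s₀ (κ * r) with hB
  have hIB : I ⊆ B := by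
    rw [hB, Real.closedBall_eq_Icc]; exact Ioo_subset_Icc_self
  set F : ℝ → ℝ≥0∞ := fun s => ∫⁻ τ in Ioo 0 η, ‖g (s, τ)‖ₑ
  have hcmm : Measurable fun s => ‖c s - c s₀‖ₑ := (hcm.sub_const _).enorm
  have hJ : k * ∫⁻ y in E, ‖u y - c s₀‖ₑ
      ≤ ENNReal.ofReal (κ * r) * ((∫⁻ s in B, ‖c s - c s₀‖ₑ) + ∫⁻ s in B, F s) := by
    rw [← lintegral_indicator hEm, ← hk]
    calc ∫⁻ p, E.indicator (fun y => ‖u y - c s₀‖ₑ) (oblique q e p)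
        ≤ ∫⁻ p, (I ×ˢ Ioo 0 (κ * r)).indicator (fun p : ℝ × ℝ => ‖c p.1 - c s₀‖ₑ + F p.1) p := by
          refine lintegral_mono_ae ?_
          filter_upwards [hac] with ⟨s, t⟩ hp
          by_cases hpE : oblique q e (s, t) ∈ E
          · have hmem := hsub hpE
            rw [indicator_of_mem hpE, indicator_of_mem hmem]
            obtain ⟨h1, h2⟩ := hmem
            simp only [hI, mem_Ioo] at h1 h2
            rw [hp ⟨by simp only; linarith, by simp only; linarith⟩
              ⟨h2.1, by simp only; linarith⟩, add_sub_right_comm]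
            refine (enorm_add_le _ _).trans ?_
            gcongr
            simp only
            rw [intervalIntegral.integral_of_le h2.1.le]
            refine (enorm_integral_le_lintegral_enorm _).trans (lintegral_mono_set ?_)
            exact fun x hx => ⟨hx.1, by linarith [hx.2]⟩
          · rw [indicator_of_notMem hpE]; exact zero_le
      _ = ∫⁻ p in I ×ˢ Ioo 0 (κ * r), (‖c p.1 - c s₀‖ₑ + F p.1) :=
          lintegral_indicator (measurableSet_Ioo.prod measurableSet_Ioo) _
      _ ≤ ∫⁻ s in I, ∫⁻ t in Ioo 0 (κ * r), (‖c s - c s₀‖ₑ + F s) := by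
          rw [Measure.volume_eq_prod, ← Measure.prod_restrict]
          exact lintegral_prod_le _
      _ = ENNReal.ofReal (κ * r) * ∫⁻ s in I, (‖c s - c s₀‖ₑ + F s) := by
          simp only [setLIntegral_const, Real.volume_Ioo, sub_zero]
          rw [lintegral_mul_const' _ _ ENNReal.ofReal_ne_top, mul_comm]
      _ ≤ ENNReal.ofReal (κ * r) * ∫⁻ s in B, (‖c s - c s₀‖ₑ + F s) := by
          gcongr
      _ = _ := by rw [lintegral_add_left hcmm]
  have hX := enorm_setAverage_sub_mul_le hE0 hEt (hu.mono_set inter_subset_right) (c s₀)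
  set X := ‖(⨍ y in E, u y) - c s₀‖ₑ
  have hvB : volume B = ENNReal.ofReal (2 * (κ * r)) := Real.volume_closedBall _ _
  rw [hvB]
  have hB0 : ENNReal.ofReal (2 * (κ * r)) ≠ 0 := (ENNReal.ofReal_pos.2 (by positivity)).ne'
  have hpos : ENNReal.ofReal (2 * l ^ 2 * r ^ 2) ≠ 0 :=
    (ENNReal.ofReal_pos.2 (by positivity)).ne'
  rw [← ENNReal.mul_le_mul_iff_right hpos ENNReal.ofReal_ne_top]
  calc ENNReal.ofReal (2 * l ^ 2 * r ^ 2) * X ≤ k * volume E * X := by gcongr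
    _ = k * (X * volume E) := by ring
    _ ≤ k * ∫⁻ y in E, ‖u y - c s₀‖ₑ := by gcongr
    _ ≤ ENNReal.ofReal (κ * r) * ((∫⁻ s in B, ‖c s - c s₀‖ₑ) + ∫⁻ s in B, F s) := hJ
    _ = ENNReal.ofReal (κ * r) * (ENNReal.ofReal (2 * (κ * r)) *
        ((∫⁻ s in B, ‖c s - c s₀‖ₑ) / ENNReal.ofReal (2 * (κ * r)) +
          (∫⁻ s in B, F s) / ENNReal.ofReal (2 * (κ * r)))) := by
        rw [mul_add (ENNReal.ofReal (2 * (κ * r))), ENNReal.mul_div_cancel hB0 ENNReal.ofReal_ne_top,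
          ENNReal.mul_div_cancel hB0 ENNReal.ofReal_ne_top]
    _ = _ := by
        have e1 : ENNReal.ofReal (κ * r) * ENNReal.ofReal (2 * (κ * r))
            = ENNReal.ofReal (2 * l ^ 2 * r ^ 2) * ENNReal.ofReal (κ ^ 2 / l ^ 2) := by
          rw [← ENNReal.ofReal_mul (by positivity), ← ENNReal.ofReal_mul (by positivity)]
          congr 1; field_simp
        rw [← mul_assoc (ENNReal.ofReal (κ * r)), e1, mul_assoc]

/-- In `enorm_average_halfBall_le` the oscillation of $c$ tends to $0$ at its Lebesgue points. The
gradient term is bounded with a strip of fixed height $\eta_k$, whose averages tend to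
$F_k(s_0)=\int_0^{\eta_k}|g(s_0,\tau)|\,d\tau$; this is small for large $k$ when $g(s_0,\cdot)$ is
integrable. Using countably many heights keeps the exceptional set null. -/
theorem ae_tendsto_average (n : ℕ) {u : ℂ → ℝ} (hu : IntegrableOn u (Omega n)) {q e : ℂ}
    (he : e.re ≠ 0) {a b H δ : ℝ} (hH : 0 < H) (hδ : 0 < δ)
    (hbox : ∀ s ∈ Ioo a b, ∀ t ∈ Ioo 0 H, oblique q e (s, t) ∈ Omega n)
    (hlow : ∀ s ∈ Ioo a b, ∀ t ∈ Ioc (-δ) 0, oblique q e (s, t) ∉ Omega n)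
    {c : ℝ → ℝ} {g : ℝ × ℝ → ℝ} (hc : Integrable c) (hcm : StronglyMeasurable c)
    (hg : Integrable g)
    (hac : ∀ᵐ p : ℝ × ℝ, p.1 ∈ Ioo a b → p.2 ∈ Ioo 0 H →
      u (oblique q e p) = c p.1 + ∫ τ in (0 : ℝ)..p.2, g (p.1, τ)) :
    ∀ᵐ s, s ∈ Ioo a b → Tendsto
      (fun r => ⨍ y in Metric.ball (oblique q e (s, 0)) r ∩ Omega n, u y) (𝓝[>] 0) (𝓝 (c s)) := by
  set η : ℕ → ℝ := fun k => 1 / ((k : ℝ) + 1) with hη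
  have hηpos : ∀ k, 0 < η k := fun k => by simp only [hη]; positivity
  set F : ℕ → ℝ → ℝ≥0∞ := fun k s => ∫⁻ τ in Ioo 0 (η k), ‖g (s, τ)‖ₑ
  have hgi : ∫⁻ s, ∫⁻ τ, ‖g (s, τ)‖ₑ ≠ ⊤ := by
    have := hg.2
    rw [HasFiniteIntegral, Measure.volume_eq_prod, lintegral_prod _ hg.1.enorm] at this
    exact this.ne
  have hgm : AEMeasurable fun s => ∫⁻ τ, ‖g (s, τ)‖ₑ := hg.1.enorm.lintegral_prod_right'
  have hFm : ∀ k, AEMeasurable (F k) := fun k => by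
    have h1 : AEMeasurable (fun p : ℝ × ℝ => ‖g p‖ₑ)
        ((volume : Measure ℝ).prod (volume.restrict (Ioo 0 (η k)))) := by
      refine hg.1.enorm.mono_measure ?_
      rw [Measure.volume_eq_prod]
      nth_rw 1 [← Measure.restrict_univ (μ := (volume : Measure ℝ))]
      rw [Measure.prod_restrict]
      exact Measure.restrict_le_self
    exact h1.lintegral_prod_right'
  have hFi : ∀ k, ∫⁻ s, F k s ≠ ⊤ := fun k =>
    ((lintegral_mono fun s => setLIntegral_le_lintegral _ _).trans_lt hgi.lt_top).ne
  have hA := (Besicovitch.vitaliFamily (volume : Measure ℝ)).ae_tendsto_lintegral_enorm_sub_div'_of_integrable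
    hc hcm
  have hB : ∀ᵐ s, ∀ k, Tendsto (fun S => (∫⁻ y in S, F k y) / volume S)
      ((Besicovitch.vitaliFamily (volume : Measure ℝ)).filterAt s) (𝓝 (F k s)) :=
    ae_all_iff.2 fun k =>
      (Besicovitch.vitaliFamily (volume : Measure ℝ)).ae_tendsto_lintegral_div (hFm k) (hFi k)
  have hC : ∀ᵐ s, ∫⁻ τ, ‖g (s, τ)‖ₑ < ⊤ := ae_lt_top' hgm hgi
  filter_upwards [hA, hB, hC] with s₀ hA hB hC hs₀
  set κ := (1 + ‖e‖) / |e.re| + 1 with hκ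
  set l := 1 / (1 + ‖e‖) with hl
  have hκ0 : 0 < κ := by rw [hκ]; positivity
  have hκt : Tendsto (fun r : ℝ => κ * r) (𝓝[>] 0) (𝓝[>] 0) := by
    refine tendsto_nhdsWithin_iff.2 ⟨?_, ?_⟩
    · have : Tendsto (fun r : ℝ => κ * r) (𝓝 0) (𝓝 (κ * 0)) := (continuous_const_mul κ).tendsto 0
      rw [mul_zero] at this
      exact this.mono_left nhdsWithin_le_nhds
    · filter_upwards [self_mem_nhdsWithin] with r hr
      exact mul_pos hκ0 hr
  have hfilt := (Besicovitch.tendsto_filterAt (volume : Measure ℝ) s₀).comp hκt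
  have hA' := hA.comp hfilt
  set M := ENNReal.ofReal (κ ^ 2 / l ^ 2)
  have hF0 : Tendsto (fun k => F k s₀) atTop (𝓝 0) := by
    refine tendsto_setLIntegral_zero hC.ne ?_
    have : (fun k => volume (Ioo 0 (η k))) = fun k => ENNReal.ofReal (η k) := by
      funext k; rw [Real.volume_Ioo, sub_zero]
    change Tendsto (fun k => volume (Ioo 0 (η k))) atTop (𝓝 0)
    rw [this, ← ENNReal.ofReal_zero]
    exact ENNReal.tendsto_ofReal tendsto_one_div_add_atTop_nhds_zero_nat
  have hMF : Tendsto (fun k => M * F k s₀) atTop (𝓝 0) := by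
    have := ENNReal.Tendsto.const_mul (a := M) hF0 (Or.inr ENNReal.ofReal_ne_top)
    rwa [mul_zero] at this
  rw [tendsto_iff_edist_tendsto_0, ENNReal.tendsto_nhds_zero]
  intro ε hε
  obtain ⟨k, hk⟩ := (hMF.eventually (gt_mem_nhds hε)).exists
  have hlim : Tendsto (fun r => M * ((∫⁻ s in Metric.closedBall s₀ (κ * r), ‖c s - c s₀‖ₑ)
            / volume (Metric.closedBall s₀ (κ * r))
          + (∫⁻ s in Metric.closedBall s₀ (κ * r), F k s)
            / volume (Metric.closedBall s₀ (κ * r)))) (𝓝[>] 0) (𝓝 (M * (0 + F k s₀))) :=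
    ENNReal.Tendsto.const_mul (hA'.add ((hB k).comp hfilt)) (Or.inr ENNReal.ofReal_ne_top)
  rw [zero_add] at hlim
  have hsmall : ∀ x : ℝ, 0 < x → ∀ᶠ r in 𝓝[>] (0 : ℝ), κ * r < x := fun x hx =>
    (hκt.mono_right nhdsWithin_le_nhds).eventually (gt_mem_nhds hx)
  filter_upwards [hlim.eventually (gt_mem_nhds hk), self_mem_nhdsWithin,
    hsmall (s₀ - a) (by linarith [hs₀.1]), hsmall (b - s₀) (by linarith [hs₀.2]), hsmall H hH,
    hsmall δ hδ, hsmall (η k) (hηpos k)] with r h1 h2 h3 h4 h5 h6 h7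
  rw [edist_eq_enorm_sub]
  exact (enorm_average_halfBall_le n hu he hbox hlow hac hcm.measurable h2 hκ hl h3 h4 h5 h6
    h7).trans h1.le

/-! ### The Poincaré inequality -/

/-- The arc length parameter of the point with relative position `s` on the `j`-th edge. -/
def edgeParam (n j : ℕ) (s : ℝ) : ℝ := (1 / 3) ^ n * (j + s)

theorem measurableEmbedding_edgeParam (n j : ℕ) : MeasurableEmbedding (edgeParam n j) :=
  (Homeomorph.mulLeft₀ ((1 / 3 : ℝ) ^ n) (by positivity)).measurableEmbedding.comp
    (measurableEmbedding_addLeft (j : ℝ))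

theorem map_edgeParam (n j : ℕ) :
    Measure.map (edgeParam n j) volume = ENNReal.ofReal (3 ^ n) • volume := by
  have h : edgeParam n j = ((1 / 3 : ℝ) ^ n * ·) ∘ ((j : ℝ) + ·) := rfl
  rw [h, ← Measure.map_map (measurable_const_mul _) (measurable_const_add _), map_add_left_eq_self,
    Real.map_volume_mul_left (by positivity)]
  congr 2
  rw [abs_of_pos (by positivity)]
  simp

theorem edgeParam_mem_Icc (n : ℕ) {j : ℕ} (hj : j < 3 * 4 ^ n) {s : ℝ} (hs : s ∈ Icc (0 : ℝ) 1) :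
    edgeParam n j s ∈ Icc 0 (perimeter n) := by
  refine ⟨mul_nonneg (by positivity) (add_nonneg (by positivity) hs.1), ?_⟩
  have h1 : ((j : ℝ) + 1) ≤ 3 * 4 ^ n := by exact_mod_cast hj
  calc (1 / 3 : ℝ) ^ n * (j + s) ≤ (1 / 3) ^ n * (3 * 4 ^ n) := by
        gcongr; linarith [hs.2]
    _ = perimeter n := by rw [perimeter, div_pow, div_pow]; ring

theorem oblique_edge_zero (n : ℕ) {j : ℕ} (hj : j < 3 * 4 ^ n) {s : ℝ} (hs : s ∈ Icc (0 : ℝ) 1) :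
    oblique (vertex n j) (edge n j) (s, 0) = arcParam n (edgeParam n j s) := by
  rw [edgeParam, arcParam_edge n j hj hs, oblique]
  simp

theorem ae_edge (n : ℕ) {j : ℕ} (hj : j < 3 * 4 ^ n) {p : ℂ → Prop} (h : ∀ᵐ x ∂(ds n), p x) :
    ∀ᵐ s : ℝ, s ∈ Ioo (0 : ℝ) 1 → p (oblique (vertex n j) (edge n j) (s, 0)) := by
  have h1 := (ae_restrict_iff' measurableSet_Icc).1 (ae_ds_iff n h)
  have h2 : ∀ᵐ s ∂(Measure.map (edgeParam n j) volume),
      s ∈ Icc 0 (perimeter n) → p (arcParam n s) := by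
    rw [map_edgeParam]
    exact Measure.ae_smul_measure h1 _
  rw [(measurableEmbedding_edgeParam n j).ae_map_iff] at h2
  filter_upwards [h2] with s hs hs1
  rw [oblique_edge_zero n hj (Ioo_subset_Icc_self hs1)]
  exact hs (edgeParam_mem_Icc n hj (Ioo_subset_Icc_self hs1))

theorem lintegral_edge_le (n : ℕ) {j : ℕ} (hj : j < 3 * 4 ^ n) {F : ℂ → ℝ≥0∞}
    (hF : Measurable F) :
    ∫⁻ s in Ioo (0 : ℝ) 1, F (oblique (vertex n j) (edge n j) (s, 0))
      ≤ ENNReal.ofReal (3 ^ n) * ∫⁻ x, F x ∂(ds n) := by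
  rw [lintegral_ds n hF.aemeasurable, ← lintegral_indicator measurableSet_Icc,
    ← lintegral_indicator measurableSet_Ioo, ← smul_eq_mul, ← lintegral_smul_measure,
    ← map_edgeParam n j, (measurableEmbedding_edgeParam n j).lintegral_map]
  refine lintegral_mono fun s => ?_
  by_cases hs : s ∈ Ioo (0 : ℝ) 1
  · rw [indicator_of_mem hs, indicator_of_mem (edgeParam_mem_Icc n hj (Ioo_subset_Icc_self hs)),
      oblique_edge_zero n hj (Ioo_subset_Icc_self hs)]
  · rw [indicator_of_notMem hs]
    exact zero_le

/-- In a box, $c$ and the trace are both limits of the same averages, hence agree almost everywhere.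
A set that is locally null is null, so boxes around single points suffice. -/
theorem ae_eq_trace_add_integral (n : ℕ) {j : ℕ} (hj : j < 3 * 4 ^ n) {u : ℂ → ℝ} {G : ℂ → ℂ}
    (hum : Measurable u) (hGm : Measurable G) (hu : IntegrableOn u (Omega n))
    (hG : IntegrableOn G (Omega n)) (hw : IsWeakGrad n u G) (htr : IsOwnTrace n u) :
    ∀ᵐ p : ℝ × ℝ, p ∈ aboveEdge n j →
      u (oblique (vertex n j) (edge n j) p) = u (oblique (vertex n j) (edge n j) (p.1, 0))
        + ∫ τ in (0 : ℝ)..p.2, (Omega n).indicator (fun z => (G z).im)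
            (oblique (vertex n j) (edge n j) (p.1, τ)) := by
  have he := edge_re_ne_zero n j hj
  rw [ae_iff]
  refine measure_null_of_locally_null _ fun p₀ hp₀ => ?_
  rw [mem_ofPred_eq, Classical.not_imp] at hp₀
  obtain ⟨δ, hδ, H, hH, hsub, hbox, hlow⟩ := exists_box n j hj hp₀.1
  have hH0 : 0 < H := hp₀.1.2.1.trans hH
  obtain ⟨c, hcm, hc, hac⟩ := exists_vertical_primitive n hum hGm hu hG hw he hH0 hbox
  have hgi : Integrable fun p : ℝ × ℝ => (Omega n).indicator (fun z => (G z).im)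
      (oblique (vertex n j) (edge n j) p) := by
    refine integrable_comp_oblique _ he ?_
    rw [integrable_indicator_iff (isOpen_Omega n).measurableSet]
    exact hG.im
  have h1 := ae_tendsto_average n hu he hH0 hδ hbox hlow hc hcm hgi hac
  have h2 := ae_edge n hj htr
  have h3 : ∀ᵐ s : ℝ, s ∈ Ioo (p₀.1 - δ) (p₀.1 + δ) →
      c s = u (oblique (vertex n j) (edge n j) (s, 0)) := by
    filter_upwards [h1, h2] with s h1 h2 hs
    exact tendsto_nhds_unique (h1 hs) (h2 (hsub hs))
  have h4 : ∀ᵐ p : ℝ × ℝ, p.1 ∈ Ioo (p₀.1 - δ) (p₀.1 + δ) →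
      c p.1 = u (oblique (vertex n j) (edge n j) (p.1, 0)) :=
    Measure.quasiMeasurePreserving_fst.ae h3
  have h5 := hac.and h4
  refine ⟨_, inter_mem_nhdsWithin _ ((isOpen_Ioo.prod isOpen_Ioo).mem_nhds
    (show p₀ ∈ Ioo (p₀.1 - δ) (p₀.1 + δ) ×ˢ Ioo 0 H from
      ⟨⟨by linarith, by linarith⟩, hp₀.1.2.1, hH⟩)), ?_⟩
  refine measure_mono_null ?_ (ae_iff.1 h5)
  rintro p ⟨hp, hp1, hp2⟩ h
  rw [mem_ofPred_eq, Classical.not_imp] at hp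
  exact hp.2 (by rw [h.1 hp1 hp2, h.2 hp1])

/-- Descend vertically from $z$ to the first point outside $\Omega$, which exists because $\Omega$
is bounded. It lies in the closure of $\Omega$, hence on $K_n$, and is interior to its edge because
the vertices have other real parts. -/
theorem exists_mem_aboveEdge (n : ℕ) {z : ℂ} (hz : z ∈ Omega n)
    (hre : ∀ j ≤ 3 * 4 ^ n, z.re ≠ (vertex n j).re) :
    ∃ j < 3 * 4 ^ n, ∃ p ∈ aboveEdge n j, oblique (vertex n j) (edge n j) p = z := by
  set S : Set ℝ := {h | 0 ≤ h ∧ z - h * Complex.I ∉ Omega n}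
  have hcont : Continuous fun h : ℝ => z - h * Complex.I := by fun_prop
  have hSc : IsClosed S :=
    isClosed_Ici.inter ((isOpen_Omega n).isClosed_compl.preimage hcont)
  obtain ⟨R, hR⟩ := (isBounded_Omega n).exists_norm_le
  have hSne : S.Nonempty := by
    refine ⟨|z.im| + |R| + 1, by positivity, fun h => ?_⟩
    have h1 := (Complex.abs_im_le_norm _).trans (hR _ h)
    have h2 := (abs_le.1 h1).1
    simp only [Complex.sub_im, Complex.mul_im, Complex.ofReal_re, Complex.I_im, mul_one,
      Complex.ofReal_im, Complex.I_re, mul_zero, add_zero] at h2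
    linarith [le_abs_self z.im, le_abs_self R]
  have hSb : BddBelow S := ⟨0, fun h hh => hh.1⟩
  set h₀ := sInf S
  have hmem : h₀ ∈ S := hSc.csInf_mem hSne hSb
  have hlt : ∀ h, 0 ≤ h → h < h₀ → z - h * Complex.I ∈ Omega n := fun h h1 h2 => by
    by_contra h3
    exact absurd (csInf_le hSb (show h ∈ S from ⟨h1, h3⟩)) (not_le.2 h2)
  have hpos : 0 < h₀ := by
    refine lt_of_le_of_ne hmem.1 fun h => hmem.2 ?_
    rw [← h]; simpa using hz
  have hcl : z - h₀ * Complex.I ∈ closure (Omega n) := by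
    have : Tendsto (fun h : ℝ => z - h * Complex.I) (𝓝[<] h₀) (𝓝 (z - h₀ * Complex.I)) :=
      (hcont.tendsto h₀).mono_left nhdsWithin_le_nhds
    refine mem_closure_of_tendsto this ?_
    filter_upwards [Ioo_mem_nhdsLT hpos] with h hh
    exact hlt h hh.1.le hh.2
  obtain ⟨s, hs, hsz⟩ := (closure_Omega_subset n hcl).resolve_left hmem.2
  obtain ⟨j, hj, t, ht, rfl⟩ := exists_edge n hs
  rw [arcParam_edge n j hj ht] at hsz
  have hzre : z.re = (vertex n j).re + t * (edge n j).re := by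
    have := congrArg Complex.re hsz
    simpa using this.symm
  have ht0 : t ≠ 0 := fun h => hre j hj.le (by rw [hzre, h, zero_mul, add_zero])
  have ht1 : t ≠ 1 := fun h => hre (j + 1) hj (by rw [hzre, h, one_mul, edge]; simp)
  refine ⟨j, hj, (t, h₀), ⟨⟨lt_of_le_of_ne ht.1 ht0.symm, lt_of_le_of_ne ht.2 ht1⟩, hpos,
    fun τ hτ => ?_⟩, ?_⟩
  · have : oblique (vertex n j) (edge n j) (t, τ) = z - (h₀ - τ : ℝ) * Complex.I := by
      simp only [oblique]; rw [hsz]; push_cast; ring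
    simp only [this]
    exact hlt _ (by linarith [hτ.2]) (by linarith [hτ.1])
  · simp only [oblique]; rw [hsz]; ring

theorem ae_re_ne (c : ℝ) : ∀ᵐ z : ℂ, z.re ≠ c := by
  have h1 : ∀ᵐ x : ℝ, x ≠ c := by simp [ae_iff]
  have h2 : ∀ᵐ p : ℝ × ℝ, p.1 ≠ c := Measure.quasiMeasurePreserving_fst.ae h1
  exact Complex.volume_preserving_equiv_real_prod.quasiMeasurePreserving.ae h2

theorem ae_exists_mem_aboveEdge (n : ℕ) : ∀ᵐ z : ℂ, z ∈ Omega n →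
    ∃ j < 3 * 4 ^ n, ∃ p ∈ aboveEdge n j, oblique (vertex n j) (edge n j) p = z := by
  have : ∀ᵐ z : ℂ, ∀ j : ℕ, z.re ≠ (vertex n j).re := ae_all_iff.2 fun j => ae_re_ne _
  filter_upwards [this] with z hz hzΩ
  exact exists_mem_aboveEdge n hzΩ fun j _ => hz j

theorem exists_height_bound (n : ℕ) : ∃ D : ℝ, 0 < D ∧ ∀ j, ∀ p ∈ aboveEdge n j, p.2 ≤ D := by
  obtain ⟨R, hR⟩ := (isBounded_Omega n).exists_norm_le
  refine ⟨2 * |R| + 1, by positivity, fun j p hp => ?_⟩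
  have h1 := (Complex.abs_im_le_norm _).trans (hR _ (hp.2.2 p.2 ⟨hp.2.1, le_rfl⟩))
  by_contra! h
  have h3 := (Complex.abs_im_le_norm _).trans
    (hR _ (hp.2.2 (p.2 - 2 * |R| - 1) ⟨by linarith, by linarith [abs_nonneg R]⟩))
  rw [oblique_im] at h1 h3
  have h4 := (abs_le.1 h1).2
  have h5 := (abs_le.1 h3).1
  simp only at h4 h5
  linarith [le_abs_self R]

/-- On a vertical of length at most $D$,
$|u(s,t)|^2\le2\big(|u(s,0)|^2+D\int|g(s,\tau)|^2d\tau\big)$. The right side does not depend on $t$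
and is integrated over $(0,1)\times(0,D]$. -/
theorem lintegral_aboveEdge_le (n : ℕ) {j : ℕ} (hj : j < 3 * 4 ^ n) :
    ∃ C : ℝ≥0∞, C ≠ ⊤ ∧ ∀ (u : ℂ → ℝ) (G : ℂ → ℂ), Measurable u → Measurable G →
      IntegrableOn u (Omega n) → IntegrableOn G (Omega n) → IsWeakGrad n u G → IsOwnTrace n u →
      ∫⁻ z, (oblique (vertex n j) (edge n j) '' aboveEdge n j).indicator (fun z => ‖u z‖ₑ ^ 2) z
        ≤ C * ((∫⁻ z in Omega n, ‖G z‖ₑ ^ 2) + ∫⁻ x, ‖u x‖ₑ ^ 2 ∂(ds n)) := by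
  have he := edge_re_ne_zero n j hj
  obtain ⟨k, hk0, hkt, hk⟩ := lintegral_comp_oblique (vertex n j) he
  obtain ⟨D, hD, hDb⟩ := exists_height_bound n
  set D' := ENNReal.ofReal D
  have hD't : D' ≠ ⊤ := ENNReal.ofReal_ne_top
  refine ⟨k⁻¹ * (D' * 2 * (ENNReal.ofReal (3 ^ n) + D' * k)), ?_, ?_⟩
  · finiteness
  intro u G hum hGm hu hG hw htr
  set Φ := oblique (vertex n j) (edge n j)
  set A := aboveEdge n j
  have hΦm : Measurable Φ := (continuous_oblique _ _).measurable
  set g : ℝ × ℝ → ℝ := fun p => (Omega n).indicator (fun z => (G z).im) (Φ p) with hg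
  have hgm : Measurable g := ((Complex.measurable_im.comp hGm).indicator
    (isOpen_Omega n).measurableSet).comp hΦm
  set X := ∫⁻ z in Omega n, ‖G z‖ₑ ^ 2 with hX
  set Y := ∫⁻ x, ‖u x‖ₑ ^ 2 ∂(ds n)
  set h : ℝ → ℝ≥0∞ := fun s => 2 * (‖u (Φ (s, 0))‖ₑ ^ 2 + D' * ∫⁻ τ, ‖g (s, τ)‖ₑ ^ 2) with hh
  have hgm2 : Measurable fun p : ℝ × ℝ => ‖g p‖ₑ ^ 2 := hgm.enorm.pow_const 2
  have hum2 : Measurable fun s : ℝ => ‖u (Φ (s, 0))‖ₑ ^ 2 :=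
    (hum.comp (hΦm.comp (measurable_id.prodMk measurable_const))).enorm.pow_const 2
  have hgm3 : Measurable fun s : ℝ => ∫⁻ τ, ‖g (s, τ)‖ₑ ^ 2 := hgm2.lintegral_prod_right'
  have hhm : Measurable h := (hum2.add (hgm3.const_mul D')).const_mul 2
  have hgX : ∫⁻ s, ∫⁻ τ, ‖g (s, τ)‖ₑ ^ 2 ≤ k * X := by
    rw [← lintegral_prod _ hgm2.aemeasurable, ← Measure.volume_eq_prod, hX,
      ← lintegral_indicator (isOpen_Omega n).measurableSet, ← hk]
    refine lintegral_mono fun p => ?_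
    by_cases hp : Φ p ∈ Omega n
    · simp only [hg]
      rw [indicator_of_mem hp, indicator_of_mem hp]
      gcongr
      rw [enorm_le_iff_norm_le]
      exact Complex.abs_im_le_norm _
    · simp only [hg]
      rw [indicator_of_notMem hp]; simp
  have hmain : ∫⁻ p : ℝ × ℝ, (Φ '' A).indicator (fun z => ‖u z‖ₑ ^ 2) (Φ p)
      ≤ ∫⁻ p : ℝ × ℝ, (Ioo (0 : ℝ) 1).indicator h p.1 * (Ioc 0 D).indicator 1 p.2 := by
    refine lintegral_mono_ae ?_
    filter_upwards [ae_eq_trace_add_integral n hj hum hGm hu hG hw htr] with p hp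
    by_cases hpA : p ∈ A
    · have hp1 : p.1 ∈ Ioo (0 : ℝ) 1 := hpA.1
      have hp2 : p.2 ∈ Ioc 0 D := ⟨hpA.2.1, hDb j p hpA⟩
      rw [indicator_of_mem (mem_image_of_mem _ hpA), indicator_of_mem hp1, indicator_of_mem hp2,
        Pi.one_apply, mul_one, hp hpA, hh]
      refine (pow_le_pow_left' (enorm_add_le _ _) 2).trans ((ennreal_add_sq_le _ _).trans ?_)
      refine mul_le_mul' le_rfl (add_le_add le_rfl
        ((sq_enorm_intervalIntegral_le hp2.1.le).trans ?_))
      rw [sub_zero]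
      exact mul_le_mul' (ENNReal.ofReal_le_ofReal hp2.2) (setLIntegral_le_lintegral _ _)
    · rw [indicator_of_notMem]
      · exact zero_le
      · rintro ⟨q, hq, hqp⟩
        exact hpA (oblique_injective _ he hqp ▸ hq)
  have hprod : ∫⁻ p : ℝ × ℝ, (Ioo (0 : ℝ) 1).indicator h p.1 * (Ioc 0 D).indicator 1 p.2
      = (∫⁻ s in Ioo (0 : ℝ) 1, h s) * D' := by
    rw [Measure.volume_eq_prod, lintegral_prod_mul (hhm.indicator measurableSet_Ioo).aemeasurable
      (measurable_one.indicator measurableSet_Ioc).aemeasurable,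
      lintegral_indicator measurableSet_Ioo, lintegral_indicator_one measurableSet_Ioc,
      Real.volume_Ioc, sub_zero]
  have hhint : ∫⁻ s in Ioo (0 : ℝ) 1, h s ≤ 2 * (ENNReal.ofReal (3 ^ n) * Y + D' * (k * X)) := by
    have hs : Measurable fun s : ℝ => ‖u (Φ (s, 0))‖ₑ ^ 2 + D' * ∫⁻ τ, ‖g (s, τ)‖ₑ ^ 2 :=
      hum2.add (hgm3.const_mul D')
    simp only [hh]
    rw [lintegral_const_mul _ hs, lintegral_add_left hum2, lintegral_const_mul _ hgm3]
    gcongr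
    · exact lintegral_edge_le n hj (hum.enorm.pow_const 2)
    · exact (setLIntegral_le_lintegral _ _).trans hgX
  have hfin : ∫⁻ z, (Φ '' A).indicator (fun z => ‖u z‖ₑ ^ 2) z
      = k⁻¹ * ∫⁻ p : ℝ × ℝ, (Φ '' A).indicator (fun z => ‖u z‖ₑ ^ 2) (Φ p) := by
    rw [hk, ← mul_assoc, ENNReal.inv_mul_cancel hk0 hkt, one_mul]
  rw [hfin, mul_assoc]
  gcongr
  calc _ ≤ (∫⁻ s in Ioo (0 : ℝ) 1, h s) * D' := hmain.trans_eq hprod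
    _ ≤ 2 * (ENNReal.ofReal (3 ^ n) * Y + D' * (k * X)) * D' := by gcongr
    _ ≤ 2 * ((ENNReal.ofReal (3 ^ n) + D' * k) * (X + Y)) * D' := by
        gcongr
        calc ENNReal.ofReal (3 ^ n) * Y + D' * (k * X)
            ≤ ENNReal.ofReal (3 ^ n) * (X + Y) + D' * k * (X + Y) := by
              rw [← mul_assoc]
              gcongr
              · exact le_add_self
              · exact le_self_add
          _ = _ := by ring
    _ = _ := by ring

theorem isOpen_aboveEdge (n : ℕ) {j : ℕ} (hj : j < 3 * 4 ^ n) : IsOpen (aboveEdge n j) := by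
  refine isOpen_iff_mem_nhds.2 fun p₀ hp₀ => ?_
  obtain ⟨δ, hδ, H, hH, hsub, hbox, -⟩ := exists_box n j hj hp₀
  refine mem_of_superset ((isOpen_Ioo.prod isOpen_Ioo).mem_nhds
    (show p₀ ∈ Ioo (p₀.1 - δ) (p₀.1 + δ) ×ˢ Ioo 0 H from
      ⟨⟨by linarith, by linarith⟩, hp₀.2.1, hH⟩)) ?_
  rintro p ⟨hp1, hp2⟩
  exact ⟨hsub hp1, hp2.1, fun τ hτ => hbox _ hp1 _ ⟨hτ.1, hτ.2.trans_lt hp2.2⟩⟩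

theorem poincare_of_measurable (n : ℕ) :
    ∃ C : ℝ≥0∞, C ≠ ⊤ ∧ ∀ (u : ℂ → ℝ) (G : ℂ → ℂ), Measurable u → Measurable G →
      IntegrableOn u (Omega n) → IntegrableOn G (Omega n) → IsWeakGrad n u G → IsOwnTrace n u →
      ∫⁻ z in Omega n, ‖u z‖ₑ ^ 2
        ≤ C * ((∫⁻ z in Omega n, ‖G z‖ₑ ^ 2) + ∫⁻ x, ‖u x‖ₑ ^ 2 ∂(ds n)) := by
  choose C hCt hC using fun j : Fin (3 * 4 ^ n) => lintegral_aboveEdge_le n j.2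
  refine ⟨∑ j, C j, ENNReal.sum_ne_top.2 fun j _ => hCt j, fun u G hum hGm hu hG hw htr => ?_⟩
  have hmeas : ∀ j : Fin (3 * 4 ^ n), AEMeasurable fun z : ℂ =>
      (oblique (vertex n j) (edge n j) '' aboveEdge n j).indicator (fun z => ‖u z‖ₑ ^ 2) z := fun j =>
    ((hum.enorm.pow_const 2).indicator (isOpenMap_oblique _ (edge_re_ne_zero n j j.2) _
      (isOpen_aboveEdge n j.2)).measurableSet).aemeasurable
  rw [← lintegral_indicator (isOpen_Omega n).measurableSet, Finset.sum_mul]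
  calc _ ≤ ∫⁻ z, ∑ j : Fin (3 * 4 ^ n),
        (oblique (vertex n j) (edge n j) '' aboveEdge n j).indicator (fun z => ‖u z‖ₑ ^ 2) z := by
        refine lintegral_mono_ae ?_
        filter_upwards [ae_exists_mem_aboveEdge n] with z hz
        by_cases hzΩ : z ∈ Omega n
        · obtain ⟨j, hj, p, hp, hpz⟩ := hz hzΩ
          rw [indicator_of_mem hzΩ]
          refine le_trans (le_of_eq ?_) (Finset.single_le_sum (fun _ _ => zero_le)
            (Finset.mem_univ (⟨j, hj⟩ : Fin (3 * 4 ^ n))))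
          exact (indicator_of_mem (show z ∈ oblique (vertex n j) (edge n j) '' aboveEdge n j from
            ⟨p, hp, hpz⟩) fun z => ‖u z‖ₑ ^ 2).symm
        · rw [indicator_of_notMem hzΩ]; exact zero_le
    _ = ∑ j : Fin (3 * 4 ^ n), ∫⁻ z,
        (oblique (vertex n j) (edge n j) '' aboveEdge n j).indicator (fun z => ‖u z‖ₑ ^ 2) z :=
        lintegral_finsetSum' _ fun j _ => hmeas j
    _ ≤ _ := Finset.sum_le_sum fun j _ => hC j u G hum hGm hu hG hw htr

/-! ### Equivalence of the energy with the squared norm of $V$ -/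

theorem ofReal_integral_norm_sq {α E : Type*} [MeasurableSpace α] [NormedAddCommGroup E]
    {μ : Measure α} {f : α → E} (hf : MemLp f 2 μ) :
    ENNReal.ofReal (∫ x, ‖f x‖ ^ 2 ∂μ) = ∫⁻ x, ‖f x‖ₑ ^ 2 ∂μ := by
  rw [ofReal_integral_eq_lintegral_ofReal (hf.integrable_norm_pow two_ne_zero)
    (ae_of_all _ fun x => by positivity)]
  simp_rw [ENNReal.ofReal_pow (norm_nonneg _), ofReal_norm]

theorem memLp_Omega (n : ℕ) (v : L2 n) : MemLp v 2 (volume.restrict (Omega n)) :=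
  (Lp.memLp v).mono_measure (Measure.le_add_right le_rfl)

theorem memLp_ds (n : ℕ) (v : L2 n) : MemLp v 2 (ds n) :=
  (Lp.memLp v).mono_measure (Measure.le_add_left le_rfl)

theorem inner_eq (n : ℕ) (u v : L2 n) :
    inner ℝ u v = (∫ x in Omega n, u x * v x) + ∫ x, u x * v x ∂(ds n) := by
  rw [L2.inner_def, ← integral_add_measure]
  · simp [m, mul_comm]
  · exact (memLp_Omega n u).integrable_mul (memLp_Omega n v)
  · exact (memLp_ds n u).integrable_mul (memLp_ds n v)

theorem norm_sq_eq (n : ℕ) (v : L2 n) :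
    ‖v‖ ^ 2 = (∫ x in Omega n, v x ^ 2) + ∫ x, v x ^ 2 ∂(ds n) := by
  rw [← real_inner_self_eq_norm_sq, inner_eq]
  simp_rw [sq]

theorem MemV.isWeakGrad {n : ℕ} {v : L2 n} (hv : MemV n v) : IsWeakGrad n v (grad n v) := by
  rw [grad, dif_pos hv.1]
  exact hv.1.choose_spec

theorem MemV.isTangDeriv {n : ℕ} {v : L2 n} (hv : MemV n v) : IsTangDeriv n v (tgrad n v) := by
  rw [tgrad, dif_pos hv.2.1]
  exact hv.2.1.choose_spec

theorem normV_sq (n : ℕ) (v : L2 n) : normV n v ^ 2 =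
    (∫ x in Omega n, ‖grad n v x‖ ^ 2) + (∫ x, (tgrad n v x) ^ 2 ∂(ds n)) + ‖v‖ ^ 2 := by
  have h1 : 0 ≤ ∫ x in Omega n, ‖grad n v x‖ ^ 2 := integral_nonneg fun x => by positivity
  have h2 : 0 ≤ ∫ x, (tgrad n v x) ^ 2 ∂(ds n) := integral_nonneg fun x => by positivity
  rw [normV, Real.sq_sqrt (by positivity)]

/-- A Poincaré inequality: functions in `V(Ω, K_n)` are controlled in `L²(Ω)` by their gradient and
their trace. -/
theorem poincare (n : ℕ) : ∃ C : ℝ, 0 ≤ C ∧ ∀ v : L2 n, MemV n v →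
    ∫ x in Omega n, v x ^ 2
      ≤ C * ((∫ x in Omega n, ‖grad n v x‖ ^ 2) + ∫ x, v x ^ 2 ∂(ds n)) := by
  obtain ⟨C, hCt, hC⟩ := poincare_of_measurable n
  refine ⟨C.toReal, ENNReal.toReal_nonneg, fun v hv => ?_⟩
  have hw := hv.isWeakGrad
  set G := hw.1.1.mk
  have hGG : grad n v =ᵐ[volume.restrict (Omega n)] G := hw.1.1.ae_eq_mk
  have hwG : IsWeakGrad n v G := by
    refine ⟨hw.1.ae_eq hGG, fun φ hφ e => ?_⟩
    rw [hw.2 φ hφ e]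
    congr 1
    refine integral_congr_ae ?_
    filter_upwards [hGG] with x hx
    rw [hx]
  have : IsFiniteMeasure (volume.restrict (Omega n)) :=
    ⟨by rw [Measure.restrict_apply_univ]; exact (isBounded_Omega n).measure_lt_top⟩
  have key := hC v G (Lp.stronglyMeasurable v).measurable hw.1.1.stronglyMeasurable_mk.measurable
    ((memLp_Omega n v).integrable one_le_two) (hwG.1.integrable one_le_two) hwG hv.2.2
  have e1 := ofReal_integral_norm_sq (memLp_Omega n v)
  have e2 := ofReal_integral_norm_sq (memLp_ds n v)
  have e3 := ofReal_integral_norm_sq hwG.1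
  have e4 : ∫ x in Omega n, ‖G x‖ ^ 2 = ∫ x in Omega n, ‖grad n v x‖ ^ 2 := by
    refine integral_congr_ae ?_
    filter_upwards [hGG] with x hx
    rw [hx]
  rw [← e1, ← e2, ← e3, e4, ← ENNReal.ofReal_toReal hCt,
    ← ENNReal.ofReal_add (integral_nonneg fun x => by positivity)
      (integral_nonneg fun x => by positivity),
    ← ENNReal.ofReal_mul ENNReal.toReal_nonneg] at key
  simp_rw [Real.norm_eq_abs, sq_abs] at key
  refine (ENNReal.ofReal_le_ofReal_iff (mul_nonneg ENNReal.toReal_nonneg (add_nonneg ?_ ?_))).1 key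
  · exact integral_nonneg fun x => by positivity
  · exact integral_nonneg fun x => by positivity

/-- Near such a point the averages run over the empty set and are $0$. Consequently only the values
of $b$ on $\overline\Omega$ enter the boundary integrals. -/
theorem ae_eq_zero_of_notMem_closure (n : ℕ) {v : ℂ → ℝ} (hv : IsOwnTrace n v) :
    ∀ᵐ x ∂(ds n), x ∉ closure (Omega n) → v x = 0 := by
  filter_upwards [hv] with x hx hxΩ
  refine tendsto_nhds_unique hx (tendsto_const_nhds.congr' ?_)
  rw [Metric.mem_closure_iff] at hxΩ
  push Not at hxΩ
  obtain ⟨ε, hε, h⟩ := hxΩ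
  filter_upwards [Ioo_mem_nhdsGT hε] with r hr
  have : Metric.ball x r ∩ Omega n = ∅ := by
    refine eq_empty_of_forall_notMem fun y hy => ?_
    have h1 := h y hy.2
    have h2 := Metric.mem_ball'.1 hy.1
    linarith [hr.2]
  rw [this]; simp

theorem integral_weight_bounds (n : ℕ) {b : ℂ → ℝ} (hb : ContinuousOn b (closure (Omega n)))
    (hbpos : ∀ x ∈ closure (Omega n), 0 < b x) :
    ∃ β B : ℝ, 0 < β ∧ 0 ≤ B ∧ ∀ v : L2 n, MemV n v →
      β * ∫ x, v x ^ 2 ∂(ds n) ≤ ∫ x, b x * v x * v x ∂(ds n) ∧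
      ∫ x, b x * v x * v x ∂(ds n) ≤ B * ∫ x, v x ^ 2 ∂(ds n) := by
  have hcomp : IsCompact (closure (Omega n)) := (isBounded_Omega n).isCompact_closure
  obtain ⟨β, hβ, hβb⟩ := hcomp.exists_forall_le' hb hbpos
  obtain ⟨B, hB⟩ := hcomp.exists_bound_of_continuousOn hb
  refine ⟨β, |B|, hβ, abs_nonneg _, fun v hv => ?_⟩
  have hz := ae_eq_zero_of_notMem_closure n hv.2.2
  have hsq : Integrable (fun x => v x ^ 2) (ds n) := (memLp_ds n v).integrable_sq
  have hm : AEStronglyMeasurable ((closure (Omega n)).indicator b) (ds n) :=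
    (aestronglyMeasurable_indicator_iff isClosed_closure.measurableSet).2
      (hb.aestronglyMeasurable isClosed_closure.measurableSet)
  have hint : Integrable (fun x => (closure (Omega n)).indicator b x * v x ^ 2) (ds n) := by
    refine hsq.bdd_mul (c := |B|) hm (ae_of_all _ fun x => ?_)
    by_cases hx : x ∈ closure (Omega n)
    · rw [indicator_of_mem hx]; exact (hB x hx).trans (le_abs_self _)
    · rw [indicator_of_notMem hx, norm_zero]; exact abs_nonneg _
  have heq : ∫ x, b x * v x * v x ∂(ds n)
      = ∫ x, (closure (Omega n)).indicator b x * v x ^ 2 ∂(ds n) := by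
    refine integral_congr_ae ?_
    filter_upwards [hz] with x hx
    by_cases hxc : x ∈ closure (Omega n)
    · rw [indicator_of_mem hxc]; ring
    · rw [hx hxc]; ring
  rw [heq, ← integral_const_mul, ← integral_const_mul]
  constructor
  · refine integral_mono_ae (hsq.const_mul _) hint ?_
    filter_upwards [hz] with x hx
    by_cases hxc : x ∈ closure (Omega n)
    · rw [indicator_of_mem hxc]
      exact mul_le_mul_of_nonneg_right (hβb x hxc) (sq_nonneg _)
    · rw [hx hxc]; simp
  · refine integral_mono_ae hint (hsq.const_mul _) (ae_of_all _ fun x => ?_)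
    by_cases hxc : x ∈ closure (Omega n)
    · simp only [indicator_of_mem hxc]
      exact mul_le_mul_of_nonneg_right ((le_abs_self _).trans ((hB x hxc).trans (le_abs_self _)))
        (sq_nonneg _)
    · simp only [indicator_of_notMem hxc, zero_mul]
      positivity

theorem energy_self (n : ℕ) (b : ℂ → ℝ) (v : L2 n) :
    energy n b v v = (∫ x in Omega n, ‖grad n v x‖ ^ 2) + (∫ x, (tgrad n v x) ^ 2 ∂(ds n))
      + (∫ x, b x * v x * v x ∂(ds n)) + theta2 n v v := by
  simp only [energy, real_inner_self_eq_norm_sq, sq]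

theorem energy_comm (n : ℕ) (b : ℂ → ℝ) (u v : L2 n) : energy n b u v = energy n b v u := by
  simp only [energy, theta2]
  congr 1
  · congr 1
    · congr 1
      · simp_rw [real_inner_comm]
      · simp_rw [mul_comm]
    · simp_rw [mul_right_comm]
  · simp_rw [mul_comm]

/-- Since $\theta_2\ge0$ and $b\ge\beta$, the energy is at least $\min(1,\beta)$ times gradient,
tangential and boundary terms together; Poincaré adds $\int_\Omega v^2$ at the cost of a factor
$1+C$. -/
theorem exists_isCoercivityConstant (n : ℕ) {b : ℂ → ℝ} (hb : ContinuousOn b (closure (Omega n)))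
    (hbpos : ∀ x ∈ closure (Omega n), 0 < b x) : ∃ c, IsCoercivityConstant n b c := by
  obtain ⟨C, hC0, hC⟩ := poincare n
  obtain ⟨β, B, hβ, -, hβB⟩ := integral_weight_bounds n hb hbpos
  refine ⟨min 1 β / (1 + C), by positivity, fun v hv => ?_⟩
  have h1 := hC v hv
  have h2 := (hβB v hv).1
  have h3 : 0 ≤ theta2 n v v := integral_nonneg fun p =>
    div_nonneg (mul_self_nonneg _) (by positivity)
  rw [normV_sq, energy_self, norm_sq_eq]
  set A := ∫ x in Omega n, ‖grad n v x‖ ^ 2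
  set D := ∫ x, (tgrad n v x) ^ 2 ∂(ds n)
  set Y := ∫ x, v x ^ 2 ∂(ds n)
  have hA : 0 ≤ A := integral_nonneg fun x => by positivity
  have hD : 0 ≤ D := integral_nonneg fun x => by positivity
  have hY : 0 ≤ Y := integral_nonneg fun x => by positivity
  have hm : 0 ≤ min 1 β := by positivity
  have hmA := mul_le_mul_of_nonneg_right (min_le_left 1 β) hA
  have hmD := mul_le_mul_of_nonneg_right (min_le_left 1 β) hD
  have hmY := mul_le_mul_of_nonneg_right (min_le_right 1 β) hY
  have hCD : 0 ≤ C * D := by positivity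
  calc min 1 β / (1 + C) * (A + D + ((∫ x in Omega n, v x ^ 2) + Y))
      ≤ min 1 β / (1 + C) * ((1 + C) * (A + D + Y)) := by
        refine mul_le_mul_of_nonneg_left ?_ (by positivity)
        nlinarith
    _ = min 1 β * (A + D + Y) := by field_simp
    _ ≤ _ := by linarith

theorem energy_self_le (n : ℕ) {b : ℂ → ℝ} (hb : ContinuousOn b (closure (Omega n)))
    (hbpos : ∀ x ∈ closure (Omega n), 0 < b x) :
    ∃ C : ℝ, 0 < C ∧ ∀ v : L2 n, MemV n v → energy n b v v ≤ C * normV n v ^ 2 := by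
  obtain ⟨C, hC0, hC⟩ := integral_theta_kernel_le n
  obtain ⟨β, B, hβ, hB, hβB⟩ := integral_weight_bounds n hb hbpos
  refine ⟨1 + C + B, by positivity, fun v hv => ?_⟩
  have h1 : theta2 n v v ≤ _ := hC v _ hv.isTangDeriv
  have h2 := (hβB v hv).2
  rw [normV_sq, energy_self, norm_sq_eq]
  set A := ∫ x in Omega n, ‖grad n v x‖ ^ 2
  set D := ∫ x, (tgrad n v x) ^ 2 ∂(ds n)
  set Y := ∫ x, v x ^ 2 ∂(ds n)
  set X := ∫ x in Omega n, v x ^ 2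
  have hA : 0 ≤ A := integral_nonneg fun x => by positivity
  have hD : 0 ≤ D := integral_nonneg fun x => by positivity
  have hX : 0 ≤ X := integral_nonneg fun x => by positivity
  have hY : 0 ≤ Y := integral_nonneg fun x => by positivity
  have := mul_nonneg hC0 hA
  have := mul_nonneg hC0 hX
  have := mul_nonneg hC0 hY
  have := mul_nonneg hB hA
  have := mul_nonneg hB hD
  have := mul_nonneg hB hX
  linarith

/-! ### The energy identity along a solution -/

namespace IsSolution

variable {n : ℕ} {b : ℂ → ℝ} {T : ℝ} {f : ℝ → L2 n} {u₀ : L2 n} {u : ℝ → L2 n}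

/-- Expanding the normal derivative by Green's formula with $\Delta u=u'-f$ brings the volume terms
into the boundary equation, which then is the variational equation in $L^2(\Omega,m)$. -/
theorem energy_eq_inner (h : IsSolution n b T f u₀ u) {t : ℝ} (ht : t ∈ Icc 0 T) {v : L2 n}
    (hv : MemV n v) : energy n b (u t) v = inner ℝ (f t - derivWithin u (Icc 0 T) t) v := by
  have h1 := h.boundary t ht v hv
  set w := derivWithin u (Icc 0 T) t
  have h2 := inner_eq n (w - f t) v
  have h3 : ∫ x, (w - f t) x * v x ∂(ds n)
      = (∫ x, w x * v x ∂(ds n)) - ∫ x, f t x * v x ∂(ds n) := by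
    refine (integral_congr_ae ?_).trans (integral_sub
      ((memLp_ds n w).integrable_mul (memLp_ds n v))
      ((memLp_ds n (f t)).integrable_mul (memLp_ds n v)))
    have h4 : ∀ᵐ x ∂(ds n), (w - f t) x = (w - ⇑(f t)) x :=
      (Measure.absolutelyContinuous_of_le (Measure.le_add_left le_rfl)).ae_le
        (Lp.coeFn_sub w (f t))
    filter_upwards [h4] with x hx
    rw [hx]
    exact sub_mul _ _ _
  have h5 : inner ℝ (f t - w) v = -inner ℝ (w - f t) v := by rw [← inner_neg_left, neg_sub]
  rw [h5, h2, h3, energy]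
  rw [normalDeriv] at h1
  linarith

theorem continuousOn_derivWithin (h : IsSolution n b T f u₀ u) (hT : 0 < T) :
    ContinuousOn (derivWithin u (Icc 0 T)) (Icc 0 T) :=
  h.contDiff.continuousOn_derivWithin (uniqueDiffOn_Icc hT) le_rfl

/-- With $F=f-u'$, symmetry gives $(F(t),u(s))=(F(s),u(t))$, so the increment of the energy is
$(F(t)+F(s),u(t)-u(s))$. Only continuity of $F$ and differentiability of $u$ in $L^2(\Omega,m)$ are
then needed. -/
theorem hasDerivWithinAt_energy (h : IsSolution n b T f u₀ u) (hT : 0 < T)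
    (hf : ContinuousOn f (Icc 0 T)) {s : ℝ} (hs : s ∈ Icc 0 T) :
    HasDerivWithinAt (fun t => energy n b (u t) (u t))
      (2 * inner ℝ (f s - derivWithin u (Icc 0 T) s) (derivWithin u (Icc 0 T) s)) (Icc 0 T) s := by
  set F : ℝ → L2 n := fun t => f t - derivWithin u (Icc 0 T) t
  have hFc : ContinuousOn F (Icc 0 T) := hf.sub (h.continuousOn_derivWithin hT)
  have hdu : HasDerivWithinAt u (derivWithin u (Icc 0 T) s) (Icc 0 T) s :=
    ((h.contDiff.differentiableOn one_ne_zero) s hs).hasDerivWithinAt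
  rw [hasDerivWithinAt_iff_tendsto_slope] at hdu ⊢
  have hFt : Tendsto F (𝓝[Icc 0 T \ {s}] s) (𝓝 (F s)) :=
    (hFc s hs).mono_left (nhdsWithin_mono _ sdiff_subset)
  have hlim := (hFt.add_const (F s)).inner (𝕜 := ℝ) hdu
  rw [← two_smul ℝ (F s), real_inner_smul_left] at hlim
  refine hlim.congr' ?_
  filter_upwards [self_mem_nhdsWithin] with t ht
  have e1 := h.energy_eq_inner ht.1 (h.memV t ht.1)
  have e2 := h.energy_eq_inner ht.1 (h.memV s hs)
  have e3 := h.energy_eq_inner hs (h.memV s hs)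
  have e4 := h.energy_eq_inner hs (h.memV t ht.1)
  rw [energy_comm] at e4
  have e5 : inner ℝ (F t) (u s) = inner ℝ (F s) (u t) := e2.symm.trans e4
  rw [slope_def_module, slope_def_module, real_inner_smul_right, smul_eq_mul, e1, e3]
  congr 1
  change inner ℝ (F t + F s) (u t - u s) = inner ℝ (F t) (u t) - inner ℝ (F s) (u s)
  rw [inner_add_left, inner_sub_right, inner_sub_right, e5]
  ring

theorem energy_sub_eq (h : IsSolution n b T f u₀ u) (hT : 0 < T)
    (hf : ContinuousOn f (Icc 0 T)) {s t : ℝ} (hs : 0 ≤ s) (hst : s ≤ t) (ht : t ≤ T) :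
    ∫ τ in s..t, 2 * inner ℝ (f τ - derivWithin u (Icc 0 T) τ) (derivWithin u (Icc 0 T) τ)
      = energy n b (u t) (u t) - energy n b (u s) (u s) := by
  have hsub : Icc s t ⊆ Icc 0 T := Icc_subset_Icc hs ht
  have hd := h.continuousOn_derivWithin hT
  refine intervalIntegral.integral_eq_sub_of_hasDerivAt_of_le hst
    (f := fun t => energy n b (u t) (u t)) (fun τ hτ =>
      ((h.hasDerivWithinAt_energy hT hf (hsub hτ)).continuousWithinAt).mono hsub) (fun τ hτ => ?_) ?_
  · exact (h.hasDerivWithinAt_energy hT hf (hsub (Ioo_subset_Icc_self hτ))).hasDerivAt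
      (Icc_mem_nhds (hs.trans_lt hτ.1) (hτ.2.trans_le ht))
  · refine ContinuousOn.intervalIntegrable_of_Icc hst ?_
    exact (continuousOn_const.mul ((hf.sub hd).inner hd)).mono hsub

/-- The energy inequality, with a free parameter from Young's inequality. -/
theorem energy_add_le (h : IsSolution n b T f u₀ u) (hT : 0 < T)
    (hf : ContinuousOn f (Icc 0 T)) {s t : ℝ} (hs : 0 ≤ s) (hst : s ≤ t) (ht : t ≤ T) {l : ℝ}
    (hl : 0 < l) :
    energy n b (u t) (u t) + (2 - l) * ∫ τ in s..t, ‖derivWithin u (Icc 0 T) τ‖ ^ 2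
      ≤ energy n b (u s) (u s) + (∫ τ in s..t, ‖f τ‖ ^ 2) / l := by
  have hsub : Icc s t ⊆ Icc 0 T := Icc_subset_Icc hs ht
  have hd := h.continuousOn_derivWithin hT
  have i1 : IntervalIntegrable (fun τ => ‖derivWithin u (Icc 0 T) τ‖ ^ 2) volume s t :=
    ((hd.mono hsub).norm.pow 2).intervalIntegrable_of_Icc hst
  have i2 : IntervalIntegrable (fun τ => ‖f τ‖ ^ 2) volume s t :=
    ((hf.mono hsub).norm.pow 2).intervalIntegrable_of_Icc hst
  have i3 : IntervalIntegrable (fun τ => 2 * inner ℝ (f τ - derivWithin u (Icc 0 T) τ)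
      (derivWithin u (Icc 0 T) τ)) volume s t :=
    ((continuousOn_const.mul ((hf.sub hd).inner hd)).mono hsub).intervalIntegrable_of_Icc hst
  have key := intervalIntegral.integral_mono_on hst i3
    ((i2.div_const l).add (i1.const_mul (l - 2))) fun τ _ => by
      set w := derivWithin u (Icc 0 T) τ
      -- Young's inequality in the form $2(f,w)\le\frac1l\|f\|^2+l\|w\|^2$.
      have h1 : 0 ≤ ‖f τ - l • w‖ ^ 2 := by positivity
      rw [norm_sub_sq_real, real_inner_smul_right, norm_smul, Real.norm_eq_abs, mul_pow,
        sq_abs] at h1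
      rw [inner_sub_left, real_inner_self_eq_norm_sq]
      have h2 : 2 * inner ℝ (f τ) w ≤ ‖f τ‖ ^ 2 / l + l * ‖w‖ ^ 2 := by
        rw [← mul_le_mul_iff_right₀ hl]
        have : l * (‖f τ‖ ^ 2 / l + l * ‖w‖ ^ 2) = ‖f τ‖ ^ 2 + l ^ 2 * ‖w‖ ^ 2 := by
          field_simp
        rw [this]
        linarith
      linarith
  rw [h.energy_sub_eq hT hf hs hst ht, intervalIntegral.integral_add (i2.div_const l)
    (i1.const_mul (l - 2)), intervalIntegral.integral_div, intervalIntegral.integral_const_mul] at key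
  linarith

end IsSolution

end Venttsel

end

/-! ### The two a priori estimates -/

theorem mainTheorem10 (n : ℕ) (b : ℂ → ℝ)
    (hb : ContinuousOn b (closure (Venttsel.Omega n)))
    (hbpos : ∀ x ∈ closure (Venttsel.Omega n), 0 < b x) :
    (∃ Cbar : ℝ, Venttsel.IsCoercivityConstant n b Cbar) ∧
    ∃ Ctilde : ℝ, 0 < Ctilde ∧
      ∀ Cbar : ℝ, Venttsel.IsCoercivityConstant n b Cbar →
      ∀ T : ℝ, 0 < T →
      ∀ f : ℝ → Venttsel.L2 n,
      (∃ α Cf : ℝ≥0, 0 < α ∧ α < 1 ∧ HolderOnWith Cf α f (Icc 0 T)) →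
      ∀ (u₀ : Venttsel.L2 n) (u : ℝ → Venttsel.L2 n),
      Venttsel.IsSolution n b T f u₀ u →
        (∀ t ∈ Icc 0 T,
          (∫ τ in (0 : ℝ)..t, ‖derivWithin u (Icc 0 T) τ‖ ^ 2) + Venttsel.normV n (u t) ^ 2
            ≤ 1 / min 1 Cbar *
              (Ctilde * Venttsel.normV n u₀ ^ 2 + ∫ τ in (0 : ℝ)..t, ‖f τ‖ ^ 2)) ∧
        BddAbove ((fun t => Venttsel.normV n (u t) ^ 2) '' Icc 0 T) ∧
        (Cbar ≤ 3 / 4 →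
          (∫ τ in (0 : ℝ)..T, ‖derivWithin u (Icc 0 T) τ‖ ^ 2)
              + sSup ((fun t => Venttsel.normV n (u t) ^ 2) '' Icc 0 T)
            ≤ 1 / min 1 Cbar *
              (Ctilde * Venttsel.normV n u₀ ^ 2 + ∫ τ in (0 : ℝ)..T, ‖f τ‖ ^ 2)) := by
  refine ⟨Venttsel.exists_isCoercivityConstant n hb hbpos, ?_⟩
  obtain ⟨C, hC0, hC⟩ := Venttsel.energy_self_le n hb hbpos
  -- Part (i) needs only $C$; the factor $\frac32$ bounds $1+\frac23\bar C$ in (ii), where $\bar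
  -- C\le\frac34$.
  refine ⟨3 / 2 * C, by positivity, fun c hc T hT f hf u₀ u h => ?_⟩
  have hfc : ContinuousOn f (Icc 0 T) := by
    obtain ⟨α, Cf, hα, -, hf⟩ := hf
    exact hf.continuousOn hα
  set N := Venttsel.normV n u₀ ^ 2
  have hmem0 : Venttsel.MemV n (u 0) := h.memV 0 ⟨le_rfl, hT.le⟩
  have hE0 : Venttsel.energy n b (u 0) (u 0) ≤ C * N := by
    have := hC _ hmem0
    rwa [h.initial] at this ⊢
  have hN0 : 0 ≤ N := sq_nonneg _
  have hCN : 0 ≤ C * N := mul_nonneg hC0.le hN0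
  have hmin : 0 < min 1 c := lt_min one_pos hc.1
  have hint : ∀ g : ℝ → Venttsel.L2 n, ∀ s t : ℝ, s ≤ t → 0 ≤ ∫ τ in s..t, ‖g τ‖ ^ 2 :=
    fun g s t hst => intervalIntegral.integral_nonneg hst fun τ _ => by positivity
  have hone : ∀ t ∈ Icc 0 T,
      (∫ τ in (0 : ℝ)..t, ‖derivWithin u (Icc 0 T) τ‖ ^ 2) + Venttsel.normV n (u t) ^ 2
        ≤ 1 / min 1 c * (3 / 2 * C * N + ∫ τ in (0 : ℝ)..t, ‖f τ‖ ^ 2) := fun t ht => by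
    have h1 := h.energy_add_le hT hfc le_rfl ht.1 ht.2 one_pos
    have h2 := hc.2 _ (h.memV t ht)
    have h3 := mul_le_mul_of_nonneg_right (min_le_left 1 c)
      (hint (derivWithin u (Icc 0 T)) 0 t ht.1)
    have h4 := mul_le_mul_of_nonneg_right (min_le_right 1 c) (sq_nonneg (Venttsel.normV n (u t)))
    rw [one_div, ← div_eq_inv_mul, le_div_iff₀ hmin]
    linarith
  refine ⟨hone, ⟨1 / min 1 c * (3 / 2 * C * N + ∫ τ in (0 : ℝ)..T, ‖f τ‖ ^ 2), ?_⟩, fun hc34 => ?_⟩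
  · rintro _ ⟨t, ht, rfl⟩
    have h1 := hint (derivWithin u (Icc 0 T)) 0 t ht.1
    refine (le_add_of_nonneg_left h1).trans ((hone t ht).trans ?_)
    have h2 : ∫ τ in (0 : ℝ)..t, ‖f τ‖ ^ 2 ≤ ∫ τ in (0 : ℝ)..T, ‖f τ‖ ^ 2 :=
      intervalIntegral.integral_mono_interval le_rfl ht.1 ht.2
        (ae_of_all _ fun τ => by positivity)
        ((hfc.norm.pow 2).intervalIntegrable_of_Icc hT.le)
    gcongr
  · rw [min_eq_right (by linarith)]
    rw [← le_sub_iff_add_le']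
    refine csSup_le ((nonempty_Icc.2 hT.le).image _) ?_
    rintro _ ⟨t, ht, rfl⟩
    rw [le_sub_iff_add_le', one_div, ← div_eq_inv_mul, le_div_iff₀ hc.1]
    have hi : ∀ g : ℝ → Venttsel.L2 n, ContinuousOn g (Icc 0 T) →
        ∫ τ in (0 : ℝ)..T, ‖g τ‖ ^ 2
          = (∫ τ in (0 : ℝ)..t, ‖g τ‖ ^ 2) + ∫ τ in t..T, ‖g τ‖ ^ 2 := fun g hg =>
      (intervalIntegral.integral_add_adjacent_intervals
        (((hg.mono (Icc_subset_Icc le_rfl ht.2)).norm.pow 2).intervalIntegrable_of_Icc ht.1)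
        (((hg.mono (Icc_subset_Icc ht.1 le_rfl)).norm.pow 2).intervalIntegrable_of_Icc ht.2)).symm
    rw [hi f hfc, hi _ (h.continuousOn_derivWithin hT)]
    -- On $[t,T]$ the choice $l=\frac12$ gives $cA_2\le\frac{2c}3X+\frac{4c}3F_2$, with
    -- $\frac{4c}3\le1$. On $[0,t]$ the coefficient of $X$ must therefore be $1+\frac{2c}3$ after
    -- scaling $F_1$ to coefficient $1$, which dictates this $l$; then $l(2-l)=1-\frac{4c^2}9$.
    have hl : 0 < 1 + 2 * c / 3 := by have := hc.1; positivity
    have h1 := h.energy_add_le hT hfc le_rfl ht.1 ht.2 hl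
    have h2 := h.energy_add_le hT hfc ht.1 ht.2 le_rfl one_half_pos
    have h3 := hc.2 _ (h.memV t ht)
    have h4 : 0 ≤ Venttsel.energy n b (u T) (u T) :=
      (mul_nonneg hc.1.le (sq_nonneg _)).trans (hc.2 _ (h.memV T ⟨hT.le, le_rfl⟩))
    have h5 := hint (derivWithin u (Icc 0 T)) 0 t ht.1
    have h6 := hint f t T ht.2
    set A₁ := ∫ τ in (0 : ℝ)..t, ‖derivWithin u (Icc 0 T) τ‖ ^ 2
    set A₂ := ∫ τ in t..T, ‖derivWithin u (Icc 0 T) τ‖ ^ 2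
    set F₁ := ∫ τ in (0 : ℝ)..t, ‖f τ‖ ^ 2
    set F₂ := ∫ τ in t..T, ‖f τ‖ ^ 2
    set X := Venttsel.energy n b (u t) (u t)
    have h7 : (1 + 2 * c / 3) * X + (1 - 4 * c ^ 2 / 9) * A₁
        ≤ (1 + 2 * c / 3) * Venttsel.energy n b (u 0) (u 0) + F₁ := by
      have := mul_le_mul_of_nonneg_left h1 hl.le
      have e : (1 + 2 * c / 3) * (F₁ / (1 + 2 * c / 3)) = F₁ := mul_div_cancel₀ _ hl.ne'
      rw [mul_add, mul_add, e] at this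
      linarith
    -- For $0<c\le\frac34$ one has $1-\frac{4c^2}9\ge\frac34\ge c$.
    have h8 : c * A₁ ≤ (1 - 4 * c ^ 2 / 9) * A₁ :=
      mul_le_mul_of_nonneg_right (by nlinarith [hc.1]) h5
    have h9 : c * (3 / 2 * A₂) ≤ c * (X + 2 * F₂) :=
      mul_le_mul_of_nonneg_left (by linarith) hc.1.le
    have h10 : c * F₂ ≤ 3 / 4 * F₂ := mul_le_mul_of_nonneg_right hc34 h6
    have h11 : (1 + 2 * c / 3) * Venttsel.energy n b (u 0) (u 0) ≤ 3 / 2 * (C * N) :=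
      (mul_le_mul_of_nonneg_left hE0 hl.le).trans
        (mul_le_mul_of_nonneg_right (by linarith) hCN)
    linarith
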